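/- Let $d\ge 2$ and $\gamma\in\left(\frac{d-1}{d},1\right)$. A $\gamma$-Hölder domain is a nonempty, bounded, connected, open set $\Omega\subset\mathbb{R}^d$ which near each of its boundary points is, up to a rotation and translation of the coordinates, the region below the graph of a function $f$ satisfying $|f(x)-f(y)|\le c|x-y|^\gamma$ for some constant $c>0$ and all $x,y$ in its domain, an open bounded subset of $\mathbb{R}^{d-1}$. There exist a $\gamma$-Hölder domain $\Omega\subset\mathbb{R}^d$ and a measurable potential $V:\Omega\to(-\infty,0]$ with $V\in L^{d/2}(\Omega)$ such that (i) for every $\lambda>0$ the quadratic form $\int_\Omega|\nabla u|^2+\lambda\int_\Omega V|u|^2$, defined for those $u\in H^1(\Omega)$ with $V|u|^2\in L^1(\Omega)$, is densely defined in $L^2(\Omega)$, bounded from below and closed, so that it defines a self-adjoint operator $-\Delta^N_\Omega+\lambda V$ in $L^2(\Omega)$, and (ii) the number $N(-\Delta^N_\Omega+\lambda V)$ of negative eigenvalues of this operator, counted with multiplicity, satisfies $$\limsup_{\lambda\to\infty}\frac{N(-\Delta^N_\Omega+\lambda V)}{\lambda^{d/2}}=\infty .$$ -/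

import Mathlib

open MeasureTheory Filter Topology
open scoped ENNReal ContDiff

noncomputable section

namespace NeumannSchrodinger

/-- A `γ`-Hölder domain in `ℝ^d`: a nonempty bounded connected open set which, near each of its
boundary points `z`, is the region lying below the graph, in some direction `ν`, of a `γ`-Hölder
continuous function `f` defined on an open bounded subset `A` of the hyperplane orthogonal to `ν`.
(Near `z`, the boundary is then exactly the graph of `f`.) -/
def IsHolderDomain {d : ℕ} (γ : ℝ) (Ω : Set (EuclideanSpace ℝ (Fin d))) : Prop :=
  IsOpen Ω ∧ Bornology.IsBounded Ω ∧ IsConnected Ω ∧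
    ∀ z ∈ frontier Ω, ∃ ν : EuclideanSpace ℝ (Fin d), ‖ν‖ = 1 ∧
      ∃ (A : Set (Submodule.span ℝ {ν})ᗮ) (f : (Submodule.span ℝ {ν})ᗮ → ℝ) (c : ℝ),
        IsOpen A ∧ Bornology.IsBounded A ∧ 0 < c ∧
        (∀ x ∈ A, ∀ y ∈ A, |f x - f y| ≤ c * ‖x - y‖ ^ γ) ∧
        ∃ U : Set (EuclideanSpace ℝ (Fin d)), IsOpen U ∧ z ∈ U ∧
          ∀ x ∈ U, (Submodule.span ℝ {ν})ᗮ.orthogonalProjectionOnto x ∈ A ∧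
            (x ∈ Ω ↔ inner ℝ ν x < f ((Submodule.span ℝ {ν})ᗮ.orthogonalProjectionOnto x))

/-- The Hilbert space `L²(Ω)` of complex-valued functions. -/
abbrev L2 {d : ℕ} (Ω : Set (EuclideanSpace ℝ (Fin d))) : Type :=
  Lp ℂ 2 (volume.restrict Ω)

/-- `g = (g₁, …, g_d)` is the weak (distributional) gradient of `u` in `Ω`. -/
def IsWeakGradient {d : ℕ} (Ω : Set (EuclideanSpace ℝ (Fin d)))
    (u : L2 Ω) (g : Fin d → L2 Ω) : Prop :=
  ∀ (i : Fin d) (φ : EuclideanSpace ℝ (Fin d) → ℝ),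
    ContDiff ℝ ∞ φ → HasCompactSupport φ → tsupport φ ⊆ Ω →
      ∫ x in Ω, (fderiv ℝ φ x (EuclideanSpace.single i 1)) • u x = - ∫ x in Ω, φ x • g i x

/-- The Sobolev space `H¹(Ω)`, each function `u` being listed together with its weak gradient, as
the pair `(u, ∇u)`. -/
def H1 {d : ℕ} (Ω : Set (EuclideanSpace ℝ (Fin d))) : Set (L2 Ω × (Fin d → L2 Ω)) :=
  {U | IsWeakGradient Ω U.1 U.2}

/-- The form domain of `-Δ + V` with Neumann boundary conditions: the functions in `H¹(Ω)` with
finite potential energy. -/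
def formDomain {d : ℕ} (Ω : Set (EuclideanSpace ℝ (Fin d)))
    (V : EuclideanSpace ℝ (Fin d) → ℝ) : Set (L2 Ω × (Fin d → L2 Ω)) :=
  {U | U ∈ H1 Ω ∧ Integrable (fun x => V x * ‖U.1 x‖ ^ 2) (volume.restrict Ω)}

/-- The sesquilinear form `∫_Ω conj(∇u) · ∇w + ∫_Ω V conj(u) w`, conjugate-linear in the first
argument. -/
def form {d : ℕ} (Ω : Set (EuclideanSpace ℝ (Fin d))) (V : EuclideanSpace ℝ (Fin d) → ℝ)
    (U W : L2 Ω × (Fin d → L2 Ω)) : ℂ :=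
  (∑ i, inner ℂ (U.2 i) (W.2 i)) + ∫ x in Ω, (V x : ℂ) * inner ℂ (U.1 x) (W.1 x)

/-- The quadratic form `∫_Ω |∇u|² + ∫_Ω V |u|²`. -/
def quadForm {d : ℕ} (Ω : Set (EuclideanSpace ℝ (Fin d))) (V : EuclideanSpace ℝ (Fin d) → ℝ)
    (U : L2 Ω × (Fin d → L2 Ω)) : ℝ :=
  (∑ i, ‖U.2 i‖ ^ 2) + ∫ x in Ω, V x * ‖U.1 x‖ ^ 2

/-- The quadratic form of `-Δ + V` is densely defined, bounded from below and closed, so that it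
is the form of a unique self-adjoint operator in `L²(Ω)`, bounded from below. -/
def IsWellPosed {d : ℕ} (Ω : Set (EuclideanSpace ℝ (Fin d)))
    (V : EuclideanSpace ℝ (Fin d) → ℝ) : Prop :=
  Dense {u : L2 Ω | ∃ U ∈ formDomain Ω V, U.1 = u} ∧
  (∃ m : ℝ, ∀ U ∈ formDomain Ω V, -m * ‖U.1‖ ^ 2 ≤ quadForm Ω V U) ∧
  (∀ (U : ℕ → L2 Ω × (Fin d → L2 Ω)) (u : L2 Ω), (∀ n, U n ∈ formDomain Ω V) →
    Tendsto (fun n => (U n).1) atTop (𝓝 u) →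
    Tendsto (fun p : ℕ × ℕ => quadForm Ω V (U p.1 - U p.2)) atTop (𝓝 0) →
    ∃ W ∈ formDomain Ω V, W.1 = u ∧ Tendsto (fun n => quadForm Ω V (U n - W)) atTop (𝓝 0))

/-- The graph of the operator `H = -Δ + V` in `L²(Ω)` with Neumann boundary conditions, that is, of
the operator of the above form: `u` lies in the domain of `H` and `H u = w` if and only if `u` lies
in the form domain and the form at `(v, u)` equals `⟨v, w⟩` for each `v` in the form domain. -/
def operatorGraph {d : ℕ} (Ω : Set (EuclideanSpace ℝ (Fin d)))
    (V : EuclideanSpace ℝ (Fin d) → ℝ) : Set (L2 Ω × L2 Ω) :=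
  {p | ∃ U ∈ formDomain Ω V, U.1 = p.1 ∧
    ∀ W ∈ formDomain Ω V, form Ω V W U = inner ℂ W.1 p.2}

/-- `N(-Δ + V)`: the number of negative eigenvalues, counted with multiplicity, of the operator
`-Δ + V` in `L²(Ω)` with Neumann boundary conditions, as the dimension of the linear span of all
eigenfunctions with a negative eigenvalue (eigenspaces of a self-adjoint operator for different
eigenvalues being linearly independent). -/
def numNegEigenvalues {d : ℕ} (Ω : Set (EuclideanSpace ℝ (Fin d)))
    (V : EuclideanSpace ℝ (Fin d) → ℝ) : ℕ∞ :=
  Cardinal.toENat (Module.rank ℂ (Submodule.span ℂ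
    {u : L2 Ω | ∃ μ : ℝ, μ < 0 ∧ (u, (μ : ℂ) • u) ∈ operatorGraph Ω V}))

end NeumannSchrodinger

end

/-! Put n = d - 1. The domain |x'|^γ + |x₀| < 1 has a cusp at the tip e₀: at depth r = 1 - x₀ its
section is an n-ball of radius r^(1/γ), so slices have measure of order r^a with a = n / γ > n. The
potential is V = -r⁻² (2 - log r)^(-1/d). The factor r⁻² scales like the Laplacian, so all dyadic
layers r ~ 2⁻ᵏ are equally able to carry a negative state, up to the logarithm. The thinness of the
cusp still leaves V in L^(d/2): |V|^(d/2) ≤ r^(-d), and r^(a - d) is integrable at 0 because a > d -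
1 (`memLp_cuspPotential`).

Counting: a bump in the layer r ~ 2⁻ᵏ has gradient energy of order 4ᵏ m and potential energy of
order -t 4ᵏ k^(-1/d) m, where m is the volume of the layer. The total is negative as long as k is
below a multiple of t^d (`exists_energy_trial_neg`). Bumps in different layers have disjoint
supports, so there are at least c t^d negative eigenvalues for large t, which beats t^(d/2).

Well-posedness for every t: the weight r^a with a > 1 admits a Hardy inequality, so r⁻² is
form-bounded (`hardy_doubleCusp_of_mem_H1`). The logarithmic factor tends to zero at the tip and
turns this into relative form bound zero (`isFormSmall_cuspPotential`), whence the form is closed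
and semibounded on all of H¹ (`isWellPosed_of_isFormSmall`).

From test functions to eigenvalues: if there were too few negative eigenvectors, the form would
still be negative somewhere orthogonally to them; minimising the Rayleigh quotient there yields one
more (`le_rank_span_negative_eigenvectors`). The minimiser exists by Rellich's theorem
(`exists_tendsto_subseq_of_bounded`). Rellich's theorem and the density of smooth functions in H¹
may fail on general rough domains; here they follow from star-shapedness, by contracting towards the
origin and then mollifying (`smear`). -/

open NeumannSchrodinger

/-! ### Variational lower bound for the number of negative eigenvalues, in abstract form. -/

section SpectralLowerBound

variable {H X : Type*} [NormedAddCommGroup H] [InnerProductSpace ℂ H] [AddCommGroup X] [Module ℂ X]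

/-- Parallelogram identity for a sesquilinear form. -/
theorem sesq_parallelogram (b : X →ₗ⋆[ℂ] X →ₗ[ℂ] ℂ) (x y : X) :
    (b (x + y) (x + y)).re + (b (x - y) (x - y)).re = 2 * (b x x).re + 2 * (b y y).re := by
  simp only [map_add, map_sub, LinearMap.add_apply, LinearMap.sub_apply, Complex.add_re,
    Complex.sub_re]
  ring

theorem sesq_smul_re (b : X →ₗ⋆[ℂ] X →ₗ[ℂ] ℂ) (c : ℂ) (x : X) :
    (b (c • x) (c • x)).re = ‖c‖ ^ 2 * (b x x).re := by
  simp only [LinearMap.map_smulₛₗ, LinearMap.smul_apply, map_smul, smul_eq_mul]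
  rw [← mul_assoc, Complex.mul_conj', ← Complex.ofReal_pow, Complex.re_ofReal_mul]

theorem sesq_add_re (b : X →ₗ⋆[ℂ] X →ₗ[ℂ] ℂ) (hb : ∀ x y, (starRingEnd ℂ) (b x y) = b y x)
    (x y : X) : (b (x + y) (x + y)).re = (b x x).re + 2 * (b y x).re + (b y y).re := by
  have h : (b x y).re = (b y x).re := by rw [← hb x y, Complex.conj_re]
  simp only [map_add, LinearMap.add_apply, Complex.add_re, h]
  ring

/-- A hermitian form that is bounded below by `μ‖·‖²` on a submodule `M`, with equality at `W ∈ M`,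
satisfies the eigenvalue equation at `W` against `M`. -/
theorem sesq_eq_of_minimizer (ι : X →ₗ[ℂ] H) (b : X →ₗ⋆[ℂ] X →ₗ[ℂ] ℂ)
    (hb : ∀ x y, (starRingEnd ℂ) (b x y) = b y x) (M : Submodule ℂ X) (μ : ℝ)
    (hμ : ∀ x ∈ M, μ * ‖ι x‖ ^ 2 ≤ (b x x).re) {W : X} (hW : W ∈ M)
    (hq : (b W W).re = μ * ‖ι W‖ ^ 2) {w : X} (hw : w ∈ M) :
    b w W = (μ : ℂ) * inner ℂ (ι w) (ι W) := by
  have key : ∀ w ∈ M, (b w W).re = μ * (inner ℂ (ι w) (ι W)).re := by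
    intro w hw
    set β := (b w W).re - μ * (inner ℂ (ι w) (ι W)).re with hβ
    set A := (b w w).re - μ * ‖ι w‖ ^ 2 with hA
    have h1 : ∀ t : ℝ, 0 ≤ 2 * t * β + t ^ 2 * A := by
      intro t
      have h := hμ (W + (t : ℂ) • w) (M.add_mem hW (M.smul_mem _ hw))
      rw [sesq_add_re b hb, sesq_smul_re, map_add, @norm_add_sq ℂ, map_smul, norm_smul,
        inner_smul_right, hq] at h
      simp only [LinearMap.map_smulₛₗ, LinearMap.smul_apply, smul_eq_mul, Complex.conj_ofReal,
        Complex.re_ofReal_mul, RCLike.re_to_complex, Complex.norm_real, Real.norm_eq_abs,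
        sq_abs, mul_pow] at h
      have h2 : (inner ℂ (ι W) (ι w) : ℂ).re = (inner ℂ (ι w) (ι W) : ℂ).re := by
        rw [← inner_conj_symm, Complex.conj_re]
      rw [h2] at h
      rw [hβ, hA]
      nlinarith [h]
    have hA0 : 0 ≤ A := by rw [hA]; linarith [hμ w hw]
    -- Nearly the minimiser of the quadratic in t; the denominator A + 1 instead of A covers A = 0.
    have h2 := h1 (-(β / (A + 1)))
    have h3 : 2 * -(β / (A + 1)) * β + (-(β / (A + 1))) ^ 2 * A
        = -(β ^ 2 * (A + 2) / (A + 1) ^ 2) := by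
      field_simp
      ring
    rw [h3] at h2
    have h4 : β ^ 2 * (A + 2) / (A + 1) ^ 2 ≤ 0 := by linarith
    have h5 : β ^ 2 ≤ 0 := by
      by_contra hc
      push Not at hc
      have : 0 < β ^ 2 * (A + 2) / (A + 1) ^ 2 := by positivity
      linarith
    have : β = 0 := by nlinarith
    linarith
  apply Complex.ext
  · simpa using key w hw
  -- Replacing w by i w exchanges real and imaginary parts.
  · have h := key (Complex.I • w) (M.smul_mem _ hw)
    simp only [LinearMap.map_smulₛₗ, LinearMap.smul_apply, smul_eq_mul, map_smul,
      inner_smul_left, Complex.conj_I] at h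
    simpa using h

/-- Variational lower bound for the number of negative eigenvalues: a closed semibounded hermitian
form with compact form domain that is negative on `N` mutually form-orthogonal vectors has
at least `N` negative eigenvalues. -/
theorem le_rank_span_negative_eigenvectors (ι : X →ₗ[ℂ] H) (b : X →ₗ⋆[ℂ] X →ₗ[ℂ] ℂ)
    (hb : ∀ x y, (starRingEnd ℂ) (b x y) = b y x) (m : ℝ)
    (hm : ∀ x, -m * ‖ι x‖ ^ 2 ≤ (b x x).re)
    (hclosed : ∀ (x : ℕ → X) (u : H), Tendsto (fun k => ι (x k)) atTop (𝓝 u) →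
      Tendsto (fun p : ℕ × ℕ => (b (x p.1 - x p.2) (x p.1 - x p.2)).re) atTop (𝓝 0) →
      ∃ w, ι w = u ∧ Tendsto (fun k => (b (x k - w) (x k - w)).re) atTop (𝓝 0))
    (hcomp : ∀ (x : ℕ → X) (C : ℝ), (∀ k, ‖ι (x k)‖ ≤ C) → (∀ k, (b (x k) (x k)).re ≤ C) →
      ∃ φ : ℕ → ℕ, StrictMono φ ∧ ∃ u, Tendsto (fun k => ι (x (φ k))) atTop (𝓝 u))
    {N : ℕ} (e : Fin N → X) (horth : ∀ i j, i ≠ j → b (e i) (e j) = 0)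
    (hneg : ∀ i, (b (e i) (e i)).re < 0) :
    (N : ℕ∞) ≤ Cardinal.toENat (Module.rank ℂ (Submodule.span ℂ
      {u : H | ∃ μ : ℝ, μ < 0 ∧ ∃ x, ι x = u ∧ ∀ w, b w x = inner ℂ (ι w) ((μ : ℂ) • u)})) := by
  set T := {u : H | ∃ μ : ℝ, μ < 0 ∧ ∃ x, ι x = u ∧ ∀ w, b w x = inner ℂ (ι w) ((μ : ℂ) • u)}
    with hT
  set E := Submodule.span ℂ T with hE
  by_contra hlt
  push Not at hlt
  have hrank : Module.rank ℂ E < N := by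
    rw [← Cardinal.toENat_lt_natCast]; exact hlt
  have hfin : FiniteDimensional ℂ E := by
    rw [FiniteDimensional, ← Module.rank_lt_aleph0_iff]
    exact hrank.trans (Cardinal.natCast_lt_aleph0)
  have hfr : Module.finrank ℂ E < N := by
    rw [← Module.finrank_eq_rank] at hrank
    exact_mod_cast hrank
  -- the elements of the domain orthogonal to the eigenvectors
  set M : Submodule ℂ X := Eᗮ.comap ι with hM
  have hMmem : ∀ x, x ∈ M ↔ ∀ v ∈ E, inner ℂ v (ι x) = 0 := fun x => Submodule.mem_orthogonal _ _
  -- Dimension count: projecting combinations of the N vectors `e i` to `E`, of dimension below N,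
  -- has a nontrivial kernel. Form-orthogonality makes `b` diagonal on these combinations, hence
  -- negative.
  obtain ⟨x₀, hx₀M, hx₀⟩ : ∃ x ∈ M, (b x x).re < 0 := by
    let F : (Fin N → ℂ) →ₗ[ℂ] E :=
      (E.orthogonalProjectionOnto : H →L[ℂ] E).toLinearMap ∘ₗ ι ∘ₗ Fintype.linearCombination ℂ e
    have : ¬ Function.Injective F := by
      intro hinj
      have := LinearMap.finrank_le_finrank_of_injective hinj
      simp at this
      omega
    rw [← LinearMap.ker_eq_bot, ← ne_eq, Submodule.ne_bot_iff] at this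
    obtain ⟨c, hc, hc0⟩ := this
    refine ⟨∑ i, c i • e i, ?_, ?_⟩
    · rw [hM, Submodule.mem_comap, ← Submodule.orthogonalProjectionOnto_eq_zero_iff]
      simpa [F, Fintype.linearCombination_apply] using hc
    · have h1 : (b (∑ i, c i • e i) (∑ i, c i • e i)).re
          = ∑ i, ‖c i‖ ^ 2 * (b (e i) (e i)).re := by
        rw [map_sum, Complex.re_sum]
        refine Finset.sum_congr rfl fun i _ => ?_
        rw [map_sum, LinearMap.sum_apply, Finset.sum_eq_single i, sesq_smul_re]
        · intro j _ hj
          simp [horth j i hj]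
        · simp
      rw [h1]
      obtain ⟨i, hi⟩ := Function.ne_iff.mp hc0
      refine Finset.sum_neg' (fun j _ => ?_) ⟨i, Finset.mem_univ _, ?_⟩
      · exact mul_nonpos_of_nonneg_of_nonpos (by positivity) (hneg j).le
      · exact mul_neg_of_pos_of_neg (pow_pos (norm_pos_iff.mpr hi) 2) (hneg i)
  have hscale : ∀ x, ι x ≠ 0 → ‖ι (((‖ι x‖⁻¹ : ℝ) : ℂ) • x)‖ = 1 := by
    intro x hx
    rw [map_smul, norm_smul, Complex.norm_real, Real.norm_eq_abs, abs_inv, abs_norm,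
      inv_mul_cancel₀ (norm_ne_zero_iff.mpr hx)]
  have hqscale : ∀ x, (b (((‖ι x‖⁻¹ : ℝ) : ℂ) • x) (((‖ι x‖⁻¹ : ℝ) : ℂ) • x)).re
      = (b x x).re / ‖ι x‖ ^ 2 := by
    intro x
    rw [sesq_smul_re, Complex.norm_real, Real.norm_eq_abs, abs_inv, abs_norm]
    ring
  -- `ι` need not be injective; semiboundedness excludes a negative form value on its kernel.
  have hιx₀ : ι x₀ ≠ 0 := by
    intro h
    have := hm x₀
    simp [h] at this
    linarith
  set S : Set ℝ := {r | ∃ x ∈ M, ‖ι x‖ = 1 ∧ (b x x).re = r} with hS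
  have hSbdd : BddBelow S := by
    refine ⟨-m, ?_⟩
    rintro r ⟨x, _, hx, rfl⟩
    have := hm x
    rw [hx] at this
    linarith
  have hS0 : (b x₀ x₀).re / ‖ι x₀‖ ^ 2 ∈ S :=
    ⟨_, M.smul_mem _ hx₀M, hscale x₀ hιx₀, hqscale x₀⟩
  set μ := sInf S with hμdef
  have hμneg : μ < 0 := by
    refine (csInf_le hSbdd hS0).trans_lt (div_neg_of_neg_of_pos hx₀ ?_)
    have := norm_pos_iff.mpr hιx₀
    positivity
  have hμle : ∀ x ∈ M, μ * ‖ι x‖ ^ 2 ≤ (b x x).re := by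
    intro x hx
    by_cases h0 : ι x = 0
    · have := hm x
      simp [h0] at this ⊢
      exact this
    · have h1 : μ ≤ (b x x).re / ‖ι x‖ ^ 2 :=
        csInf_le hSbdd ⟨_, M.smul_mem _ hx, hscale x h0, hqscale x⟩
      have := norm_pos_iff.mpr h0
      rwa [le_div_iff₀ (by positivity)] at h1
  obtain ⟨r, -, hr, hrS⟩ := exists_seq_tendsto_sInf ⟨_, hS0⟩ hSbdd
  choose y hyM hy1 hyr using hrS
  obtain ⟨C, hC⟩ := hr.bddAbove_range
  obtain ⟨φ, hφ, u, hu⟩ := hcomp y (max 1 C) (fun k => by rw [hy1]; exact le_max_left _ _)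
    (fun k => by rw [hyr]; exact (hC ⟨k, rfl⟩).trans (le_max_right _ _))
  set z : ℕ → X := fun k => y (φ k) with hz
  have hzq : Tendsto (fun k => (b (z k) (z k)).re) atTop (𝓝 μ) := by
    have := hr.comp hφ.tendsto_atTop
    refine this.congr fun k => ?_
    simp [hz, hyr]
  have hu1 : ‖u‖ = 1 := by
    refine tendsto_nhds_unique (hu.norm) ?_
    simp [hy1]
  -- A minimising sequence is form-Cauchy: by the parallelogram identity and the bound `μ` at the
  -- sum of two terms, the form of the difference is at most a quantity tending to 2μ + 2μ - μ‖2u‖²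
  -- = 0; from below it is controlled by `m`.
  have hcauchy : Tendsto (fun p : ℕ × ℕ => (b (z p.1 - z p.2) (z p.1 - z p.2)).re) atTop
      (𝓝 0) := by
    have hu1' : Tendsto (fun p : ℕ × ℕ => ι (z p.1)) atTop (𝓝 u) := by
      rw [← prod_atTop_atTop_eq]; exact hu.comp tendsto_fst
    have hu2' : Tendsto (fun p : ℕ × ℕ => ι (z p.2)) atTop (𝓝 u) := by
      rw [← prod_atTop_atTop_eq]; exact hu.comp tendsto_snd
    have hq1 : Tendsto (fun p : ℕ × ℕ => (b (z p.1) (z p.1)).re) atTop (𝓝 μ) := by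
      rw [← prod_atTop_atTop_eq]; exact hzq.comp tendsto_fst
    have hq2 : Tendsto (fun p : ℕ × ℕ => (b (z p.2) (z p.2)).re) atTop (𝓝 μ) := by
      rw [← prod_atTop_atTop_eq]; exact hzq.comp tendsto_snd
    have hlow : Tendsto (fun p : ℕ × ℕ => -m * ‖ι (z p.1) - ι (z p.2)‖ ^ 2) atTop (𝓝 0) := by
      have := ((hu1'.sub hu2').norm.pow 2).const_mul (-m)
      simpa using this
    have hup : Tendsto (fun p : ℕ × ℕ => 2 * (b (z p.1) (z p.1)).re + 2 * (b (z p.2) (z p.2)).re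
        - μ * ‖ι (z p.1) + ι (z p.2)‖ ^ 2) atTop (𝓝 0) := by
      have := ((hq1.const_mul 2).add (hq2.const_mul 2)).sub
        (((hu1'.add hu2').norm.pow 2).const_mul μ)
      convert this using 2
      rw [← two_smul ℝ u, norm_smul, hu1]
      norm_num
      ring
    refine tendsto_of_tendsto_of_tendsto_of_le_of_le hlow hup (fun p => ?_) (fun p => ?_)
    · have := hm (z p.1 - z p.2)
      rwa [map_sub] at this
    · have h1 := sesq_parallelogram b (z p.1) (z p.2)
      have h2 := hμle (z p.1 + z p.2) (M.add_mem (hyM _) (hyM _))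
      rw [map_add] at h2
      simp only
      linarith
  obtain ⟨W, hWu, hW⟩ := hclosed z u hu hcauchy
  have hWM : W ∈ M := by
    rw [hMmem]
    intro v hv
    rw [hWu]
    refine tendsto_nhds_unique (tendsto_const_nhds.inner hu) ?_
    have : ∀ k, inner ℂ v (ι (y (φ k))) = (0 : ℂ) := fun k => (hMmem _).mp (hyM _) v hv
    simp [this]
  -- Lower semicontinuity from the parallelogram identity for z and z - W, whose sum 2z - W lies in
  -- `M` and whose difference is W.
  have hqW : (b W W).re = μ * ‖ι W‖ ^ 2 := by
    refine le_antisymm ?_ (hμle W hWM)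
    rw [hWu, hu1]
    have hup : Tendsto (fun k => 2 * (b (z k) (z k)).re + 2 * (b (z k - W) (z k - W)).re
        - μ * ‖ι (z k) + (ι (z k) - ι W)‖ ^ 2) atTop (𝓝 (μ * 1 ^ 2)) := by
      have := ((hzq.const_mul 2).add (hW.const_mul 2)).sub
        (((hu.add (hu.sub_const (ι W))).norm.pow 2).const_mul μ)
      convert this using 2
      rw [hWu, sub_self, add_zero, hu1]
      ring
    refine ge_of_tendsto' hup fun k => ?_
    have h1 := sesq_parallelogram b (z k) (z k - W)
    have h2 := hμle (z k + (z k - W)) (M.add_mem (hyM _) (M.sub_mem (hyM _) hWM))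
    rw [map_add, map_sub] at h2
    rw [sub_sub_cancel] at h1
    linarith
  -- Eigenvectors are form-orthogonal to `M`. Subtracting such a lift of the projection to `E`
  -- brings any w into `M`, which extends the eigenvalue equation of the minimiser from `M` to the
  -- whole form domain.
  have hlift : ∀ v ∈ E, ∃ x, ι x = v ∧ ∀ w ∈ M, b w x = 0 := by
    intro v hv
    induction hv using Submodule.span_induction with
    | mem v hv =>
      obtain ⟨ν, hν, x, hx, hxe⟩ := hv
      refine ⟨x, hx, fun w hw => ?_⟩
      rw [hxe, inner_smul_right, ← inner_conj_symm, (hMmem w).mp hw v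
        (Submodule.subset_span ⟨ν, hν, x, hx, hxe⟩)]
      simp
    | zero => exact ⟨0, map_zero _, fun w _ => map_zero _⟩
    | add v v' _ _ h h' =>
      obtain ⟨x, rfl, hx⟩ := h
      obtain ⟨x', rfl, hx'⟩ := h'
      exact ⟨x + x', map_add _ _ _, fun w hw => by rw [map_add, hx w hw, hx' w hw, add_zero]⟩
    | smul c v _ h =>
      obtain ⟨x, rfl, hx⟩ := h
      exact ⟨c • x, map_smul _ _ _, fun w hw => by rw [map_smul, hx w hw, smul_zero]⟩
  have hWeig : ∀ w, b w W = inner ℂ (ι w) ((μ : ℂ) • u) := by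
    intro w
    obtain ⟨x, hx, hxM⟩ := hlift (E.orthogonalProjectionOnto (ι w)) (Subtype.mem _)
    have hwx : w - x ∈ M := by
      rw [hM, Submodule.mem_comap, map_sub, hx]
      exact Submodule.sub_starProjection_mem_orthogonal _
    have h1 := sesq_eq_of_minimizer ι b hb M μ hμle hWM hqW hwx
    have h2 : b x W = 0 := by rw [← hb, hxM W hWM, map_zero]
    have h3 : inner ℂ (ι x) (ι W) = (0 : ℂ) := by
      rw [hx]; exact (hMmem W).mp hWM _ (Subtype.mem _)
    rw [map_sub, LinearMap.sub_apply, h2, sub_zero, map_sub, inner_sub_left, h3, sub_zero] at h1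
    rw [h1, inner_smul_right, hWu]
  -- The new eigenvector lies both in `E` and in its orthogonal complement, yet has norm one.
  have huE : u ∈ E := Submodule.subset_span ⟨μ, hμneg, W, hWu, hWeig⟩
  have : inner ℂ u u = (0 : ℂ) := by
    have := (hMmem W).mp hWM u huE
    rwa [hWu] at this
  rw [inner_self_eq_zero] at this
  simp [this] at hu1

end SpectralLowerBound

/-! ### The double cusp and its Hölder charts. -/

section Geometry

theorem abs_rpow_sub_rpow_le {a b γ : ℝ} (ha : 0 ≤ a) (hb : 0 ≤ b) (h0 : 0 ≤ γ) (h1 : γ ≤ 1) :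
    |a ^ γ - b ^ γ| ≤ |a - b| ^ γ := by
  wlog h : b ≤ a generalizing a b
  · rw [abs_sub_comm, abs_sub_comm a b]
    exact this hb ha (le_of_not_ge h)
  have h2 := Real.rpow_add_le_add_rpow hb (sub_nonneg.mpr h) h0 h1
  rw [add_sub_cancel] at h2
  rw [abs_of_nonneg (sub_nonneg.mpr h),
    abs_of_nonneg (sub_nonneg.mpr (Real.rpow_le_rpow hb h h0))]
  linarith

/-- All coordinates but the first. -/
noncomputable def tail (n : ℕ) : EuclideanSpace ℝ (Fin (n + 1)) →L[ℝ] EuclideanSpace ℝ (Fin n) :=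
  LinearMap.toContinuousLinearMap
    { toFun := fun x => WithLp.toLp 2 fun i => x i.succ
      map_add' := fun _ _ => rfl
      map_smul' := fun _ _ => rfl }

@[simp] theorem tail_apply (n : ℕ) (x : EuclideanSpace ℝ (Fin (n + 1))) (i : Fin n) :
    tail n x i = x i.succ := rfl

theorem norm_sq_eq_head_add_tail (n : ℕ) (x : EuclideanSpace ℝ (Fin (n + 1))) :
    ‖x‖ ^ 2 = x 0 ^ 2 + ‖tail n x‖ ^ 2 := by
  simp [EuclideanSpace.norm_sq_eq, Fin.sum_univ_succ]

theorem norm_tail_le (n : ℕ) (x : EuclideanSpace ℝ (Fin (n + 1))) : ‖tail n x‖ ≤ ‖x‖ := by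
  refine le_of_sq_le_sq ?_ (norm_nonneg _)
  rw [norm_sq_eq_head_add_tail n x]
  nlinarith [sq_nonneg (x 0)]

theorem abs_apply_zero_le (n : ℕ) (x : EuclideanSpace ℝ (Fin (n + 1))) : |x 0| ≤ ‖x‖ := by
  simpa using PiLp.norm_apply_le x 0

/-- The solid of revolution `|x'|^γ + |x₀| < 1`, with two outward cusps at `±e₀`. -/
def doubleCusp (n : ℕ) (γ : ℝ) : Set (EuclideanSpace ℝ (Fin (n + 1))) :=
  {x | ‖tail n x‖ ^ γ + |x 0| < 1}

variable {n : ℕ} {γ : ℝ}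

theorem mem_doubleCusp {x : EuclideanSpace ℝ (Fin (n + 1))} :
    x ∈ doubleCusp n γ ↔ ‖tail n x‖ ^ γ + |x 0| < 1 := Iff.rfl

theorem continuous_doubleCusp_gauge (hγ : 0 < γ) :
    Continuous fun x : EuclideanSpace ℝ (Fin (n + 1)) => ‖tail n x‖ ^ γ + |x 0| := by
  refine Continuous.add ?_ (by fun_prop)
  exact (tail n).continuous.norm.rpow_const fun _ => Or.inr hγ.le

theorem isOpen_doubleCusp (hγ : 0 < γ) : IsOpen (doubleCusp n γ) :=
  isOpen_lt (continuous_doubleCusp_gauge hγ) continuous_const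

theorem norm_tail_lt_one_of_mem (hγ : 0 < γ) {x : EuclideanSpace ℝ (Fin (n + 1))}
    (hx : x ∈ doubleCusp n γ) : ‖tail n x‖ < 1 := by
  by_contra h
  push Not at h
  have h1 := Real.one_le_rpow h hγ.le
  have h2 := abs_nonneg (x 0)
  rw [mem_doubleCusp] at hx
  linarith

theorem abs_head_lt_one_of_mem {x : EuclideanSpace ℝ (Fin (n + 1))}
    (hx : x ∈ doubleCusp n γ) : |x 0| < 1 := by
  have h1 := Real.rpow_nonneg (norm_nonneg (tail n x)) γ
  rw [mem_doubleCusp] at hx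
  linarith

theorem norm_lt_two_of_mem_doubleCusp (hγ : 0 < γ) {x : EuclideanSpace ℝ (Fin (n + 1))}
    (hx : x ∈ doubleCusp n γ) : ‖x‖ < 2 := by
  have h1 := norm_tail_lt_one_of_mem hγ hx
  have h2 := abs_head_lt_one_of_mem hx
  have h3 := norm_sq_eq_head_add_tail n x
  have h4 := sq_lt_one_iff_abs_lt_one (x 0) |>.mpr h2
  nlinarith [norm_nonneg (tail n x), norm_nonneg x]

theorem isBounded_doubleCusp (hγ : 0 < γ) : Bornology.IsBounded (doubleCusp n γ) :=
  (Metric.isBounded_ball (x := (0 : EuclideanSpace ℝ (Fin (n + 1)))) (r := 2)).subset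
    fun x hx => by simpa using norm_lt_two_of_mem_doubleCusp hγ hx

/-- Contracting the domain leaves room for a small translation. -/
theorem smul_add_mem_doubleCusp (h0 : 0 < γ) (h1 : γ ≤ 1) {s ε : ℝ} (hs0 : 0 < s) (hs1 : s ≤ 1)
    (hε : ε ^ γ + ε ≤ 1 - s ^ γ) {x z : EuclideanSpace ℝ (Fin (n + 1))} (hx : x ∈ doubleCusp n γ)
    (hz : ‖z‖ ≤ ε) : s • x + z ∈ doubleCusp n γ := by
  rw [mem_doubleCusp] at hx ⊢
  have hε0 : 0 ≤ ε := (norm_nonneg z).trans hz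
  have e1 : ‖tail n (s • x + z)‖ ^ γ ≤ s ^ γ * ‖tail n x‖ ^ γ + ε ^ γ := by
    calc ‖tail n (s • x + z)‖ ^ γ ≤ (s * ‖tail n x‖ + ε) ^ γ := by
          refine Real.rpow_le_rpow (norm_nonneg _) ?_ h0.le
          rw [map_add, map_smul]
          refine (norm_add_le _ _).trans ?_
          rw [norm_smul, Real.norm_of_nonneg hs0.le]
          gcongr
          exact (norm_tail_le n z).trans hz
      _ ≤ (s * ‖tail n x‖) ^ γ + ε ^ γ :=
          Real.rpow_add_le_add_rpow (by positivity) hε0 h0.le h1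
      _ = _ := by rw [Real.mul_rpow hs0.le (norm_nonneg _)]
  have e2 : |(s • x + z) 0| ≤ s ^ γ * |x 0| + ε := by
    -- The axial term shrinks by s, the radial one only by s^γ; both are bounded using the weaker
    -- factor s^γ, and the remaining 1 - s^γ absorbs the translation.
    have f1 : s ≤ s ^ γ := by
      have := Real.rpow_le_rpow_of_exponent_ge hs0 hs1 h1
      rwa [Real.rpow_one] at this
    simp only [PiLp.add_apply, PiLp.smul_apply, smul_eq_mul]
    refine (abs_add_le _ _).trans ?_
    rw [abs_mul, abs_of_pos hs0]
    gcongr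
    exact (abs_apply_zero_le n z).trans hz
  have e3 : 0 < s ^ γ := Real.rpow_pos_of_pos hs0 γ
  nlinarith

theorem smul_mem_doubleCusp (h0 : 0 < γ) {s : ℝ} (hs0 : 0 ≤ s) (hs1 : s ≤ 1)
    {x : EuclideanSpace ℝ (Fin (n + 1))} (hx : x ∈ doubleCusp n γ) : s • x ∈ doubleCusp n γ := by
  rw [mem_doubleCusp] at hx ⊢
  have h2 : ‖tail n (s • x)‖ ^ γ ≤ ‖tail n x‖ ^ γ := by
    refine Real.rpow_le_rpow (norm_nonneg _) ?_ h0.le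
    rw [map_smul, norm_smul, Real.norm_of_nonneg hs0]
    exact mul_le_of_le_one_left (norm_nonneg _) hs1
  have h3 : |(s • x) 0| ≤ |x 0| := by
    simp only [PiLp.smul_apply, smul_eq_mul, abs_mul, abs_of_nonneg hs0]
    exact mul_le_of_le_one_left (abs_nonneg _) hs1
  linarith

theorem zero_mem_doubleCusp (h0 : 0 < γ) : (0 : EuclideanSpace ℝ (Fin (n + 1))) ∈ doubleCusp n γ := by
  simp [mem_doubleCusp, Real.zero_rpow h0.ne']

theorem isConnected_doubleCusp (h0 : 0 < γ) : IsConnected (doubleCusp n γ) := by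
  refine (StarConvex.isPathConnected (a := 0) ?_ (zero_mem_doubleCusp h0)).isConnected
  rw [starConvex_zero_iff]
  exact fun x hx s hs0 hs1 => smul_mem_doubleCusp h0 hs0 hs1 hx

theorem norm_sq_orthogonalProjection {E : Type*} [NormedAddCommGroup E] [InnerProductSpace ℝ E]
    {ν : E} (hν : ‖ν‖ = 1) (x : E) :
    ‖(Submodule.span ℝ {ν})ᗮ.orthogonalProjectionOnto x‖ ^ 2 = ‖x‖ ^ 2 - (inner ℝ ν x) ^ 2 := by
  have h := Submodule.norm_sq_eq_add_norm_sq_starProjection x (Submodule.span ℝ {ν})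
  rw [Submodule.starProjection_unit_singleton ℝ hν, norm_smul, hν, mul_one, Real.norm_eq_abs,
    sq_abs] at h
  rw [h, add_sub_cancel_left]
  rfl

theorem orthogonalProjection_coe {E : Type*} [NormedAddCommGroup E] [InnerProductSpace ℝ E]
    {ν : E} (hν : ‖ν‖ = 1) (x : E) :
    ((Submodule.span ℝ {ν})ᗮ.orthogonalProjectionOnto x : E) = x - (inner ℝ ν x) • ν := by
  have h := Submodule.starProjection_add_starProjection_orthogonal (K := Submodule.span ℝ {ν}) x
  rw [Submodule.starProjection_unit_singleton ℝ hν] at h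
  exact eq_sub_of_add_eq' h

/-- Near a boundary point off the equator the double cusp is a Hölder subgraph in the direction of
its axis. -/
theorem exists_chart_doubleCusp_axis (h0 : 0 < γ) (h1 : γ ≤ 1) (σ : ℝ) (hσ : |σ| = 1)
    (z : EuclideanSpace ℝ (Fin (n + 1))) (hz : 0 < σ * z 0) :
    ∃ ν : EuclideanSpace ℝ (Fin (n + 1)), ‖ν‖ = 1 ∧
      ∃ (A : Set (Submodule.span ℝ {ν})ᗮ) (f : (Submodule.span ℝ {ν})ᗮ → ℝ) (c : ℝ),
        IsOpen A ∧ Bornology.IsBounded A ∧ 0 < c ∧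
        (∀ x ∈ A, ∀ y ∈ A, |f x - f y| ≤ c * ‖x - y‖ ^ γ) ∧
        ∃ U : Set (EuclideanSpace ℝ (Fin (n + 1))), IsOpen U ∧ z ∈ U ∧
          ∀ x ∈ U, (Submodule.span ℝ {ν})ᗮ.orthogonalProjectionOnto x ∈ A ∧
            (x ∈ doubleCusp n γ ↔
              inner ℝ ν x < f ((Submodule.span ℝ {ν})ᗮ.orthogonalProjectionOnto x)) := by
  have hν : ‖EuclideanSpace.single (0 : Fin (n + 1)) σ‖ = 1 := by simpa using hσ
  have hin : ∀ x : EuclideanSpace ℝ (Fin (n + 1)),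
      inner ℝ (EuclideanSpace.single (0 : Fin (n + 1)) σ) x = σ * x 0 := by
    intro x
    simp [EuclideanSpace.inner_single_left]
  have hσ2 : σ ^ 2 = 1 := by rw [← sq_abs, hσ, one_pow]
  have hnorm : ∀ x : EuclideanSpace ℝ (Fin (n + 1)),
      ‖(Submodule.span ℝ {EuclideanSpace.single (0 : Fin (n + 1)) σ})ᗮ.orthogonalProjectionOnto x‖
        = ‖tail n x‖ := by
    intro x
    rw [← sq_eq_sq₀ (norm_nonneg _) (norm_nonneg _), norm_sq_orthogonalProjection hν, hin,
      norm_sq_eq_head_add_tail, mul_pow, hσ2]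
    ring
  -- In the half-space σ x₀ > 0 one has |x₀| = σ x₀, so the defining inequality is already a
  -- subgraph condition. The tips are included.
  refine ⟨EuclideanSpace.single 0 σ, hν, Metric.ball 0 (‖tail n z‖ + 1), fun p => 1 - ‖p‖ ^ γ, 1,
    Metric.isOpen_ball, Metric.isBounded_ball, one_pos, ?_,
    {x | 0 < σ * x 0} ∩ {x | ‖tail n x‖ < ‖tail n z‖ + 1}, ?_, ⟨hz, by simp⟩, ?_⟩
  · intro x _ y _
    rw [one_mul, sub_sub_sub_cancel_left, abs_sub_comm]
    exact (abs_rpow_sub_rpow_le (norm_nonneg _) (norm_nonneg _) h0.le h1).trans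
      (Real.rpow_le_rpow (abs_nonneg _) (abs_norm_sub_norm_le _ _) h0.le)
  · exact (isOpen_lt continuous_const (by fun_prop)).inter (isOpen_lt (by fun_prop) continuous_const)
  · rintro x ⟨hx1, hx2⟩
    refine ⟨by rw [mem_ball_zero_iff, hnorm]; exact hx2, ?_⟩
    have h2 : |x 0| = σ * x 0 := by
      have hx1' : 0 < σ * x 0 := hx1
      rw [← abs_of_pos hx1', abs_mul, hσ, one_mul]
    change _ ↔ _ < 1 - ‖_‖ ^ γ
    rw [hnorm, hin, mem_doubleCusp, h2, lt_sub_iff_add_lt, add_comm]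

/-- Near a boundary point on the equator the double cusp is a Lipschitz subgraph in the radial
direction. -/
theorem exists_chart_doubleCusp_equator (h0 : 0 < γ) (h1 : γ ≤ 1)
    (z : EuclideanSpace ℝ (Fin (n + 1))) (hz : z 0 = 0) (hz1 : ‖z‖ = 1) :
    ∃ ν : EuclideanSpace ℝ (Fin (n + 1)), ‖ν‖ = 1 ∧
      ∃ (A : Set (Submodule.span ℝ {ν})ᗮ) (f : (Submodule.span ℝ {ν})ᗮ → ℝ) (c : ℝ),
        IsOpen A ∧ Bornology.IsBounded A ∧ 0 < c ∧
        (∀ x ∈ A, ∀ y ∈ A, |f x - f y| ≤ c * ‖x - y‖ ^ γ) ∧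
        ∃ U : Set (EuclideanSpace ℝ (Fin (n + 1))), IsOpen U ∧ z ∈ U ∧
          ∀ x ∈ U, (Submodule.span ℝ {ν})ᗮ.orthogonalProjectionOnto x ∈ A ∧
            (x ∈ doubleCusp n γ ↔
              inner ℝ ν x < f ((Submodule.span ℝ {ν})ᗮ.orthogonalProjectionOnto x)) := by
  -- With h the coordinate along z and p the orthogonal part, |x'|² = h² + ‖p‖² - p₀². Solving
  -- |x'|^γ < 1 - |p₀| for h > 0 gives the square root below, a smooth function of |p₀| and ‖p‖² -
  -- p₀² near (0, 0).
  obtain ⟨K, t, ht, hK⟩ : ∃ K, ∃ t ∈ 𝓝 ((0, 0) : ℝ × ℝ),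
      LipschitzOnWith K (fun p : ℝ × ℝ => √((1 - p.1) ^ (2 / γ) - p.2)) t := by
    refine ContDiffAt.exists_lipschitzOnWith (𝕂 := ℝ) ?_
    refine ContDiffAt.sqrt (ContDiffAt.sub (ContDiffAt.rpow_const_of_ne ?_ ?_) ?_) ?_
    · exact contDiffAt_const.sub contDiffAt_fst
    · norm_num
    · exact contDiffAt_snd
    · norm_num
  let G : (Submodule.span ℝ {z})ᗮ → ℝ × ℝ :=
    fun p => (|(p : EuclideanSpace ℝ (Fin (n + 1))) 0|,
      ‖p‖ ^ 2 - (p : EuclideanSpace ℝ (Fin (n + 1))) 0 ^ 2)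
  have hGc : Continuous G := by
    have : Continuous fun p : (Submodule.span ℝ {z})ᗮ => (p : EuclideanSpace ℝ (Fin (n + 1))) 0 :=
      (EuclideanSpace.proj (𝕜 := ℝ) (0 : Fin (n + 1))).continuous.comp continuous_subtype_val
    fun_prop
  have hG0 : G 0 = (0, 0) := by simp [G]
  obtain ⟨δ, hδ, hδt⟩ := Metric.mem_nhds_iff.mp (hGc.continuousAt.preimage_mem_nhds (hG0 ▸ ht))
  -- Radius at most 1/2 makes mutual distances at most 1, where a Lipschitz bound implies a γ-Hölder
  -- bound.
  set δ' := min δ (1 / 2) with hδ'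
  have hδ'0 : 0 < δ' := by positivity
  have hGL : ∀ p q : (Submodule.span ℝ {z})ᗮ, ‖p‖ < δ' → ‖q‖ < δ' → dist (G p) (G q) ≤ 4 * ‖p - q‖ := by
    intro p q hp hq
    have hp' : ‖p‖ ≤ 1 := by linarith [min_le_right δ (1 / 2)]
    have hq' : ‖q‖ ≤ 1 := by linarith [min_le_right δ (1 / 2)]
    have e1 := abs_apply_zero_le n (p : EuclideanSpace ℝ (Fin (n + 1)))
    have e2 := abs_apply_zero_le n (q : EuclideanSpace ℝ (Fin (n + 1)))
    have e3 := abs_apply_zero_le n ((p - q : (Submodule.span ℝ {z})ᗮ) : EuclideanSpace ℝ (Fin (n + 1)))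
    rw [← Submodule.coe_norm] at e1 e2 e3
    have e4 : ((p - q : (Submodule.span ℝ {z})ᗮ) : EuclideanSpace ℝ (Fin (n + 1))) 0
      = (p : EuclideanSpace ℝ (Fin (n + 1))) 0 - (q : EuclideanSpace ℝ (Fin (n + 1))) 0 := by simp
    rw [e4] at e3
    have e5 := abs_norm_sub_norm_le p q
    set a := (p : EuclideanSpace ℝ (Fin (n + 1))) 0
    set b := (q : EuclideanSpace ℝ (Fin (n + 1))) 0
    rw [Prod.dist_eq, max_le_iff, Real.dist_eq, Real.dist_eq]
    constructor
    · have := abs_abs_sub_abs_le a b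
      change abs (|a| - |b|) ≤ _
      linarith [norm_nonneg (p - q)]
    · change |(‖p‖ ^ 2 - a ^ 2) - (‖q‖ ^ 2 - b ^ 2)| ≤ _
      have f1 : |‖p‖ ^ 2 - ‖q‖ ^ 2| ≤ 2 * ‖p - q‖ := by
        rw [sq_sub_sq, abs_mul, abs_of_nonneg (by positivity)]
        gcongr
        linarith
      have f2 : |a ^ 2 - b ^ 2| ≤ 2 * ‖p - q‖ := by
        rw [sq_sub_sq, abs_mul]
        gcongr
        exact (abs_add_le _ _).trans (by linarith)
      have := abs_sub (‖p‖ ^ 2 - ‖q‖ ^ 2) (a ^ 2 - b ^ 2)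
      rw [show (‖p‖ ^ 2 - a ^ 2) - (‖q‖ ^ 2 - b ^ 2) = (‖p‖ ^ 2 - ‖q‖ ^ 2) - (a ^ 2 - b ^ 2) by ring]
      linarith
  refine ⟨z, hz1, Metric.ball 0 δ', fun p => √((1 - (G p).1) ^ (2 / γ) - (G p).2), K * 4 + 1,
    Metric.isOpen_ball, Metric.isBounded_ball, by positivity, ?_,
    {x | 0 < inner ℝ z x} ∩ (Submodule.span ℝ {z})ᗮ.orthogonalProjectionOnto ⁻¹' Metric.ball 0 δ',
    ?_, ⟨?_, ?_⟩, ?_⟩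
  · intro x hx y hy
    rw [mem_ball_zero_iff] at hx hy
    have hxt : G x ∈ t := hδt (by rw [mem_ball_zero_iff]; exact hx.trans_le (min_le_left _ _))
    have hyt : G y ∈ t := hδt (by rw [mem_ball_zero_iff]; exact hy.trans_le (min_le_left _ _))
    have e1 := hK.dist_le_mul _ hxt _ hyt
    rw [Real.dist_eq] at e1
    have e2 : ‖x - y‖ ≤ 1 := by
      have := norm_sub_le x y
      linarith [min_le_right δ (1 / 2)]
    have e3 : ‖x - y‖ ≤ ‖x - y‖ ^ γ := by
      have := Real.rpow_le_rpow_of_exponent_ge' (norm_nonneg (x - y)) e2 h0.le h1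
      rwa [Real.rpow_one] at this
    calc _ ≤ K * dist (G x) (G y) := e1
      _ ≤ K * (4 * ‖x - y‖) := by gcongr; exact hGL x y hx hy
      _ ≤ (K * 4 + 1) * ‖x - y‖ := by nlinarith [norm_nonneg (x - y)]
      _ ≤ _ := by gcongr
  · exact (isOpen_lt continuous_const (by fun_prop)).inter
      (Metric.isOpen_ball.preimage (ContinuousLinearMap.continuous _))
  · simp [hz1]
  · have : (Submodule.span ℝ {z})ᗮ.orthogonalProjectionOnto z = 0 := by
      rw [← norm_eq_zero, ← sq_eq_zero_iff, norm_sq_orthogonalProjection hz1,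
        real_inner_self_eq_norm_sq, hz1]
      norm_num
    simp [this, hδ'0]
  · rintro x ⟨hx1, hx2⟩
    refine ⟨hx2, ?_⟩
    set p := (Submodule.span ℝ {z})ᗮ.orthogonalProjectionOnto x with hp
    have hx2' : ‖p‖ < δ' := mem_ball_zero_iff.mp hx2
    have e0 : (p : EuclideanSpace ℝ (Fin (n + 1))) 0 = x 0 := by
      rw [hp, orthogonalProjection_coe hz1]
      simp [hz]
    have e1 : ‖tail n x‖ ^ 2 = (inner ℝ z x) ^ 2 + (‖p‖ ^ 2 - x 0 ^ 2) := by
      have := norm_sq_eq_head_add_tail n x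
      rw [hp, norm_sq_orthogonalProjection hz1]
      linarith
    have e2 : |x 0| < 1 := by
      have := abs_apply_zero_le n (p : EuclideanSpace ℝ (Fin (n + 1)))
      rw [e0, ← Submodule.coe_norm] at this
      linarith [min_le_right δ (1 / 2)]
    have e3 : G p = (|x 0|, ‖p‖ ^ 2 - x 0 ^ 2) := by simp only [G, e0]
    have e4 : ‖tail n x‖ ^ γ = (‖tail n x‖ ^ 2) ^ (γ / 2) := by
      rw [← Real.rpow_natCast, ← Real.rpow_mul (norm_nonneg _)]
      congr 1
      push_cast
      ring
    have e5 : 1 - |x 0| = ((1 - |x 0|) ^ (2 / γ)) ^ (γ / 2) := by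
      rw [← Real.rpow_mul (by linarith)]
      rw [show 2 / γ * (γ / 2) = 1 by field_simp, Real.rpow_one]
    change _ ↔ _ < √((1 - (G p).1) ^ (2 / γ) - (G p).2)
    rw [e3, Real.lt_sqrt (le_of_lt hx1), lt_sub_iff_add_lt, ← e1, mem_doubleCusp,
      ← lt_sub_iff_add_lt, e4, e5]
    rw [Real.rpow_lt_rpow_iff (by positivity) (Real.rpow_nonneg (by linarith) _) (by positivity),
      ← e5]

/-- The axial charts fail only where |x₀| changes branch, that is on the equator x₀ = 0, and there
the radial direction serves. -/
theorem isHolderDomain_doubleCusp (h0 : 0 < γ) (h1 : γ ≤ 1) :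
    IsHolderDomain γ (doubleCusp n γ) := by
  refine ⟨isOpen_doubleCusp h0, isBounded_doubleCusp h0, isConnected_doubleCusp h0, ?_⟩
  intro z hz
  have hz1 : ‖tail n z‖ ^ γ + |z 0| = 1 :=
    frontier_lt_subset_eq (continuous_doubleCusp_gauge h0) continuous_const hz
  rcases lt_trichotomy (z 0) 0 with h | h | h
  · exact exists_chart_doubleCusp_axis h0 h1 (-1) (by simp) z (by linarith)
  · refine exists_chart_doubleCusp_equator h0 h1 z h ?_
    rw [h, abs_zero, add_zero] at hz1
    have h2 : ‖tail n z‖ = 1 := by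
      rw [← Real.one_rpow γ] at hz1
      exact (Real.rpow_left_inj (norm_nonneg _) zero_le_one h0.ne').mp hz1
    have h3 := norm_sq_eq_head_add_tail n z
    rw [h, h2] at h3
    nlinarith [norm_nonneg z]
  · exact exists_chart_doubleCusp_axis h0 h1 1 (by simp) z (by linarith)

end Geometry

/-! ### Integration over the upper half of the cusp along curves running into the tip. -/

section Slices

/-- The point with first coordinate `r` and remaining coordinates `ξ`. -/
noncomputable def glue (n : ℕ) (r : ℝ) (ξ : EuclideanSpace ℝ (Fin n)) :
    EuclideanSpace ℝ (Fin (n + 1)) :=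
  WithLp.toLp 2 (Fin.cons r ξ)

variable {n : ℕ} {γ : ℝ}

@[simp] theorem glue_zero (r : ℝ) (ξ : EuclideanSpace ℝ (Fin n)) : glue n r ξ 0 = r := rfl

@[simp] theorem tail_glue (r : ℝ) (ξ : EuclideanSpace ℝ (Fin n)) : tail n (glue n r ξ) = ξ := by
  ext i
  simp [glue]

theorem norm_sq_glue (r : ℝ) (ξ : EuclideanSpace ℝ (Fin n)) :
    ‖glue n r ξ‖ ^ 2 = r ^ 2 + ‖ξ‖ ^ 2 := by
  rw [norm_sq_eq_head_add_tail, glue_zero, tail_glue]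

theorem measurePreserving_glue :
    MeasurePreserving (fun p : ℝ × EuclideanSpace ℝ (Fin n) => glue n p.1 p.2) := by
  have h1 : MeasurePreserving (Prod.map (id : ℝ → ℝ)
      (MeasurableEquiv.toLp 2 (Fin n → ℝ)).symm) (volume.prod volume) (volume.prod volume) :=
    (MeasurePreserving.id volume).prod
      (EuclideanSpace.volume_preserving_symm_measurableEquiv_toLp (Fin n))
  have h2 := (volume_preserving_piFinSuccAbove (fun _ : Fin (n + 1) => ℝ) 0).symm
  have h3 := (PiLp.volume_preserving_toLp (Fin (n + 1))).comp (h2.comp h1)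
  have h4 : (fun p : ℝ × EuclideanSpace ℝ (Fin n) => glue n p.1 p.2) = WithLp.toLp 2 ∘
      (MeasurableEquiv.piFinSuccAbove (fun _ : Fin (n + 1) => ℝ) 0).symm ∘
        Prod.map id (MeasurableEquiv.toLp 2 (Fin n → ℝ)).symm := by
    ext p i
    refine Fin.cases ?_ (fun j => ?_) i <;> simp [glue]
  rw [h4]
  exact h3

theorem continuous_glue :
    Continuous (fun p : ℝ × EuclideanSpace ℝ (Fin n) => glue n p.1 p.2) := by
  refine (PiLp.continuous_toLp 2 _).comp ?_
  refine continuous_pi fun i => ?_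
  refine Fin.cases ?_ (fun j => ?_) i
  · exact continuous_fst
  · simp only [Fin.cons_succ]
    exact (EuclideanSpace.proj (𝕜 := ℝ) j).continuous.comp continuous_snd

theorem lintegral_glue {F : EuclideanSpace ℝ (Fin (n + 1)) → ℝ≥0∞} (hF : Measurable F) :
    ∫⁻ x, F x = ∫⁻ r : ℝ, ∫⁻ ξ : EuclideanSpace ℝ (Fin n), F (glue n r ξ) := by
  rw [← measurePreserving_glue.lintegral_comp hF]
  exact lintegral_prod _ (hF.comp continuous_glue.measurable).aemeasurable

theorem lintegral_eq_smul {E : Type*} [NormedAddCommGroup E] [NormedSpace ℝ E]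
    [MeasurableSpace E] [BorelSpace E] [FiniteDimensional ℝ E] (μ : Measure E) [μ.IsAddHaarMeasure]
    {G : E → ℝ≥0∞} {c : ℝ} (hc : 0 < c) :
    ∫⁻ x, G x ∂μ = ENNReal.ofReal (c ^ Module.finrank ℝ E) * ∫⁻ x, G (c • x) ∂μ := by
  have h := lintegral_map_equiv (μ := μ) G (MeasurableEquiv.smul₀ c hc.ne')
  have h2 : ⇑(MeasurableEquiv.smul₀ c hc.ne') = fun x : E => c • x := rfl
  rw [h2, Measure.map_addHaar_smul μ hc.ne', lintegral_smul_measure] at h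
  rw [← h, smul_eq_mul, ← mul_assoc, ← ENNReal.ofReal_mul (by positivity),
    abs_of_pos (by positivity), mul_inv_cancel₀ (by positivity), ENNReal.ofReal_one, one_mul]

/-- The section at depth r below the upper tip is a ball of radius r^(1/γ); this is the source of
the weight r^(n/γ). -/
theorem glue_mem_upper_iff (h0 : 0 < γ) (r : ℝ) (ξ : EuclideanSpace ℝ (Fin n)) :
    glue n (1 - r) ξ ∈ doubleCusp n γ ∩ {x | 0 < x 0} ↔
      r ∈ Set.Ioo (0 : ℝ) 1 ∧ ‖ξ‖ < r ^ (1 / γ) := by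
  have h1 := Real.rpow_nonneg (norm_nonneg ξ) γ
  simp only [Set.mem_inter_iff, mem_doubleCusp, tail_glue, glue_zero, Set.mem_ofPred_eq,
    Set.mem_Ioo]
  constructor
  · rintro ⟨h2, h3⟩
    rw [abs_of_pos h3] at h2
    have hr : 0 < r := by linarith
    refine ⟨⟨hr, by linarith⟩, ?_⟩
    rw [← Real.rpow_lt_rpow_iff (norm_nonneg _) (by positivity) h0, ← Real.rpow_mul hr.le,
      one_div_mul_cancel h0.ne', Real.rpow_one]
    linarith
  · rintro ⟨⟨h2, h3⟩, h4⟩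
    refine ⟨?_, by linarith⟩
    rw [← Real.rpow_lt_rpow_iff (norm_nonneg _) (by positivity) h0, ← Real.rpow_mul h2.le,
      one_div_mul_cancel h0.ne', Real.rpow_one] at h4
    rw [abs_of_pos (by linarith)]
    linarith

/-- Integration over the upper half of the double cusp along the curves
`r ↦ (1 - r, r ^ (1 / γ) ξ)`, `‖ξ‖ < 1`. -/
theorem lintegral_upper_doubleCusp (h0 : 0 < γ) {F : EuclideanSpace ℝ (Fin (n + 1)) → ℝ≥0∞}
    (hF : Measurable F) :
    ∫⁻ x in doubleCusp n γ ∩ {x | 0 < x 0}, F x =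
      ∫⁻ ξ in Metric.ball (0 : EuclideanSpace ℝ (Fin n)) 1, ∫⁻ r in Set.Ioo (0 : ℝ) 1,
        ENNReal.ofReal (r ^ (n / γ)) * F (glue n (1 - r) (r ^ (1 / γ) • ξ)) := by
  have hms : MeasurableSet (doubleCusp n γ ∩ {x | 0 < x 0}) :=
    ((isOpen_doubleCusp h0).inter (isOpen_lt continuous_const (by fun_prop))).measurableSet
  have hm : Measurable fun p : EuclideanSpace ℝ (Fin n) × ℝ =>
      ENNReal.ofReal (p.2 ^ (n / γ)) * F (glue n (1 - p.2) (p.2 ^ (1 / γ) • p.1)) := by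
    refine Measurable.mul (by fun_prop) (hF.comp ?_)
    have : Measurable fun p : EuclideanSpace ℝ (Fin n) × ℝ => (1 - p.2, p.2 ^ (1 / γ) • p.1) := by
      fun_prop
    exact continuous_glue.measurable.comp this
  rw [lintegral_lintegral_swap (μ := volume.restrict (Metric.ball 0 1))
    (ν := volume.restrict (Set.Ioo (0 : ℝ) 1)) (f := fun ξ r => ENNReal.ofReal (r ^ (n / γ)) *
      F (glue n (1 - r) (r ^ (1 / γ) • ξ))) hm.aemeasurable,
    ← lintegral_indicator hms, lintegral_glue (hF.indicator hms),
    ← lintegral_sub_left_eq_self _ (1 : ℝ), ← lintegral_indicator measurableSet_Ioo]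
  · refine lintegral_congr fun r => ?_
    by_cases hr : r ∈ Set.Ioo (0 : ℝ) 1
    · rw [Set.indicator_of_mem hr]
      have hc : 0 < r ^ (1 / γ) := Real.rpow_pos_of_pos hr.1 _
      -- Rescaling the section to the unit ball produces the Jacobian (r^(1/γ))^n.
      rw [lintegral_eq_smul volume hc, finrank_euclideanSpace_fin, ← Real.rpow_natCast,
        ← Real.rpow_mul hr.1.le, one_div_mul_eq_div, lintegral_const_mul' _ _ ENNReal.ofReal_ne_top,
        ← lintegral_indicator measurableSet_ball]
      congr 1
      refine lintegral_congr fun ξ => ?_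
      by_cases hξ : ‖ξ‖ < 1
      · rw [Set.indicator_of_mem, Set.indicator_of_mem (by simpa using hξ)]
        rw [glue_mem_upper_iff h0]
        refine ⟨hr, ?_⟩
        rw [norm_smul, Real.norm_of_nonneg hc.le]
        exact mul_lt_of_lt_one_right hc hξ
      · rw [Set.indicator_of_notMem, Set.indicator_of_notMem (by simpa using hξ)]
        rw [glue_mem_upper_iff h0]
        rintro ⟨-, h⟩
        rw [norm_smul, Real.norm_of_nonneg hc.le] at h
        exact hξ (by simpa using (mul_lt_iff_lt_one_right hc).mp h)
    · rw [Set.indicator_of_notMem hr]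
      refine (lintegral_congr fun ξ => Set.indicator_of_notMem ?_ F).trans lintegral_zero
      rw [glue_mem_upper_iff h0]
      exact fun h => hr h.1

end Slices

/-! ### Hardy's inequality with weight r^a, and its transfer to the cusp. -/

section Hardy

variable {n : ℕ} {γ : ℝ}

/-- Pointwise form of the one-dimensional weighted Hardy inequality. -/
theorem hardy_pointwise {κ r x A B p : ℝ} (hκ : 0 < κ) (hr0 : 0 ≤ r) (hr1 : r ≤ 1) (hx : 0 ≤ x)
    (hp : |p| ≤ A * B) :
    κ / 2 * (x * A ^ 2) - ((κ + 1) ^ 2 / (2 * κ) + 1 / κ) * (r ^ 2 * x * (A ^ 2 + B ^ 2)) ≤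
      (2 * κ * (1 - r) * x - r * x) * A ^ 2 + (1 - r) * (r * x) * (2 * p) := by
  have h1 : -(A * B) ≤ p := (abs_le.mp hp).1
  have h2 : (1 - r) * (r * x) * (2 * (-(A * B))) ≤ (1 - r) * (r * x) * (2 * p) := by
    have : 0 ≤ (1 - r) * (r * x) := mul_nonneg (by linarith) (by positivity)
    nlinarith
  have h3 : 0 ≤ (1 - r) * x / κ * (κ * A - r * B) ^ 2 :=
    mul_nonneg (div_nonneg (mul_nonneg (by linarith) hx) hκ.le) (sq_nonneg _)
  have h4 : 0 ≤ x * A ^ 2 / (2 * κ) * (κ - (κ + 1) * r) ^ 2 := by positivity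
  have h5 : 0 ≤ (κ + 1) ^ 2 / (2 * κ) * (r ^ 2 * x * B ^ 2) := by positivity
  have h6 : 0 ≤ 1 / κ * (r ^ 2 * x * A ^ 2) := by positivity
  have h7 : 0 ≤ 1 / κ * (r ^ 2 * x * B ^ 2) * r := by positivity
  -- Completing squares: the first absorbs the cross term A B, the second the term in A² linear in
  -- r.
  have e : (2 * κ * (1 - r) * x - r * x) * A ^ 2 + (1 - r) * (r * x) * (2 * (-(A * B)))
      - (κ / 2 * (x * A ^ 2) - ((κ + 1) ^ 2 / (2 * κ) + 1 / κ) * (r ^ 2 * x * (A ^ 2 + B ^ 2)))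
      = (1 - r) * x / κ * (κ * A - r * B) ^ 2 + x * A ^ 2 / (2 * κ) * (κ - (κ + 1) * r) ^ 2
        + (κ + 1) ^ 2 / (2 * κ) * (r ^ 2 * x * B ^ 2) + 1 / κ * (r ^ 2 * x * A ^ 2)
        + 1 / κ * (r ^ 2 * x * B ^ 2) * r := by
    field_simp
    ring
  linarith

/-- One-dimensional weighted Hardy inequality away from the singular end point. -/
theorem hardy_interval {a : ℝ} (ha : 1 < a) {v v' : ℝ → ℂ}
    (hv : ∀ r, 0 < r → HasDerivAt v (v' r) r) (hv' : ContinuousOn v' (Set.Ioi 0)) {s : ℝ}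
    (hs0 : 0 < s) (hs1 : s ≤ 1) :
    (a - 1) / 4 * ∫ r in s..1, r ^ (a - 2) * ‖v r‖ ^ 2 ≤
      (((a - 1) / 2 + 1) ^ 2 / (a - 1) + 2 / (a - 1)) *
        ∫ r in s..1, r ^ a * (‖v r‖ ^ 2 + ‖v' r‖ ^ 2) := by
  have hsub : Set.uIcc s 1 ⊆ Set.Ioi 0 := by
    rw [Set.uIcc_of_le hs1]; exact fun x hx => hs0.trans_le hx.1
  have hvc : ContinuousOn v (Set.Ioi 0) := fun r hr => (hv r hr).continuousAt.continuousWithinAt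
  have hpow : ∀ q : ℝ, ContinuousOn (fun r : ℝ => r ^ q) (Set.Ioi 0) := fun q r hr =>
    (Real.continuousAt_rpow_const r q (Or.inl (ne_of_gt hr))).continuousWithinAt
  have c1 : ContinuousOn (fun r => r ^ (a - 2) * ‖v r‖ ^ 2) (Set.Ioi 0) :=
    (hpow _).mul (hvc.norm.pow 2)
  have c2 : ContinuousOn (fun r => r ^ a * (‖v r‖ ^ 2 + ‖v' r‖ ^ 2)) (Set.Ioi 0) :=
    (hpow _).mul ((hvc.norm.pow 2).add (hv'.norm.pow 2))
  -- Derivative of (1 - r) r^(a-1) |v|². The cutoff 1 - r removes the boundary term at 1, and the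
  -- one at s has a sign that allows it to be dropped.
  let P' : ℝ → ℝ := fun r => (-1 * r ^ (a - 1) + (1 - r) * ((a - 1) * r ^ (a - 1 - 1))) * ‖v r‖ ^ 2
    + (1 - r) * r ^ (a - 1) * (2 * inner ℝ (v r) (v' r))
  have hP : ∀ r ∈ Set.uIcc s 1, HasDerivAt (fun r => (1 - r) * r ^ (a - 1) * ‖v r‖ ^ 2) (P' r) r := by
    intro r hr
    have hr0 : 0 < r := hsub hr
    have d1 : HasDerivAt (fun r : ℝ => 1 - r) (-1) r := by
      simpa using (hasDerivAt_id r).const_sub 1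
    have d2 : HasDerivAt (fun r : ℝ => r ^ (a - 1)) ((a - 1) * r ^ (a - 1 - 1)) r :=
      Real.hasDerivAt_rpow_const (Or.inl hr0.ne')
    exact (d1.mul d2).mul (hv r hr0).norm_sq
  have c3 : ContinuousOn P' (Set.Ioi 0) := by
    refine ContinuousOn.add (ContinuousOn.mul (ContinuousOn.add ?_ ?_) (hvc.norm.pow 2)) ?_
    · exact continuousOn_const.mul (hpow _)
    · exact (continuousOn_const.sub continuousOn_id).mul (continuousOn_const.mul (hpow _))
    · exact ((continuousOn_const.sub continuousOn_id).mul (hpow _)).mul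
        (continuousOn_const.mul (hvc.inner hv'))
  have hint := intervalIntegral.integral_eq_sub_of_hasDerivAt hP (c3.mono hsub).intervalIntegrable
  have hle : ∫ r in s..1, ((a - 1) / 4 * (r ^ (a - 2) * ‖v r‖ ^ 2) -
      (((a - 1) / 2 + 1) ^ 2 / (a - 1) + 2 / (a - 1)) * (r ^ a * (‖v r‖ ^ 2 + ‖v' r‖ ^ 2))) ≤
      ∫ r in s..1, P' r := by
    refine intervalIntegral.integral_mono_on hs1 ?_ (c3.mono hsub).intervalIntegrable ?_
    · exact (((c1.mono hsub).intervalIntegrable).const_mul _).sub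
        (((c2.mono hsub).intervalIntegrable).const_mul _)
    · intro r hr
      have hr0 : 0 < r := hs0.trans_le hr.1
      have hx : 0 ≤ r ^ (a - 2) := Real.rpow_nonneg hr0.le _
      have e1 : r ^ (a - 1) = r * r ^ (a - 2) := by
        rw [← Real.rpow_one_add' hr0.le (by linarith)]; congr 1; ring
      have e2 : r ^ a = r ^ 2 * r ^ (a - 2) := by
        rw [← Real.rpow_natCast, ← Real.rpow_add hr0]; congr 1; push_cast; ring
      have e3 : r ^ (a - 1 - 1) = r ^ (a - 2) := by congr 1; ring
      have h := hardy_pointwise (κ := (a - 1) / 2) (by linarith) hr0.le hr.2 hx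
        (abs_real_inner_le_norm (v r) (v' r))
      simp only [P', e1, e2, e3]
      have f1 : ((a - 1) / 2 + 1) ^ 2 / (2 * ((a - 1) / 2)) + 1 / ((a - 1) / 2)
        = ((a - 1) / 2 + 1) ^ 2 / (a - 1) + 2 / (a - 1) := by
        have : a - 1 ≠ 0 := by linarith
        field_simp
      rw [f1] at h
      refine le_of_eq_of_le ?_ (h.trans_eq ?_) <;> ring
  rw [hint, intervalIntegral.integral_sub (((c1.mono hsub).intervalIntegrable).const_mul _)
    (((c2.mono hsub).intervalIntegrable).const_mul _), intervalIntegral.integral_const_mul,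
    intervalIntegral.integral_const_mul] at hle
  have : 0 ≤ (1 - s) * s ^ (a - 1) * ‖v s‖ ^ 2 :=
    mul_nonneg (mul_nonneg (by linarith) (Real.rpow_nonneg hs0.le _)) (sq_nonneg _)
  simp only [sub_self, zero_mul] at hle
  linarith

/-- The constant in the weighted Hardy inequality with weight `r ^ a`. -/
noncomputable def hardyConst (a : ℝ) : ℝ :=
  4 / (a - 1) * (((a - 1) / 2 + 1) ^ 2 / (a - 1) + 2 / (a - 1))

theorem hardyConst_nonneg {a : ℝ} (ha : 1 < a) : 0 ≤ hardyConst a := by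
  have : 0 < a - 1 := by linarith
  unfold hardyConst
  positivity

/-- Since the constant of `hardy_interval` does not depend on s, exhausting (0, 1) from the left
suffices, and no behaviour of v at 0 has to be prescribed. -/
theorem hardy_lintegral {a : ℝ} (ha : 1 < a) {v v' : ℝ → ℂ}
    (hv : ∀ r, 0 < r → HasDerivAt v (v' r) r) (hv' : ContinuousOn v' (Set.Ioi 0)) :
    ∫⁻ r in Set.Ioo (0 : ℝ) 1, ENNReal.ofReal (r ^ (a - 2) * ‖v r‖ ^ 2) ≤
      ENNReal.ofReal (hardyConst a) *
        ∫⁻ r in Set.Ioo (0 : ℝ) 1, ENNReal.ofReal (r ^ a * (‖v r‖ ^ 2 + ‖v' r‖ ^ 2)) := by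
  have hUnion : Set.Ioo (0 : ℝ) 1 = ⋃ k : ℕ, Set.Ioo (1 / ((k : ℝ) + 1)) 1 := by
    ext r
    simp only [Set.mem_Ioo, Set.mem_iUnion]
    constructor
    · rintro ⟨h1, h2⟩
      obtain ⟨k, hk⟩ := exists_nat_one_div_lt h1
      exact ⟨k, hk, h2⟩
    · rintro ⟨k, h1, h2⟩
      exact ⟨lt_trans (by positivity) h1, h2⟩
  have hdir : Directed (· ⊆ ·) fun k : ℕ => Set.Ioo (1 / ((k : ℝ) + 1)) 1 := by
    refine Monotone.directed_le fun k l hkl => Set.Ioo_subset_Ioo_left ?_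
    exact Nat.one_div_le_one_div hkl
  nth_rewrite 1 [hUnion]
  rw [setLIntegral_iUnion_of_directed _ hdir]
  refine iSup_le fun k => ?_
  set s : ℝ := 1 / ((k : ℝ) + 1) with hs
  have hs0 : 0 < s := by positivity
  have hs1 : s ≤ 1 := by
    rw [hs, div_le_one (by positivity)]
    linarith [Nat.cast_nonneg (α := ℝ) k]
  have hsub : Set.Icc s 1 ⊆ Set.Ioi 0 := fun x hx => hs0.trans_le hx.1
  have hvc : ContinuousOn v (Set.Ioi 0) := fun r hr => (hv r hr).continuousAt.continuousWithinAt
  have hpow : ∀ q : ℝ, ContinuousOn (fun r : ℝ => r ^ q) (Set.Ioi 0) := fun q r hr =>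
    (Real.continuousAt_rpow_const r q (Or.inl (ne_of_gt hr))).continuousWithinAt
  have c1 : ContinuousOn (fun r => r ^ (a - 2) * ‖v r‖ ^ 2) (Set.Ioi 0) :=
    (hpow _).mul (hvc.norm.pow 2)
  have c2 : ContinuousOn (fun r => r ^ a * (‖v r‖ ^ 2 + ‖v' r‖ ^ 2)) (Set.Ioi 0) :=
    (hpow _).mul ((hvc.norm.pow 2).add (hv'.norm.pow 2))
  have key : ∀ g : ℝ → ℝ, ContinuousOn g (Set.Ioi 0) → (∀ r, 0 < r → 0 ≤ g r) →
      ∫⁻ r in Set.Ioo s 1, ENNReal.ofReal (g r) = ENNReal.ofReal (∫ r in s..1, g r) := by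
    intro g hg hg0
    rw [intervalIntegral.integral_of_le hs1, restrict_Ioo_eq_restrict_Ioc,
      ofReal_integral_eq_lintegral_ofReal]
    · exact ((hg.mono hsub).integrableOn_Icc).mono_set Set.Ioc_subset_Icc_self
    · exact (ae_restrict_mem measurableSet_Ioc).mono fun r hr => hg0 r (hs0.trans hr.1)
  have h := hardy_interval ha hv hv' hs0 hs1
  have h1 : ∫ r in s..1, r ^ (a - 2) * ‖v r‖ ^ 2 ≤
      hardyConst a * ∫ r in s..1, r ^ a * (‖v r‖ ^ 2 + ‖v' r‖ ^ 2) := by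
    have h2 : 0 < a - 1 := by linarith
    rw [hardyConst, mul_assoc, div_mul_eq_mul_div, le_div_iff₀ h2]
    linarith
  rw [key _ c1 fun r hr => mul_nonneg (Real.rpow_nonneg hr.le _) (sq_nonneg _)]
  refine (ENNReal.ofReal_le_ofReal h1).trans ?_
  rw [ENNReal.ofReal_mul (hardyConst_nonneg ha),
    ← key _ c2 fun r hr => mul_nonneg (Real.rpow_nonneg hr.le _) (by positivity)]
  gcongr

/-- The squared length of the gradient of `f`. -/
noncomputable def gradSq {d : ℕ} (f : EuclideanSpace ℝ (Fin d) → ℂ)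
    (x : EuclideanSpace ℝ (Fin d)) : ℝ :=
  ∑ i, ‖fderiv ℝ f x (EuclideanSpace.single i 1)‖ ^ 2

theorem gradSq_nonneg {d : ℕ} (f : EuclideanSpace ℝ (Fin d) → ℂ) (x : EuclideanSpace ℝ (Fin d)) :
    0 ≤ gradSq f x := Finset.sum_nonneg fun _ _ => by positivity

theorem continuous_gradSq {d : ℕ} {f : EuclideanSpace ℝ (Fin d) → ℂ} (hf : ContDiff ℝ 1 f) :
    Continuous (gradSq f) := by
  have := hf.continuous_fderiv one_ne_zero
  unfold gradSq
  fun_prop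

theorem norm_fderiv_apply_sq_le {d : ℕ} (f : EuclideanSpace ℝ (Fin d) → ℂ)
    (x v : EuclideanSpace ℝ (Fin d)) : ‖fderiv ℝ f x v‖ ^ 2 ≤ ‖v‖ ^ 2 * gradSq f x := by
  have h1 : v = ∑ i, v i • EuclideanSpace.single i (1 : ℝ) := by
    ext j
    simp [Finset.sum_apply, Pi.single_apply]
  have h2 : ‖fderiv ℝ f x v‖ ≤ ∑ i, |v i| * ‖fderiv ℝ f x (EuclideanSpace.single i 1)‖ := by
    conv_lhs => rw [h1, map_sum]
    refine (norm_sum_le _ _).trans_eq (Finset.sum_congr rfl fun i _ => ?_)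
    rw [map_smul, norm_smul, Real.norm_eq_abs]
  calc ‖fderiv ℝ f x v‖ ^ 2 ≤
        (∑ i, |v i| * ‖fderiv ℝ f x (EuclideanSpace.single i 1)‖) ^ 2 := by gcongr
    _ ≤ (∑ i, |v i| ^ 2) * ∑ i, ‖fderiv ℝ f x (EuclideanSpace.single i 1)‖ ^ 2 :=
        Finset.sum_mul_sq_le_sq_mul_sq _ _ _
    _ = ‖v‖ ^ 2 * gradSq f x := by
        rw [EuclideanSpace.norm_sq_eq, gradSq]
        simp

theorem hasDerivAt_glue (r : ℝ) (hr : 0 < r) (q : ℝ) (ξ : EuclideanSpace ℝ (Fin n)) :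
    HasDerivAt (fun r : ℝ => glue n (1 - r) (r ^ q • ξ)) (glue n (-1) ((q * r ^ (q - 1)) • ξ)) r := by
  have h : HasDerivAt (fun r : ℝ => (Fin.cons (1 - r) (r ^ q • ξ : EuclideanSpace ℝ (Fin n)) :
      Fin (n + 1) → ℝ)) (Fin.cons (-1) ((q * r ^ (q - 1)) • ξ : EuclideanSpace ℝ (Fin n))) r := by
    rw [hasDerivAt_pi]
    intro i
    refine Fin.cases ?_ (fun j => ?_) i
    · simpa using (hasDerivAt_id r).const_sub 1
    · simpa using (Real.hasDerivAt_rpow_const (p := q) (Or.inl hr.ne')).mul_const (ξ j)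
  exact ((PiLp.continuousLinearEquiv 2 ℝ fun _ : Fin (n + 1) => ℝ).symm.hasFDerivAt.comp_hasDerivAt
    r h)

/-- Hardy's inequality at the cusp. -/
theorem hardy_doubleCusp (h0 : 0 < γ) (h1 : γ ≤ 1) (ha : 1 < n / γ) :
    ∃ C : ℝ, 0 ≤ C ∧ ∀ f : EuclideanSpace ℝ (Fin (n + 1)) → ℂ, ContDiff ℝ 1 f →
      ∫⁻ x in doubleCusp n γ ∩ {x | 0 < x 0}, ENNReal.ofReal (((1 - x 0) ^ 2)⁻¹ * ‖f x‖ ^ 2) ≤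
        ENNReal.ofReal C * ∫⁻ x in doubleCusp n γ, ENNReal.ofReal (gradSq f x + ‖f x‖ ^ 2) := by
  set a := (n : ℝ) / γ with had
  -- Bounds the squared speed of r ↦ (1 - r, r^(1/γ) ξ) for r, ‖ξ‖ < 1; it is finite because 1/γ ≥
  -- 1.
  set L : ℝ := 1 + (1 / γ) ^ 2 with hL
  have hL1 : 1 ≤ L := by rw [hL]; linarith [sq_nonneg (1 / γ)]
  refine ⟨hardyConst a * L, mul_nonneg (hardyConst_nonneg ha) (by linarith), fun f hf => ?_⟩
  have hfc := hf.continuous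
  have hgc := continuous_gradSq hf
  have hm1 : Measurable fun x : EuclideanSpace ℝ (Fin (n + 1)) =>
      ENNReal.ofReal (((1 - x 0) ^ 2)⁻¹ * ‖f x‖ ^ 2) := by
    have : Measurable fun x : EuclideanSpace ℝ (Fin (n + 1)) => (1 - x 0) :=
      (by fun_prop : Continuous fun x : EuclideanSpace ℝ (Fin (n + 1)) => (1 - x 0)).measurable
    exact (((this.pow_const 2).inv).mul (hfc.norm.pow 2).measurable).ennreal_ofReal
  have hm2 : Measurable fun x : EuclideanSpace ℝ (Fin (n + 1)) =>
      ENNReal.ofReal (gradSq f x + ‖f x‖ ^ 2) :=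
    (hgc.add (hfc.norm.pow 2)).measurable.ennreal_ofReal
  calc _ ≤ ENNReal.ofReal (hardyConst a * L) *
        ∫⁻ x in doubleCusp n γ ∩ {x | 0 < x 0}, ENNReal.ofReal (gradSq f x + ‖f x‖ ^ 2) := ?_
    _ ≤ _ := by
      gcongr
      exact Set.inter_subset_left
  rw [lintegral_upper_doubleCusp h0 hm1, lintegral_upper_doubleCusp h0 hm2,
    ← lintegral_const_mul' _ _ ENNReal.ofReal_ne_top]
  refine setLIntegral_mono' measurableSet_ball fun ξ hξ => ?_
  rw [mem_ball_zero_iff] at hξ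
  let c : ℝ → EuclideanSpace ℝ (Fin (n + 1)) := fun r => glue n (1 - r) (r ^ (1 / γ) • ξ)
  let c' : ℝ → EuclideanSpace ℝ (Fin (n + 1)) :=
    fun r => glue n (-1) ((1 / γ * r ^ (1 / γ - 1)) • ξ)
  have hc : ∀ r, 0 < r → HasDerivAt (fun r => f (c r)) (fderiv ℝ f (c r) (c' r)) r := by
    intro r hr
    exact ((hf.differentiable one_ne_zero) (c r)).hasFDerivAt.comp_hasDerivAt r
      (hasDerivAt_glue r hr (1 / γ) ξ)
  have hpow : ∀ q : ℝ, ContinuousOn (fun r : ℝ => r ^ q) (Set.Ioi 0) := fun q r hr =>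
    (Real.continuousAt_rpow_const r q (Or.inl (ne_of_gt hr))).continuousWithinAt
  have hcc : ContinuousOn c (Set.Ioi 0) :=
    continuous_glue.comp_continuousOn ((continuousOn_const.sub continuousOn_id).prodMk
      ((hpow _).smul continuousOn_const))
  have hcc' : ContinuousOn c' (Set.Ioi 0) :=
    continuous_glue.comp_continuousOn (continuousOn_const.prodMk
      ((continuousOn_const.mul (hpow _)).smul continuousOn_const))
  have hd : ContinuousOn (fun r => fderiv ℝ f (c r) (c' r)) (Set.Ioi 0) :=
    ((hf.continuous_fderiv one_ne_zero).comp_continuousOn hcc).clm_apply hcc'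
  -- The one-dimensional inequality on a single curve; its weight r^a is the Jacobian of the
  -- curvilinear coordinates.
  have hH := hardy_lintegral ha hc hd
  calc _ = ∫⁻ r in Set.Ioo (0 : ℝ) 1, ENNReal.ofReal (r ^ (a - 2) * ‖f (c r)‖ ^ 2) := by
        refine setLIntegral_congr_fun measurableSet_Ioo fun r hr => ?_
        simp only [glue_zero, sub_sub_cancel]
        rw [← ENNReal.ofReal_mul (Real.rpow_nonneg hr.1.le _), ← mul_assoc, Real.rpow_sub hr.1,
          Real.rpow_two, div_eq_mul_inv (r ^ a)]
    _ ≤ _ := hH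
    _ ≤ _ := by
        rw [ENNReal.ofReal_mul (hardyConst_nonneg ha), mul_assoc]
        refine mul_le_mul_right ?_ _
        rw [← lintegral_const_mul' _ _ ENNReal.ofReal_ne_top]
        refine setLIntegral_mono' measurableSet_Ioo fun r hr => ?_
        have hr0 : 0 ≤ r ^ a := Real.rpow_nonneg hr.1.le _
        rw [← ENNReal.ofReal_mul hr0, ← ENNReal.ofReal_mul (by linarith)]
        refine ENNReal.ofReal_le_ofReal ?_
        have e1 := norm_fderiv_apply_sq_le f (c r) (c' r)
        have e2 : ‖c' r‖ ^ 2 ≤ L := by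
          have e3 : r ^ (1 / γ - 1) ≤ 1 := by
            refine Real.rpow_le_one hr.1.le hr.2.le ?_
            rw [sub_nonneg, le_div_iff₀ h0]
            linarith
          have e4 : 0 ≤ r ^ (1 / γ - 1) := Real.rpow_nonneg hr.1.le _
          have e5 : ‖(1 / γ * r ^ (1 / γ - 1)) • ξ‖ ≤ 1 / γ := by
            rw [norm_smul, Real.norm_of_nonneg (by positivity)]
            calc 1 / γ * r ^ (1 / γ - 1) * ‖ξ‖ ≤ 1 / γ * 1 * 1 := by gcongr
              _ = 1 / γ := by ring
          simp only [c', norm_sq_glue, hL]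
          have := pow_le_pow_left₀ (norm_nonneg _) e5 2
          linarith
        have e6 := gradSq_nonneg f (c r)
        have e7 : ‖f (c r)‖ ^ 2 + ‖fderiv ℝ f (c r) (c' r)‖ ^ 2 ≤
            L * (gradSq f (c r) + ‖f (c r)‖ ^ 2) := by
          nlinarith [sq_nonneg ‖f (c r)‖]
        calc r ^ a * (‖f (c r)‖ ^ 2 + ‖fderiv ℝ f (c r) (c' r)‖ ^ 2) ≤
              r ^ a * (L * (gradSq f (c r) + ‖f (c r)‖ ^ 2)) := by gcongr
          _ = _ := by ring

end Hardy

/-! ### Elementary inequalities for integrals of squared norms. -/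

section SquareIntegrals

theorem enorm_add_sq_le {F : Type*} [NormedAddCommGroup F] (a b : F) :
    ‖a + b‖ₑ ^ 2 ≤ 2 * (‖a‖ₑ ^ 2 + ‖b‖ₑ ^ 2) := by
  have h : ‖a + b‖ ^ 2 ≤ 2 * (‖a‖ ^ 2 + ‖b‖ ^ 2) := by
    have := norm_add_le a b
    nlinarith [sq_nonneg (‖a‖ - ‖b‖), norm_nonneg (a + b), norm_nonneg a, norm_nonneg b]
  have h2 := ENNReal.ofReal_le_ofReal h
  rw [ENNReal.ofReal_mul (by norm_num), ENNReal.ofReal_add (by positivity) (by positivity),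
    ENNReal.ofReal_pow (norm_nonneg _), ENNReal.ofReal_pow (norm_nonneg _),
    ENNReal.ofReal_pow (norm_nonneg _), ofReal_norm, ofReal_norm, ofReal_norm,
    ENNReal.ofReal_ofNat] at h2
  exact h2

theorem lintegral_enorm_add_sq_le {α F : Type*} [MeasurableSpace α] [NormedAddCommGroup F]
    {μ : Measure α} {f g : α → F} (hf : AEStronglyMeasurable f μ) :
    ∫⁻ x, ‖f x + g x‖ₑ ^ 2 ∂μ ≤ 2 * (∫⁻ x, ‖f x‖ₑ ^ 2 ∂μ + ∫⁻ x, ‖g x‖ₑ ^ 2 ∂μ) := by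
  rw [← lintegral_add_left' (hf.enorm.pow_const 2), ← lintegral_const_mul' _ _ (by norm_num)]
  exact lintegral_mono fun x => enorm_add_sq_le _ _

theorem lintegral_sq_le {α : Type*} [MeasurableSpace α] (ν : Measure α) [IsProbabilityMeasure ν]
    {h : α → ℝ≥0∞} (hh : AEMeasurable h ν) : (∫⁻ z, h z ∂ν) ^ 2 ≤ ∫⁻ z, h z ^ 2 ∂ν := by
  have h1 := ENNReal.lintegral_mul_le_Lp_mul_Lq ν Real.HolderConjugate.two_two hh
    (aemeasurable_const (b := (1 : ℝ≥0∞)))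
  simp only [Pi.mul_apply, mul_one, ENNReal.one_rpow, lintegral_one, measure_univ] at h1
  calc (∫⁻ z, h z ∂ν) ^ 2 ≤ ((∫⁻ z, h z ^ (2 : ℝ) ∂ν) ^ (1 / (2 : ℝ))) ^ 2 := by gcongr
    _ = ∫⁻ z, h z ^ (2 : ℝ) ∂ν := by
      rw [← ENNReal.rpow_natCast, ← ENNReal.rpow_mul]; norm_num
    _ = _ := by simp

/-- Jensen's inequality for the squared norm of an average. -/
theorem enorm_integral_sq_le {α F : Type*} [MeasurableSpace α] [NormedAddCommGroup F]
    [NormedSpace ℝ F] (ν : Measure α) [IsProbabilityMeasure ν] {h : α → F}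
    (hh : AEStronglyMeasurable h ν) : ‖∫ z, h z ∂ν‖ₑ ^ 2 ≤ ∫⁻ z, ‖h z‖ₑ ^ 2 ∂ν :=
  (pow_le_pow_left' (enorm_integral_le_lintegral_enorm h) 2).trans (lintegral_sq_le ν hh.enorm)

/-- Jensen's inequality for the probability measure with density w. -/
theorem enorm_integral_smul_sq_le {α F : Type*} [MeasurableSpace α] [NormedAddCommGroup F]
    [NormedSpace ℝ F] (μ : Measure α) {w : α → ℝ} (hw : Measurable w) (hw0 : ∀ z, 0 ≤ w z)
    (hw1 : ∫ z, w z ∂μ = 1) {h : α → F} (hh : AEStronglyMeasurable h μ) :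
    ‖∫ z, w z • h z ∂μ‖ₑ ^ 2 ≤ ∫⁻ z, ENNReal.ofReal (w z) * ‖h z‖ₑ ^ 2 ∂μ := by
  have hint : Integrable w μ := by
    by_contra hc
    rw [integral_undef hc] at hw1
    exact zero_ne_one hw1
  let ν := μ.withDensity fun z => ENNReal.ofReal (w z)
  have hν : IsProbabilityMeasure ν := by
    refine ⟨?_⟩
    rw [withDensity_apply _ MeasurableSet.univ, Measure.restrict_univ,
      ← ofReal_integral_eq_lintegral_ofReal hint (Eventually.of_forall hw0), hw1,
      ENNReal.ofReal_one]
  have h1 : ∫ z, h z ∂ν = ∫ z, w z • h z ∂μ := by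
    rw [integral_withDensity_eq_integral_toReal_smul (by fun_prop) (by simp)]
    simp only [ENNReal.toReal_ofReal (hw0 _)]
  have h2 : ∫⁻ z, ‖h z‖ₑ ^ 2 ∂ν = ∫⁻ z, ENNReal.ofReal (w z) * ‖h z‖ₑ ^ 2 ∂μ := by
    rw [lintegral_withDensity_eq_lintegral_mul₀' (by fun_prop)]
    · rfl
    · exact (hh.mono_ac (withDensity_absolutelyContinuous _ _)).enorm.pow_const 2
  rw [← h1, ← h2]
  exact enorm_integral_sq_le ν (hh.mono_ac (withDensity_absolutelyContinuous _ _))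

end SquareIntegrals

/-! ### Dilations and translations under the integral. -/

section AffineChange

variable {E : Type*} [NormedAddCommGroup E] [NormedSpace ℝ E] [MeasurableSpace E] [BorelSpace E]
  [FiniteDimensional ℝ E] (μ : Measure E) [μ.IsAddHaarMeasure]

theorem lintegral_comp_smul_add {G : E → ℝ≥0∞} {c : ℝ} (hc : 0 < c) (w : E) :
    ∫⁻ x, G (c • x + w) ∂μ = ENNReal.ofReal ((c ^ Module.finrank ℝ E)⁻¹) * ∫⁻ x, G x ∂μ := by
  rw [← lintegral_add_right_eq_self G w, lintegral_eq_smul μ (G := fun x => G (x + w)) hc,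
    ← mul_assoc, ← ENNReal.ofReal_mul (by positivity), inv_mul_cancel₀ (by positivity),
    ENNReal.ofReal_one, one_mul]

/-- The image of Ω stays in Ω, so only the Jacobian c^(-d) ≤ 2^d is lost, uniformly in the map. -/
theorem setLIntegral_comp_smul_add_le {Ω : Set E} (hΩ : MeasurableSet Ω) {G : E → ℝ≥0∞} {c : ℝ}
    (hc : 1 / 2 ≤ c) (w : E) (h : ∀ x ∈ Ω, c • x + w ∈ Ω) :
    ∫⁻ x in Ω, G (c • x + w) ∂μ ≤
      ENNReal.ofReal (2 ^ Module.finrank ℝ E) * ∫⁻ x in Ω, G x ∂μ := by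
  have hc0 : 0 < c := by linarith
  calc ∫⁻ x in Ω, G (c • x + w) ∂μ ≤ ∫⁻ x, Ω.indicator G (c • x + w) ∂μ := by
        rw [← lintegral_indicator hΩ]
        refine lintegral_mono fun x => ?_
        by_cases hx : x ∈ Ω
        · rw [Set.indicator_of_mem hx, Set.indicator_of_mem (h x hx)]
        · rw [Set.indicator_of_notMem hx]; exact zero_le
    _ = ENNReal.ofReal ((c ^ Module.finrank ℝ E)⁻¹) * ∫⁻ x in Ω, G x ∂μ := by
        rw [lintegral_comp_smul_add μ hc0, lintegral_indicator hΩ]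
    _ ≤ _ := by
        gcongr
        rw [← inv_pow]
        gcongr
        rw [inv_le_comm₀ hc0 (by norm_num)]
        linarith

end AffineChange

/-! ### Contraction followed by mollification. -/

section Smearing

variable {d : ℕ}

theorem ofReal_gradSq_eq (f : EuclideanSpace ℝ (Fin d) → ℂ) (x : EuclideanSpace ℝ (Fin d)) :
    ENNReal.ofReal (gradSq f x) = ∑ i, ‖fderiv ℝ f x (EuclideanSpace.single i 1)‖ₑ ^ 2 := by
  rw [gradSq, ENNReal.ofReal_sum_of_nonneg fun _ _ => by positivity]
  refine Finset.sum_congr rfl fun i _ => ?_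
  rw [ENNReal.ofReal_pow (norm_nonneg _), ofReal_norm]

/-- Variation of a `C¹` function along a family of segments that stay in `Ω`. -/
theorem lintegral_enorm_sub_sq_le_of_path {Ω : Set (EuclideanSpace ℝ (Fin d))}
    (hΩ : MeasurableSet Ω) {f : EuclideanSpace ℝ (Fin d) → ℂ} (hf : ContDiff ℝ 1 f)
    {α₀ α₁ B : ℝ} (h0 : 1 / 2 ≤ α₀) (h1 : 1 / 2 ≤ α₁) {w : EuclideanSpace ℝ (Fin d)}
    (hpath : ∀ τ ∈ Set.Icc (0 : ℝ) 1, ∀ x ∈ Ω, (α₀ + τ * (α₁ - α₀)) • x + τ • w ∈ Ω)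
    (hB : ∀ x ∈ Ω, ‖(α₁ - α₀) • x + w‖ ≤ B) :
    ∫⁻ x in Ω, ‖f (α₁ • x + w) - f (α₀ • x)‖ₑ ^ 2 ≤
      ENNReal.ofReal (B ^ 2 * 2 ^ d) * ∫⁻ x in Ω, ENNReal.ofReal (gradSq f x) := by
  have hgc := continuous_gradSq hf
  let P : ℝ → EuclideanSpace ℝ (Fin d) → EuclideanSpace ℝ (Fin d) :=
    fun τ x => (α₀ + τ * (α₁ - α₀)) • x + τ • w
  have hP : ∀ x τ, HasDerivAt (fun τ => P τ x) ((α₁ - α₀) • x + w) τ := by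
    intro x τ
    have e1 : HasDerivAt (fun τ : ℝ => α₀ + τ * (α₁ - α₀)) (α₁ - α₀) τ := by
      simpa using ((hasDerivAt_id τ).mul_const (α₁ - α₀)).const_add α₀
    have e2 : HasDerivAt (fun τ : ℝ => τ • w) w τ := by
      simpa using (hasDerivAt_id τ).smul_const w
    exact (e1.smul_const x).add e2
  have hPc : Continuous (Function.uncurry P) := by
    simp only [P, Function.uncurry_def]
    fun_prop
  have hν : IsProbabilityMeasure (volume.restrict (Set.Ioc (0 : ℝ) 1)) := ⟨by simp⟩
  -- Fundamental theorem of calculus along the segment, whose velocity is constant, then Jensen in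
  -- τ.
  have hpt : ∀ x ∈ Ω, ‖f (α₁ • x + w) - f (α₀ • x)‖ₑ ^ 2 ≤
      ENNReal.ofReal (B ^ 2) * ∫⁻ τ in Set.Ioc (0 : ℝ) 1, ENNReal.ofReal (gradSq f (P τ x)) := by
    intro x hx
    have hPx : Continuous fun τ => P τ x := hPc.comp (by fun_prop : Continuous fun τ => (τ, x))
    have hD : Continuous fun τ => fderiv ℝ f (P τ x) ((α₁ - α₀) • x + w) :=
      ((hf.continuous_fderiv one_ne_zero).comp hPx).clm_apply continuous_const
    have e1 := intervalIntegral.integral_eq_sub_of_hasDerivAt (a := 0) (b := 1)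
      (f := fun τ => f (P τ x))
      (fun τ _ => (hf.differentiable one_ne_zero (P τ x)).hasFDerivAt.comp_hasDerivAt τ (hP x τ))
      (hD.intervalIntegrable _ _)
    have e2 : f (α₁ • x + w) - f (α₀ • x) =
        ∫ τ in Set.Ioc (0 : ℝ) 1, fderiv ℝ f (P τ x) ((α₁ - α₀) • x + w) := by
      rw [← intervalIntegral.integral_of_le zero_le_one, e1]
      simp [P]
    rw [e2]
    refine (enorm_integral_sq_le _ hD.aestronglyMeasurable).trans ?_
    rw [← lintegral_const_mul' _ _ ENNReal.ofReal_ne_top]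
    refine lintegral_mono fun τ => ?_
    rw [← ofReal_norm, ← ENNReal.ofReal_pow (norm_nonneg _), ← ENNReal.ofReal_mul (sq_nonneg _)]
    refine ENNReal.ofReal_le_ofReal ((norm_fderiv_apply_sq_le f _ _).trans ?_)
    gcongr
    · exact gradSq_nonneg _ _
    · exact hB x hx
  have hm : Measurable (Function.uncurry fun x τ => ENNReal.ofReal (gradSq f (P τ x))) := by
    refine (hgc.comp (hPc.comp (continuous_snd.prodMk continuous_fst))).measurable.ennreal_ofReal
  calc _ ≤ ∫⁻ x in Ω, ENNReal.ofReal (B ^ 2) *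
        ∫⁻ τ in Set.Ioc (0 : ℝ) 1, ENNReal.ofReal (gradSq f (P τ x)) :=
        setLIntegral_mono' hΩ hpt
    _ = ENNReal.ofReal (B ^ 2) * ∫⁻ τ in Set.Ioc (0 : ℝ) 1, ∫⁻ x in Ω,
          ENNReal.ofReal (gradSq f (P τ x)) := by
        rw [lintegral_const_mul' _ _ ENNReal.ofReal_ne_top, lintegral_lintegral_swap hm.aemeasurable]
    _ ≤ ENNReal.ofReal (B ^ 2) * ∫⁻ τ in Set.Ioc (0 : ℝ) 1, ENNReal.ofReal (2 ^ d) *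
          ∫⁻ x in Ω, ENNReal.ofReal (gradSq f x) := by
        refine mul_le_mul_right (setLIntegral_mono' measurableSet_Ioc fun τ hτ => ?_) _
        have := setLIntegral_comp_smul_add_le volume hΩ
          (G := fun x => ENNReal.ofReal (gradSq f x)) (c := α₀ + τ * (α₁ - α₀)) (w := τ • w)
          (by nlinarith [hτ.1, hτ.2]) (hpath τ ⟨hτ.1.le, hτ.2⟩)
        rwa [finrank_euclideanSpace_fin] at this
    _ = _ := by
        rw [lintegral_const, measure_univ, mul_one, ENNReal.ofReal_mul (sq_nonneg _), mul_assoc]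

/-- Average of the dilates and translates `u (s • · - z)` against a normalized bump function. -/
noncomputable def smear (φ : ContDiffBump (0 : EuclideanSpace ℝ (Fin d))) (s : ℝ)
    (u : EuclideanSpace ℝ (Fin d) → ℂ) (x : EuclideanSpace ℝ (Fin d)) : ℂ :=
  ∫ z, φ.normed volume z • u (s • x - z)

theorem enorm_smear_sq_le (φ : ContDiffBump (0 : EuclideanSpace ℝ (Fin d))) (s : ℝ)
    {u : EuclideanSpace ℝ (Fin d) → ℂ} (hu : Measurable u) (x : EuclideanSpace ℝ (Fin d)) :
    ‖smear φ s u x‖ₑ ^ 2 ≤ ∫⁻ z, ENNReal.ofReal (φ.normed volume z) * ‖u (s • x - z)‖ₑ ^ 2 :=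
  enorm_integral_smul_sq_le volume φ.continuous_normed.measurable φ.nonneg_normed φ.integral_normed
    (hu.comp (measurable_const.sub measurable_id)).aestronglyMeasurable

theorem lintegral_ofReal_normed (φ : ContDiffBump (0 : EuclideanSpace ℝ (Fin d))) :
    ∫⁻ z, ENNReal.ofReal (φ.normed volume z) = 1 := by
  rw [← ofReal_integral_eq_lintegral_ofReal φ.integrable_normed
    (Eventually.of_forall φ.nonneg_normed), φ.integral_normed, ENNReal.ofReal_one]

/-- Jensen under the averaging and a change of variables for each z. The constant is independent of
φ and s, so approximation properties extend from smooth functions to L². -/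
theorem lintegral_enorm_smear_sq_le (φ : ContDiffBump (0 : EuclideanSpace ℝ (Fin d))) {s : ℝ}
    (hs : 1 / 2 ≤ s) {u : EuclideanSpace ℝ (Fin d) → ℂ} (hu : Measurable u) :
    ∫⁻ x, ‖smear φ s u x‖ₑ ^ 2 ≤ ENNReal.ofReal (2 ^ d) * ∫⁻ x, ‖u x‖ₑ ^ 2 := by
  have hm : Measurable (Function.uncurry fun x z : EuclideanSpace ℝ (Fin d) =>
      ENNReal.ofReal (φ.normed volume z) * ‖u (s • x - z)‖ₑ ^ 2) := by
    have m1 : Measurable fun p : EuclideanSpace ℝ (Fin d) × EuclideanSpace ℝ (Fin d) =>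
        s • p.1 - p.2 := by fun_prop
    exact (φ.continuous_normed.measurable.comp measurable_snd).ennreal_ofReal.mul
      ((hu.comp m1).enorm.pow_const 2)
  calc _ ≤ ∫⁻ x, ∫⁻ z, ENNReal.ofReal (φ.normed volume z) * ‖u (s • x - z)‖ₑ ^ 2 :=
        lintegral_mono fun x => enorm_smear_sq_le φ s hu x
    _ = ∫⁻ z, ENNReal.ofReal (φ.normed volume z) * ∫⁻ x, ‖u (s • x - z)‖ₑ ^ 2 := by
        rw [lintegral_lintegral_swap hm.aemeasurable]
        simp_rw [lintegral_const_mul' _ _ ENNReal.ofReal_ne_top]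
    _ ≤ ∫⁻ z, ENNReal.ofReal (φ.normed volume z) *
          (ENNReal.ofReal (2 ^ d) * ∫⁻ x, ‖u x‖ₑ ^ 2) := by
        refine lintegral_mono fun z => mul_le_mul_right ?_ _
        have := setLIntegral_comp_smul_add_le (volume : Measure (EuclideanSpace ℝ (Fin d)))
          MeasurableSet.univ (G := fun x => ‖u x‖ₑ ^ 2) hs (-z) (fun x _ => Set.mem_univ _)
        simpa only [Measure.restrict_univ, finrank_euclideanSpace_fin, sub_eq_add_neg] using this
    _ = _ := by
        rw [lintegral_mul_const'' _ φ.continuous_normed.measurable.ennreal_ofReal.aemeasurable,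
          lintegral_ofReal_normed, one_mul]

end Smearing

/-! ### Smearing as an approximate identity on star-shaped domains. -/

section Approximation

variable {d : ℕ} {Ω : Set (EuclideanSpace ℝ (Fin d))} {R : ℝ}

/-- A bounded open set which is star-shaped about the origin and whose contractions about the
origin have positive distance to its boundary. -/
structure StarContracting (Ω : Set (EuclideanSpace ℝ (Fin d))) (R : ℝ) : Prop where
  isOpen : IsOpen Ω
  radius_nonneg : 0 ≤ R
  norm_le : ∀ x ∈ Ω, ‖x‖ ≤ R
  smul_mem : ∀ x ∈ Ω, ∀ s ∈ Set.Icc (0 : ℝ) 1, s • x ∈ Ω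
  room : ∀ s ∈ Set.Ioo (0 : ℝ) 1, ∃ ε > 0, ∀ x ∈ Ω, ∀ z, ‖z‖ ≤ ε → s • x + z ∈ Ω

/-- The averages of `smear φ s` at points of `Ω` only involve points of `Ω`. -/
structure Admissible (Ω : Set (EuclideanSpace ℝ (Fin d)))
    (φ : ContDiffBump (0 : EuclideanSpace ℝ (Fin d))) (s : ℝ) : Prop where
  half_le : 1 / 2 ≤ s
  le_one : s ≤ 1
  rOut_le : φ.rOut ≤ 1 - s
  mem : ∀ x ∈ Ω, ∀ z, ‖z‖ ≤ φ.rOut → s • x - z ∈ Ω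

theorem StarContracting.exists_admissible (hΩ : StarContracting Ω R) :
    ∃ (φ : ℕ → ContDiffBump (0 : EuclideanSpace ℝ (Fin d))) (s : ℕ → ℝ),
      (∀ k, Admissible Ω (φ k) (s k)) ∧ Tendsto s atTop (𝓝 1) := by
  -- The factor s = 1 - 1/(k + 2) never drops below 1/2; the bump radius is cut to min(ε, 1 - s), so
  -- that smearing displaces points by O(1 - s).
  have key : ∀ k : ℕ, ∃ φ : ContDiffBump (0 : EuclideanSpace ℝ (Fin d)),
      Admissible Ω φ (1 - 1 / ((k : ℝ) + 1 + 1)) := by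
    intro k
    have hk : 0 < 1 / ((k : ℝ) + 1 + 1) := by positivity
    have hk2 : 1 / ((k : ℝ) + 1 + 1) ≤ 1 / 2 := by
      apply one_div_le_one_div_of_le (by norm_num)
      linarith [Nat.cast_nonneg (α := ℝ) k]
    obtain ⟨ε, hε, hr⟩ := hΩ.room (1 - 1 / ((k : ℝ) + 1 + 1)) ⟨by linarith, by linarith⟩
    have hm : 0 < min ε (1 / ((k : ℝ) + 1 + 1)) := lt_min hε hk
    refine ⟨⟨min ε (1 / ((k : ℝ) + 1 + 1)) / 2, min ε (1 / ((k : ℝ) + 1 + 1)), by positivity,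
      by linarith⟩, by linarith, by linarith, ?_, ?_⟩
    · exact (min_le_right _ _).trans (by linarith)
    · intro x hx z hz
      rw [sub_eq_add_neg]
      exact hr x hx (-z) (by rw [norm_neg]; exact hz.trans (min_le_left _ _))
  choose φ hφ using key
  refine ⟨φ, _, hφ, ?_⟩
  have h := (tendsto_one_div_add_atTop_nhds_zero_nat (𝕜 := ℝ)).comp (tendsto_add_atTop_nat 1)
  simpa [Function.comp_def] using h.const_sub 1

theorem lintegral_ofReal_lt_top_of_continuous (hΩ : StarContracting Ω R)
    {h : EuclideanSpace ℝ (Fin d) → ℝ} (hh : Continuous h) :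
    ∫⁻ x in Ω, ENNReal.ofReal (h x) < ⊤ := by
  have h1 : IntegrableOn h (Metric.closedBall 0 R) :=
    hh.continuousOn.integrableOn_compact (isCompact_closedBall 0 R)
  have h2 : IntegrableOn h Ω := h1.mono_set fun x hx => by simpa using hΩ.norm_le x hx
  exact h2.lintegral_lt_top

theorem integrable_normed_smul {φ : ContDiffBump (0 : EuclideanSpace ℝ (Fin d))}
    {u : EuclideanSpace ℝ (Fin d) → ℂ} (hu : LocallyIntegrable u)
    (y : EuclideanSpace ℝ (Fin d)) : Integrable fun z => φ.normed volume z • u (y - z) :=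
  (φ.hasCompactSupport_normed (μ := volume)).convolutionExists_left
    (ContinuousLinearMap.lsmul ℝ ℝ) φ.continuous_normed hu y

theorem smear_sub {φ : ContDiffBump (0 : EuclideanSpace ℝ (Fin d))} {s : ℝ}
    {u v : EuclideanSpace ℝ (Fin d) → ℂ} (hu : LocallyIntegrable u) (hv : LocallyIntegrable v)
    (x : EuclideanSpace ℝ (Fin d)) :
    smear φ s (fun y => u y - v y) x = smear φ s u x - smear φ s v x := by
  simp only [smear, smul_sub]
  exact integral_sub (integrable_normed_smul hu _) (integrable_normed_smul hv _)

theorem contDiff_smear {φ : ContDiffBump (0 : EuclideanSpace ℝ (Fin d))} {s : ℝ}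
    {u : EuclideanSpace ℝ (Fin d) → ℂ} (hu : LocallyIntegrable u) :
    ContDiff ℝ ∞ (smear φ s u) := by
  have h := (φ.hasCompactSupport_normed (μ := volume)).contDiff_convolution_left (n := ⊤)
    (ContinuousLinearMap.lsmul ℝ ℝ) φ.contDiff_normed hu
  exact h.comp (contDiff_const_smul s)

theorem norm_lt_rOut_of_normed_ne_zero {φ : ContDiffBump (0 : EuclideanSpace ℝ (Fin d))}
    {z : EuclideanSpace ℝ (Fin d)} (hz : φ.normed volume z ≠ 0) : ‖z‖ < φ.rOut := by
  have : z ∈ Function.support (φ.normed volume) := hz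
  rw [φ.support_normed_eq] at this
  simpa using this

theorem smear_congr_on {φ : ContDiffBump (0 : EuclideanSpace ℝ (Fin d))} {s : ℝ}
    (ha : Admissible Ω φ s) {u v : EuclideanSpace ℝ (Fin d) → ℂ} (huv : ∀ x ∈ Ω, u x = v x)
    {x : EuclideanSpace ℝ (Fin d)} (hx : x ∈ Ω) : smear φ s u x = smear φ s v x := by
  refine integral_congr_ae (Eventually.of_forall fun z => ?_)
  by_cases hz : φ.normed volume z = 0
  · simp [hz]
  · simp only [huv _ (ha.mem x hx z (norm_lt_rOut_of_normed_ne_zero hz).le)]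

/-- The mean-square distance between a `C¹` function and its smeared version. -/
theorem lintegral_smear_sub_sq_le (hΩ : StarContracting Ω R)
    {φ : ContDiffBump (0 : EuclideanSpace ℝ (Fin d))} {s : ℝ} (ha : Admissible Ω φ s)
    {f : EuclideanSpace ℝ (Fin d) → ℂ} (hf : ContDiff ℝ 1 f) :
    ∫⁻ x in Ω, ‖smear φ s f x - f x‖ₑ ^ 2 ≤
      ENNReal.ofReal (4 * (((1 - s) * (R + 1)) ^ 2 * 2 ^ d)) *
        ∫⁻ x in Ω, ENNReal.ofReal (gradSq f x) := by
  set B := (1 - s) * (R + 1) with hB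
  have hR := hΩ.radius_nonneg
  have hs1 := ha.le_one
  have hΩm := hΩ.isOpen.measurableSet
  have hdiff : ∀ x, smear φ s f x - f x = ∫ z, φ.normed volume z • (f (s • x - z) - f x) := by
    intro x
    have e1 : ∫ z, φ.normed volume z • f x = f x := by
      rw [integral_smul_const, φ.integral_normed, one_smul]
    simp only [smul_sub]
    rw [integral_sub (integrable_normed_smul hf.continuous.locallyIntegrable _)
      (φ.integrable_normed.smul_const _), e1]
    rfl
  have hz : ∀ z, ENNReal.ofReal (φ.normed volume z) *
      ∫⁻ x in Ω, ‖f (s • x - z) - f x‖ₑ ^ 2 ≤ ENNReal.ofReal (φ.normed volume z) *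
        (ENNReal.ofReal (4 * (B ^ 2 * 2 ^ d)) * ∫⁻ x in Ω, ENNReal.ofReal (gradSq f x)) := by
    intro z
    by_cases h0 : φ.normed volume z = 0
    · simp [h0]
    have hzr := (norm_lt_rOut_of_normed_ne_zero h0).le
    refine mul_le_mul_right ?_ _
    -- The path from x to s x - z is split into the dilation x → s x, of length at most (1 - s) R,
    -- and a translation of length at most 1 - s. Both stay in Ω and both lengths are at most `B`.
    have p1 := lintegral_enorm_sub_sq_le_of_path hΩm hf ha.half_le ha.half_le (w := -z) (B := B)
      (fun τ hτ x hx => by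
        have := ha.mem x hx (τ • z) (by
          rw [norm_smul, Real.norm_of_nonneg hτ.1]
          exact (mul_le_of_le_one_left (norm_nonneg _) hτ.2).trans hzr)
        simpa [sub_eq_add_neg] using this)
      (fun x hx => by
        simp only [sub_self, zero_smul, zero_add, norm_neg]
        have := ha.rOut_le
        rw [hB]
        nlinarith)
    have p2 := lintegral_enorm_sub_sq_le_of_path hΩm hf (α₀ := 1) (by norm_num) ha.half_le (w := 0)
      (B := B)
      (fun τ hτ x hx => by
        have := hΩ.smul_mem x hx (1 + τ * (s - 1))
          ⟨by nlinarith [hτ.1, hτ.2, ha.half_le], by nlinarith [hτ.1, hτ.2]⟩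
        simpa using this)
      (fun x hx => by
        have := hΩ.norm_le x hx
        rw [add_zero, norm_smul, Real.norm_eq_abs, abs_sub_comm, abs_of_nonneg (by linarith), hB]
        gcongr
        linarith)
    calc ∫⁻ x in Ω, ‖f (s • x - z) - f x‖ₑ ^ 2
        = ∫⁻ x in Ω, ‖(f (s • x + -z) - f (s • x)) + (f (s • x + 0) - f ((1 : ℝ) • x))‖ₑ ^ 2 := by
          simp [sub_eq_add_neg]
      _ ≤ 2 * ((∫⁻ x in Ω, ‖f (s • x + -z) - f (s • x)‖ₑ ^ 2) +
            ∫⁻ x in Ω, ‖f (s • x + 0) - f ((1 : ℝ) • x)‖ₑ ^ 2) :=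
          lintegral_enorm_add_sq_le (by
            have := hf.continuous
            exact (by fun_prop : Continuous fun x => f (s • x + -z) - f (s • x)).aestronglyMeasurable)
      _ ≤ 2 * (ENNReal.ofReal (B ^ 2 * 2 ^ d) * (∫⁻ x in Ω, ENNReal.ofReal (gradSq f x)) +
            ENNReal.ofReal (B ^ 2 * 2 ^ d) * ∫⁻ x in Ω, ENNReal.ofReal (gradSq f x)) := by
          gcongr
      _ = _ := by
          rw [ENNReal.ofReal_mul (by norm_num : (0 : ℝ) ≤ 4), ENNReal.ofReal_ofNat]
          ring
  have hm : Measurable (Function.uncurry fun x z : EuclideanSpace ℝ (Fin d) =>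
      ENNReal.ofReal (φ.normed volume z) * ‖f (s • x - z) - f x‖ₑ ^ 2) := by
    have hfc := hf.continuous
    have c1 : Continuous fun p : EuclideanSpace ℝ (Fin d) × EuclideanSpace ℝ (Fin d) =>
        f (s • p.1 - p.2) - f p.1 := by fun_prop
    exact (φ.continuous_normed.measurable.comp measurable_snd).ennreal_ofReal.mul
      (c1.measurable.enorm.pow_const 2)
  calc _ ≤ ∫⁻ x in Ω, ∫⁻ z, ENNReal.ofReal (φ.normed volume z) *
          ‖f (s • x - z) - f x‖ₑ ^ 2 := by
        refine lintegral_mono fun x => ?_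
        rw [hdiff]
        have hfc := hf.continuous
        exact enorm_integral_smul_sq_le volume φ.continuous_normed.measurable φ.nonneg_normed
          φ.integral_normed
          (by fun_prop : Continuous fun z => f (s • x - z) - f x).aestronglyMeasurable
    _ = ∫⁻ z, ENNReal.ofReal (φ.normed volume z) * ∫⁻ x in Ω, ‖f (s • x - z) - f x‖ₑ ^ 2 := by
        rw [lintegral_lintegral_swap hm.aemeasurable]
        simp_rw [lintegral_const_mul' _ _ ENNReal.ofReal_ne_top]
    _ ≤ _ := lintegral_mono hz
    _ = _ := by
        rw [lintegral_mul_const'' _ φ.continuous_normed.measurable.ennreal_ofReal.aemeasurable,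
          lintegral_ofReal_normed, one_mul]

theorem memLp_two_of_lintegral {α : Type*} [MeasurableSpace α] {μ : Measure α} {u : α → ℂ}
    (hu : AEStronglyMeasurable u μ) (h : ∫⁻ x, ‖u x‖ₑ ^ 2 ∂μ < ⊤) : MemLp u 2 μ := by
  refine ⟨hu, ?_⟩
  have h1 := eLpNorm_nnreal_pow_eq_lintegral (f := u) (μ := μ) (p := 2) two_ne_zero
  simp only [NNReal.coe_ofNat, ENNReal.rpow_ofNat] at h1
  rw [← h1] at h
  by_contra hc
  rw [not_lt, top_le_iff] at hc
  have hc' : eLpNorm u ((2 : NNReal) : ℝ≥0∞) μ = ⊤ := by simpa using hc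
  rw [hc'] at h
  simp at h

theorem eLpNorm_two_sq {α F : Type*} [MeasurableSpace α] [NormedAddCommGroup F] {μ : Measure α}
    {u : α → F} : eLpNorm u 2 μ ^ 2 = ∫⁻ x, ‖u x‖ₑ ^ 2 ∂μ := by
  have h1 := eLpNorm_nnreal_pow_eq_lintegral (f := u) (μ := μ) (p := 2) two_ne_zero
  simpa using h1

/-- Reduces the smearing error of u to that of a nicer g: u - g enters directly and through the
uniform L² bound for smearing. -/
theorem lintegral_enorm_sub_sq_split
    {φ : ContDiffBump (0 : EuclideanSpace ℝ (Fin d))} {s : ℝ} (ha : Admissible Ω φ s)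
    {u g : EuclideanSpace ℝ (Fin d) → ℂ} (hu : Measurable u) (hg : Measurable g)
    (hul : LocallyIntegrable u) (hgl : LocallyIntegrable g) :
    ∫⁻ x in Ω, ‖smear φ s u x - u x‖ₑ ^ 2 ≤
      4 * (∫⁻ x in Ω, ‖smear φ s g x - g x‖ₑ ^ 2) +
        ENNReal.ofReal (2 * 2 ^ d + 4) * ∫⁻ x, ‖u x - g x‖ₑ ^ 2 := by
  have hcs : ∀ v : EuclideanSpace ℝ (Fin d) → ℂ, LocallyIntegrable v →
      Continuous (smear φ s v) := fun v hv => (contDiff_smear hv).continuous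
  have hsub := lintegral_enorm_smear_sq_le φ ha.half_le (hu.sub hg)
  calc ∫⁻ x in Ω, ‖smear φ s u x - u x‖ₑ ^ 2 = ∫⁻ x in Ω, ‖(smear φ s u x - smear φ s g x) +
          ((smear φ s g x - g x) + (g x - u x))‖ₑ ^ 2 := by simp
    _ ≤ 2 * ((∫⁻ x in Ω, ‖smear φ s u x - smear φ s g x‖ₑ ^ 2) + 2 *
          ((∫⁻ x in Ω, ‖smear φ s g x - g x‖ₑ ^ 2) + ∫⁻ x in Ω, ‖g x - u x‖ₑ ^ 2)) := by
        refine (lintegral_enorm_add_sq_le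
          ((hcs u hul).sub (hcs g hgl)).aestronglyMeasurable).trans ?_
        refine mul_le_mul_right (add_le_add le_rfl ?_) _
        exact lintegral_enorm_add_sq_le
          ((hcs g hgl).aestronglyMeasurable.sub hg.aestronglyMeasurable)
    _ ≤ 2 * (ENNReal.ofReal (2 ^ d) * (∫⁻ x, ‖u x - g x‖ₑ ^ 2) + 2 *
          ((∫⁻ x in Ω, ‖smear φ s g x - g x‖ₑ ^ 2) + ∫⁻ x, ‖u x - g x‖ₑ ^ 2)) := by
        refine mul_le_mul_right (add_le_add ?_ (mul_le_mul_right (add_le_add le_rfl ?_) _)) _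
        · refine (setLIntegral_le_lintegral _ _).trans (le_of_eq_of_le ?_ hsub)
          refine lintegral_congr fun x => ?_
          rw [← smear_sub hul hgl]
          rfl
        · refine (setLIntegral_le_lintegral _ _).trans_eq (lintegral_congr fun x => ?_)
          rw [← enorm_neg, neg_sub]
    _ = _ := by
        rw [ENNReal.ofReal_add (by positivity) (by norm_num), ENNReal.ofReal_mul (by norm_num),
          ENNReal.ofReal_ofNat, ENNReal.ofReal_ofNat]
        ring

theorem tendsto_smear_const {s : ℕ → ℝ} (hs : Tendsto s atTop (𝓝 1)) (R : ℝ) (d : ℕ) :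
    Tendsto (fun k => ENNReal.ofReal (4 * (((1 - s k) * (R + 1)) ^ 2 * 2 ^ d))) atTop (𝓝 0) := by
  have h : Tendsto (fun k => 4 * (((1 - s k) * (R + 1)) ^ 2 * 2 ^ d)) atTop
      (𝓝 (4 * (((1 - 1) * (R + 1)) ^ 2 * 2 ^ d))) :=
    ((((hs.const_sub 1).mul_const _).pow 2).mul_const _).const_mul _
  have h2 := ENNReal.tendsto_ofReal h
  simpa using h2

/-- Smearing is an approximate identity in `L²`. -/
theorem tendsto_lintegral_smear_sub (hΩ : StarContracting Ω R)
    {φ : ℕ → ContDiffBump (0 : EuclideanSpace ℝ (Fin d))} {s : ℕ → ℝ}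
    (ha : ∀ k, Admissible Ω (φ k) (s k)) (hs : Tendsto s atTop (𝓝 1))
    {u : EuclideanSpace ℝ (Fin d) → ℂ} (hu : Measurable u) (hu2 : MemLp u 2) :
    Tendsto (fun k => ∫⁻ x in Ω, ‖smear (φ k) (s k) u x - u x‖ₑ ^ 2) atTop (𝓝 0) := by
  rw [ENNReal.tendsto_nhds_zero]
  intro ε hε
  obtain ⟨r, hr0, hrε⟩ := ENNReal.lt_iff_exists_nnreal_btwn.mp hε
  have hr0' : 0 < (r : ℝ) := by exact_mod_cast hr0
  set K : ℝ := 2 * 2 ^ d + 4 with hK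
  have hK0 : 0 < K := by positivity
  -- A squared error of r/(2K) contributes r/2 after the split; the other r/2 is left for the
  -- smearing error of g.
  obtain ⟨g, hg1, hg2, hg3⟩ := hu2.exist_eLpNorm_sub_le (by norm_num) (by norm_num)
    (Real.sqrt_pos.mpr (show 0 < (r : ℝ) / (2 * K) by positivity))
  have hgu : ∫⁻ x, ‖u x - g x‖ₑ ^ 2 ≤ ENNReal.ofReal (r / (2 * K)) := by
    have h1 : ∫⁻ x, ‖u x - g x‖ₑ ^ 2 = eLpNorm (u - g) 2 volume ^ 2 := eLpNorm_two_sq.symm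
    rw [h1]
    calc _ ≤ (ENNReal.ofReal √(r / (2 * K))) ^ 2 := by gcongr
      _ = _ := by
        rw [← ENNReal.ofReal_pow (Real.sqrt_nonneg _), Real.sq_sqrt (by positivity)]
  have hg2' : ContDiff ℝ 1 g := hg2.of_le (by exact_mod_cast le_top)
  have hG := lintegral_ofReal_lt_top_of_continuous hΩ (continuous_gradSq hg2')
  have hlim : Tendsto (fun k => 4 * (ENNReal.ofReal (4 * (((1 - s k) * (R + 1)) ^ 2 * 2 ^ d)) *
      ∫⁻ x in Ω, ENNReal.ofReal (gradSq g x))) atTop (𝓝 (4 * (0 * ∫⁻ x in Ω,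
        ENNReal.ofReal (gradSq g x)))) :=
    ENNReal.Tendsto.const_mul (ENNReal.Tendsto.mul_const (tendsto_smear_const hs R d)
      (Or.inr hG.ne)) (Or.inr (by norm_num))
  rw [zero_mul, mul_zero, ENNReal.tendsto_nhds_zero] at hlim
  filter_upwards [hlim (ENNReal.ofReal (r / 2)) (by simpa using hr0)] with k hk
  have h1 := lintegral_enorm_sub_sq_split (ha k) hu hg2.continuous.measurable
    (hu2.locallyIntegrable (by norm_num)) hg2.continuous.locallyIntegrable
  refine (h1.trans ?_).trans hrε.le
  calc _ ≤ ENNReal.ofReal (r / 2) + ENNReal.ofReal K * ENNReal.ofReal (r / (2 * K)) := by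
        gcongr
        refine le_trans ?_ hk
        gcongr
        exact lintegral_smear_sub_sq_le hΩ (ha k) hg2'
    _ = ENNReal.ofReal r := by
        rw [← ENNReal.ofReal_mul hK0.le, ← ENNReal.ofReal_add (by positivity) (by positivity)]
        congr 1
        field_simp
        ring
    _ = r := by simp

end Approximation

/-! ### Density in H¹ of functions smooth up to the boundary. -/

section Density

variable {d : ℕ} {Ω : Set (EuclideanSpace ℝ (Fin d))} {R : ℝ}

/-- Extension by zero of a function in `L²(Ω)`. -/
noncomputable def extendZero (Ω : Set (EuclideanSpace ℝ (Fin d))) (u : L2 Ω) :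
    EuclideanSpace ℝ (Fin d) → ℂ :=
  Ω.indicator u

theorem extendZero_of_mem (u : L2 Ω) {x : EuclideanSpace ℝ (Fin d)} (hx : x ∈ Ω) :
    extendZero Ω u x = u x := Set.indicator_of_mem hx _

theorem measurable_extendZero (hΩ : MeasurableSet Ω) (u : L2 Ω) : Measurable (extendZero Ω u) :=
  (Lp.stronglyMeasurable u).measurable.indicator hΩ

theorem lintegral_enorm_sq_eq (u : L2 Ω) : ∫⁻ x in Ω, ‖u x‖ₑ ^ 2 = ‖u‖ₑ ^ 2 := by
  rw [← eLpNorm_two_sq, Lp.enorm_def]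

theorem lintegral_extendZero (hΩ : MeasurableSet Ω) (u : L2 Ω) :
    ∫⁻ x, ‖extendZero Ω u x‖ₑ ^ 2 = ‖u‖ₑ ^ 2 := by
  rw [← lintegral_enorm_sq_eq, ← lintegral_indicator hΩ]
  refine lintegral_congr fun x => ?_
  by_cases hx : x ∈ Ω
  · rw [extendZero_of_mem u hx, Set.indicator_of_mem hx]
  · simp [extendZero, Set.indicator_of_notMem hx]

theorem memLp_extendZero (hΩ : MeasurableSet Ω) (u : L2 Ω) : MemLp (extendZero Ω u) 2 := by
  refine memLp_two_of_lintegral (measurable_extendZero hΩ u).aestronglyMeasurable ?_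
  rw [lintegral_extendZero hΩ]
  exact ENNReal.pow_lt_top enorm_lt_top

theorem locallyIntegrable_extendZero (hΩ : MeasurableSet Ω) (u : L2 Ω) :
    LocallyIntegrable (extendZero Ω u) := (memLp_extendZero hΩ u).locallyIntegrable (by norm_num)

theorem integral_smul_extendZero (hΩ : MeasurableSet Ω) (u : L2 Ω)
    (ψ : EuclideanSpace ℝ (Fin d) → ℝ) : ∫ w, ψ w • extendZero Ω u w = ∫ w in Ω, ψ w • u w := by
  rw [← integral_indicator hΩ]
  congr 1
  ext w
  by_cases hw : w ∈ Ω
  · rw [extendZero_of_mem u hw, Set.indicator_of_mem hw]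
  · simp [extendZero, Set.indicator_of_notMem hw]

theorem smear_eq_integral (φ : ContDiffBump (0 : EuclideanSpace ℝ (Fin d))) (s : ℝ)
    (hΩ : MeasurableSet Ω) (u : L2 Ω) (x : EuclideanSpace ℝ (Fin d)) :
    smear φ s (extendZero Ω u) x = ∫ w in Ω, φ.normed volume (s • x - w) • u w := by
  rw [← integral_smul_extendZero hΩ, smear, ← integral_sub_left_eq_self _ volume (s • x)]
  simp only [sub_sub_cancel]

/-- Differentiation commutes with smearing on `H¹(Ω)`. -/
theorem fderiv_smear (hΩ : MeasurableSet Ω) {φ : ContDiffBump (0 : EuclideanSpace ℝ (Fin d))}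
    {s : ℝ} (ha : Admissible Ω φ s) {U : L2 Ω × (Fin d → L2 Ω)} (hU : U ∈ H1 Ω) (i : Fin d)
    {x : EuclideanSpace ℝ (Fin d)} (hx : x ∈ Ω) :
    fderiv ℝ (smear φ s (extendZero Ω U.1)) x (EuclideanSpace.single i 1) =
      s • smear φ s (extendZero Ω (U.2 i)) x := by
  set y := s • x with hy
  set e := EuclideanSpace.single i (1 : ℝ) with he
  set ρ := φ.normed (volume : Measure (EuclideanSpace ℝ (Fin d))) with hρ
  have hρc : ContDiff ℝ ∞ ρ := φ.contDiff_normed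
  have hρs : HasCompactSupport ρ := φ.hasCompactSupport_normed
  have hul := locallyIntegrable_extendZero hΩ U.1
  have hF := hρs.hasFDerivAt_convolution_left (ContinuousLinearMap.lsmul ℝ ℝ)
    (hρc.of_le (by exact_mod_cast le_top)) hul y
  have hS : HasFDerivAt (fun x : EuclideanSpace ℝ (Fin d) => s • x)
      (s • ContinuousLinearMap.id ℝ (EuclideanSpace ℝ (Fin d))) x :=
    (hasFDerivAt_id x).const_smul s
  have hcomp := (HasFDerivAt.comp x hF hS).fderiv
  have h1 : fderiv ℝ (smear φ s (extendZero Ω U.1)) x = _ := hcomp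
  rw [h1, ContinuousLinearMap.comp_apply, smul_apply,
    ContinuousLinearMap.id_apply, map_smul]
  congr 1
  have hint : Integrable (fun t => (ContinuousLinearMap.precompL (EuclideanSpace ℝ (Fin d))
      (ContinuousLinearMap.lsmul ℝ ℝ : ℝ →L[ℝ] ℂ →L[ℝ] ℂ)) (fderiv ℝ ρ t)
        (extendZero Ω U.1 (y - t))) :=
    (hρs.fderiv ℝ).convolutionExists_left _ (hρc.continuous_fderiv (by simp)) hul y
  rw [convolution_def, ContinuousLinearMap.integral_apply hint]
  simp only [ContinuousLinearMap.precompL_apply, ContinuousLinearMap.lsmul_apply]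
  rw [← integral_sub_left_eq_self _ volume y]
  simp only [sub_sub_cancel]
  -- The reflected bump is the test function in the definition of the weak gradient; admissibility
  -- places its support inside Ω although u was extended by a jump to zero.
  set ψ : EuclideanSpace ℝ (Fin d) → ℝ := fun w => ρ (y - w) with hψ
  have hψc : ContDiff ℝ ∞ ψ := hρc.comp (contDiff_const.sub contDiff_id)
  have hψd : ∀ w, fderiv ℝ ψ w e = -(fderiv ℝ ρ (y - w) e) := by
    intro w
    have e1 : HasFDerivAt (fun w : EuclideanSpace ℝ (Fin d) => y - w)
      (-ContinuousLinearMap.id ℝ (EuclideanSpace ℝ (Fin d))) w := (hasFDerivAt_id w).const_sub y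
    have e2 := (HasFDerivAt.comp w ((hρc.differentiable (by simp)) (y - w)).hasFDerivAt e1).fderiv
    have e3 : fderiv ℝ ψ w = _ := e2
    rw [e3]
    simp
  have hsupp : Function.support ψ ⊆ Metric.closedBall y φ.rOut := by
    intro w hw
    have := norm_lt_rOut_of_normed_ne_zero hw
    rw [mem_closedBall_iff_norm']
    exact this.le
  have hts : tsupport ψ ⊆ Ω := by
    refine (closure_minimal hsupp Metric.isClosed_closedBall).trans fun w hw => ?_
    rw [mem_closedBall_iff_norm'] at hw
    have := ha.mem x hx (y - w) hw
    rwa [← hy, sub_sub_cancel] at this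
  have hcs : HasCompactSupport ψ :=
    HasCompactSupport.of_support_subset_isCompact (isCompact_closedBall _ _) hsupp
  have hweak := hU i ψ hψc hcs hts
  simp only [← he, hψd, neg_smul, integral_neg, neg_inj] at hweak
  rw [integral_smul_extendZero hΩ, hweak, smear_eq_integral φ s hΩ]

/-- Functions smooth up to the boundary are dense in `H¹(Ω)`. -/
theorem exists_smooth_approx (hΩ : StarContracting Ω R) {U : L2 Ω × (Fin d → L2 Ω)}
    (hU : U ∈ H1 Ω) : ∃ f : ℕ → EuclideanSpace ℝ (Fin d) → ℂ, (∀ k, ContDiff ℝ ∞ (f k)) ∧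
      Tendsto (fun k => ∫⁻ x in Ω, ‖f k x - U.1 x‖ₑ ^ 2) atTop (𝓝 0) ∧
      ∀ i, Tendsto (fun k => ∫⁻ x in Ω,
        ‖fderiv ℝ (f k) x (EuclideanSpace.single i 1) - U.2 i x‖ₑ ^ 2) atTop (𝓝 0) := by
  obtain ⟨φ, s, ha, hs⟩ := hΩ.exists_admissible
  have hm := hΩ.isOpen.measurableSet
  have hlim : ∀ u : L2 Ω, Tendsto (fun k => ∫⁻ x in Ω,
      ‖smear (φ k) (s k) (extendZero Ω u) x - u x‖ₑ ^ 2) atTop (𝓝 0) := by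
    intro u
    refine (tendsto_lintegral_smear_sub hΩ ha hs (measurable_extendZero hm u)
      (memLp_extendZero hm u)).congr fun k => ?_
    refine setLIntegral_congr_fun hm fun x hx => ?_
    simp only [extendZero_of_mem u hx]
  refine ⟨fun k => smear (φ k) (s k) (extendZero Ω U.1),
    fun k => contDiff_smear (locallyIntegrable_extendZero hm _), hlim U.1, fun i => ?_⟩
  -- The gradient of the smeared function is s times the smeared gradient, so its error splits as s
  -- (smear g - g) + (s - 1) g.
  have hup : Tendsto (fun k => 2 * ((∫⁻ x in Ω,
      ‖smear (φ k) (s k) (extendZero Ω (U.2 i)) x - U.2 i x‖ₑ ^ 2) +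
        ENNReal.ofReal ((s k - 1) ^ 2) * ‖U.2 i‖ₑ ^ 2)) atTop (𝓝 (2 * (0 + 0 * ‖U.2 i‖ₑ ^ 2))) := by
    refine ENNReal.Tendsto.const_mul ((hlim (U.2 i)).add
      (ENNReal.Tendsto.mul_const ?_ (Or.inr (ENNReal.pow_lt_top enorm_lt_top).ne)))
      (Or.inr (by norm_num))
    have := ENNReal.tendsto_ofReal ((hs.sub_const 1).pow 2)
    simpa using this
  rw [zero_mul, add_zero, mul_zero] at hup
  refine tendsto_of_tendsto_of_tendsto_of_le_of_le tendsto_const_nhds hup (fun _ => zero_le)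
    fun k => ?_
  have hcs : Continuous (smear (φ k) (s k) (extendZero Ω (U.2 i))) :=
    (contDiff_smear (locallyIntegrable_extendZero hm _)).continuous
  have hgm : AEStronglyMeasurable (U.2 i) (volume.restrict Ω) := Lp.aestronglyMeasurable _
  calc _ = ∫⁻ x in Ω, ‖s k • (smear (φ k) (s k) (extendZero Ω (U.2 i)) x - U.2 i x) +
          (s k - 1) • U.2 i x‖ₑ ^ 2 := by
        refine setLIntegral_congr_fun hm fun x hx => ?_
        simp only [fderiv_smear hm (ha k) hU i hx]
        congr 2
        module
    _ ≤ 2 * ((∫⁻ x in Ω, ‖s k • (smear (φ k) (s k) (extendZero Ω (U.2 i)) x - U.2 i x)‖ₑ ^ 2) +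
          ∫⁻ x in Ω, ‖(s k - 1) • U.2 i x‖ₑ ^ 2) :=
        lintegral_enorm_add_sq_le ((hcs.aestronglyMeasurable.sub hgm).const_smul (s k))
    _ ≤ _ := by
        refine mul_le_mul_right (add_le_add (lintegral_mono fun x => ?_) (le_of_eq ?_)) _
        · have h1 : ‖s k‖ₑ ≤ 1 := by
            rw [← ofReal_norm, ← ENNReal.ofReal_one, Real.norm_eq_abs,
              abs_of_nonneg (by linarith [(ha k).half_le])]
            exact ENNReal.ofReal_le_ofReal (ha k).le_one
          rw [enorm_smul]
          calc _ ≤ (1 * ‖smear (φ k) (s k) (extendZero Ω (U.2 i)) x - U.2 i x‖ₑ) ^ 2 := by gcongr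
            _ = _ := by rw [one_mul]
        · rw [← lintegral_enorm_sq_eq, ← lintegral_const_mul' _ _ ENNReal.ofReal_ne_top]
          refine lintegral_congr fun x => ?_
          rw [enorm_smul, mul_pow, ← ofReal_norm (s k - 1), ← ENNReal.ofReal_pow (norm_nonneg _),
            Real.norm_eq_abs, sq_abs]

/-- The mean-square distance between a function in `H¹(Ω)` and its smeared version. -/
theorem lintegral_smear_sub_sq_le_of_mem_H1 (hΩ : StarContracting Ω R)
    {φ : ContDiffBump (0 : EuclideanSpace ℝ (Fin d))} {s : ℝ} (ha : Admissible Ω φ s)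
    {U : L2 Ω × (Fin d → L2 Ω)} (hU : U ∈ H1 Ω) :
    ∫⁻ x in Ω, ‖smear φ s (extendZero Ω U.1) x - U.1 x‖ₑ ^ 2 ≤
      8 * ENNReal.ofReal (4 * (((1 - s) * (R + 1)) ^ 2 * 2 ^ d)) * ∑ i, ‖U.2 i‖ₑ ^ 2 := by
  obtain ⟨f, hf, hf0, hf1⟩ := exists_smooth_approx hΩ hU
  have hm := hΩ.isOpen.measurableSet
  set C := ENNReal.ofReal (4 * (((1 - s) * (R + 1)) ^ 2 * 2 ^ d)) with hC
  set K := ENNReal.ofReal (2 * 2 ^ d + 4) with hK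
  have hlim : Tendsto (fun k => 4 * (C * ∑ i, 2 * ((∫⁻ x in Ω,
      ‖fderiv ℝ (f k) x (EuclideanSpace.single i 1) - U.2 i x‖ₑ ^ 2) + ‖U.2 i‖ₑ ^ 2)) +
        K * ∫⁻ x in Ω, ‖f k x - U.1 x‖ₑ ^ 2) atTop
      (𝓝 (4 * (C * ∑ i, 2 * (0 + ‖U.2 i‖ₑ ^ 2)) + K * 0)) := by
    refine Tendsto.add (ENNReal.Tendsto.const_mul (ENNReal.Tendsto.const_mul
      (tendsto_finsetSum _ fun i _ => ENNReal.Tendsto.const_mul ((hf1 i).add_const _)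
        (Or.inr (by norm_num))) (Or.inr ENNReal.ofReal_ne_top)) (Or.inr (by norm_num)))
      (ENNReal.Tendsto.const_mul hf0 (Or.inr ENNReal.ofReal_ne_top))
  have hval : 4 * (C * ∑ i, 2 * (0 + ‖U.2 i‖ₑ ^ 2)) + K * 0 = 8 * C * ∑ i, ‖U.2 i‖ₑ ^ 2 := by
    simp only [zero_add, mul_zero, add_zero, ← Finset.mul_sum]
    ring
  rw [hval] at hlim
  -- For each smooth `f k` the C¹ estimate applies. The constant 8 is the 4 of the split times the 2
  -- lost in replacing the gradient of `f k` by that of U.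
  refine ge_of_tendsto' hlim fun k => ?_
  have hf1k : ContDiff ℝ 1 (f k) := (hf k).of_le (by exact_mod_cast le_top)
  have hfc := (hf k).continuous
  have h1 := lintegral_enorm_sub_sq_split (Ω := Ω) ha (measurable_extendZero hm U.1)
    (hfc.measurable.indicator hm) (locallyIntegrable_extendZero hm U.1)
    (hfc.locallyIntegrable.indicator hm)
  have e1 : ∫⁻ x in Ω, ‖smear φ s (extendZero Ω U.1) x - extendZero Ω U.1 x‖ₑ ^ 2 =
      ∫⁻ x in Ω, ‖smear φ s (extendZero Ω U.1) x - U.1 x‖ₑ ^ 2 :=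
    setLIntegral_congr_fun hm fun x hx => by simp only [extendZero_of_mem U.1 hx]
  have e2 : ∫⁻ x in Ω, ‖smear φ s (Ω.indicator (f k)) x - Ω.indicator (f k) x‖ₑ ^ 2 =
      ∫⁻ x in Ω, ‖smear φ s (f k) x - f k x‖ₑ ^ 2 :=
    setLIntegral_congr_fun hm fun x hx => by
      simp only [Set.indicator_of_mem hx]
      rw [smear_congr_on ha (fun y hy => Set.indicator_of_mem hy (f k)) hx]
  have e3 : ∫⁻ x, ‖extendZero Ω U.1 x - Ω.indicator (f k) x‖ₑ ^ 2 =
      ∫⁻ x in Ω, ‖f k x - U.1 x‖ₑ ^ 2 := by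
    rw [← lintegral_indicator hm]
    refine lintegral_congr fun x => ?_
    by_cases hx : x ∈ Ω
    · rw [extendZero_of_mem U.1 hx, Set.indicator_of_mem hx, Set.indicator_of_mem hx, ← enorm_neg,
        neg_sub]
    · simp [extendZero, Set.indicator_of_notMem hx]
  rw [e1, e2, e3] at h1
  refine h1.trans (add_le_add (mul_le_mul_right ((lintegral_smear_sub_sq_le hΩ ha hf1k).trans
    (mul_le_mul_right ?_ _)) _) le_rfl)
  have hdc : ∀ i, Continuous fun x => fderiv ℝ (f k) x (EuclideanSpace.single i 1) := fun i =>
    (hf1k.continuous_fderiv one_ne_zero).clm_apply continuous_const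
  simp only [ofReal_gradSq_eq]
  rw [lintegral_finsetSum' _ fun i _ => ((hdc i).enorm.measurable.pow_const 2).aemeasurable]
  refine Finset.sum_le_sum fun i _ => ?_
  have hgm : AEStronglyMeasurable (U.2 i) (volume.restrict Ω) := Lp.aestronglyMeasurable _
  calc _ = ∫⁻ x in Ω, ‖(fderiv ℝ (f k) x (EuclideanSpace.single i 1) - U.2 i x) +
          U.2 i x‖ₑ ^ 2 := by simp
    _ ≤ 2 * ((∫⁻ x in Ω, ‖fderiv ℝ (f k) x (EuclideanSpace.single i 1) - U.2 i x‖ₑ ^ 2) +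
          ∫⁻ x in Ω, ‖U.2 i x‖ₑ ^ 2) :=
        lintegral_enorm_add_sq_le ((hdc i).aestronglyMeasurable.sub hgm)
    _ = _ := by rw [lintegral_enorm_sq_eq]

end Density

/-! ### Rellich's theorem. -/

section Compactness

variable {d : ℕ} {Ω : Set (EuclideanSpace ℝ (Fin d))} {R : ℝ}

/-- Bounded sequences in a separable Hilbert space have weakly convergent subsequences. -/
theorem exists_weakly_convergent_subseq {H : Type*} [NormedAddCommGroup H] [InnerProductSpace ℂ H]
    [CompleteSpace H] [TopologicalSpace.SeparableSpace H] (x : ℕ → H) (C : ℝ)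
    (hx : ∀ j, ‖x j‖ ≤ C) : ∃ φ : ℕ → ℕ, StrictMono φ ∧ ∃ u, ∀ v,
      Tendsto (fun j => inner ℂ v (x (φ j))) atTop (𝓝 (inner ℂ v u)) := by
  -- Sequential Banach–Alaoglu through the Riesz map; conjugation turns ⟨x, v⟩ into ⟨v, x⟩.
  have hK := WeakDual.isSeqCompact_closedBall ℂ H 0 C
  obtain ⟨ℓ, -, φ, hφ, hlim⟩ := hK
    (x := fun j => StrongDual.toWeakDual (InnerProductSpace.toDual ℂ H (x j))) (fun j => by
      simpa using hx j)
  refine ⟨φ, hφ, (InnerProductSpace.toDual ℂ H).symm (WeakDual.toStrongDual ℓ), fun v => ?_⟩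
  have h1 := ((WeakDual.eval_continuous v).tendsto ℓ).comp hlim
  have h2 := (Complex.continuous_conj.tendsto _).comp h1
  have h3 : (starRingEnd ℂ) (ℓ v) =
      inner ℂ v ((InnerProductSpace.toDual ℂ H).symm (WeakDual.toStrongDual ℓ)) := by
    rw [← inner_conj_symm, InnerProductSpace.toDual_symm_apply]
    rfl
  rw [← h3]
  refine h2.congr fun j => ?_
  rw [← inner_conj_symm]
  rfl

theorem exists_normed_le (φ : ContDiffBump (0 : EuclideanSpace ℝ (Fin d))) :
    ∃ M : ℝ, 0 ≤ M ∧ ∀ z, φ.normed volume z ≤ M := by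
  obtain ⟨M, hM⟩ := φ.continuous_normed.bounded_above_of_compact_support
    (φ.hasCompactSupport_normed (μ := (volume : Measure (EuclideanSpace ℝ (Fin d)))))
  exact ⟨M, (norm_nonneg _).trans (hM 0), fun z => (le_abs_self _).trans (hM z)⟩

/-- Supplies the constant majorant for dominated convergence in Rellich's theorem. -/
theorem enorm_smear_extendZero_sq_le (hΩ : MeasurableSet Ω)
    {φ : ContDiffBump (0 : EuclideanSpace ℝ (Fin d))} {M : ℝ} (hM : ∀ z, φ.normed volume z ≤ M)
    (s : ℝ) (u : L2 Ω) (x : EuclideanSpace ℝ (Fin d)) :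
    ‖smear φ s (extendZero Ω u) x‖ₑ ^ 2 ≤ ENNReal.ofReal M * ‖u‖ₑ ^ 2 := by
  refine (enorm_smear_sq_le φ s (measurable_extendZero hΩ u) x).trans ?_
  rw [← lintegral_extendZero hΩ,
    ← lintegral_sub_left_eq_self (fun z => ‖extendZero Ω u z‖ₑ ^ 2) (s • x),
    ← lintegral_const_mul' _ _ ENNReal.ofReal_ne_top]
  refine lintegral_mono fun z => ?_
  gcongr
  exact hM _

/-- Integration against a continuous compactly supported function is an inner product in `L²`. -/
theorem exists_integral_smul_eq_inner (Ω : Set (EuclideanSpace ℝ (Fin d)))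
    {ψ : EuclideanSpace ℝ (Fin d) → ℝ} (hψ : Continuous ψ) (hs : HasCompactSupport ψ) :
    ∃ κ : L2 Ω, ∀ u : L2 Ω, ∫ w in Ω, ψ w • u w = inner ℂ κ u := by
  have hL : MemLp (fun w => ((ψ w : ℝ) : ℂ)) 2 (volume.restrict Ω) :=
    ((Complex.continuous_ofReal.comp hψ).memLp_of_hasCompactSupport
      (hs.comp_left Complex.ofReal_zero)).restrict Ω
  refine ⟨hL.toLp, fun u => ?_⟩
  rw [L2.inner_def]
  refine integral_congr_ae ?_
  filter_upwards [hL.coeFn_toLp] with w hw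
  rw [hw, RCLike.inner_apply', Complex.conj_ofReal, Complex.real_smul]

/-- Point values of a smeared function are bounded functionals of u, hence converge along weakly
convergent sequences. -/
theorem exists_smear_extendZero_eq_inner (hΩ : MeasurableSet Ω)
    (φ : ContDiffBump (0 : EuclideanSpace ℝ (Fin d))) (s : ℝ) (x : EuclideanSpace ℝ (Fin d)) :
    ∃ κ : L2 Ω, ∀ u : L2 Ω, smear φ s (extendZero Ω u) x = inner ℂ κ u := by
  have hc : Continuous fun w => φ.normed volume (s • x - w) := by
    have := φ.continuous_normed (μ := (volume : Measure (EuclideanSpace ℝ (Fin d))))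
    fun_prop
  have hs : HasCompactSupport fun w => φ.normed volume (s • x - w) := by
    refine HasCompactSupport.of_support_subset_isCompact
      (isCompact_closedBall (s • x) φ.rOut) fun w hw => ?_
    rw [mem_closedBall_iff_norm']
    exact (norm_lt_rOut_of_normed_ne_zero (φ := φ) hw).le
  obtain ⟨κ, hκ⟩ := exists_integral_smul_eq_inner Ω hc hs
  exact ⟨κ, fun u => by rw [smear_eq_integral φ s hΩ, hκ]⟩

/-- Rellich's theorem: `H¹(Ω)` is compactly embedded in `L²(Ω)`. -/
theorem exists_tendsto_subseq_of_bounded (hΩ : StarContracting Ω R)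
    (U : ℕ → L2 Ω × (Fin d → L2 Ω)) (hU : ∀ j, U j ∈ H1 Ω) (C : ℝ) (h0 : ∀ j, ‖(U j).1‖ ≤ C)
    (h1 : ∀ j i, ‖(U j).2 i‖ ≤ C) :
    ∃ φ : ℕ → ℕ, StrictMono φ ∧ ∃ u, Tendsto (fun j => (U (φ j)).1) atTop (𝓝 u) := by
  have hm := hΩ.isOpen.measurableSet
  have : Fact ((2 : ℝ≥0∞) ≠ ⊤) := ⟨by norm_num⟩
  have : SecondCountableTopology (L2 Ω) := Lp.SecondCountableTopology
  have hfin : IsFiniteMeasure (volume.restrict Ω) := by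
    refine ⟨?_⟩
    rw [Measure.restrict_apply_univ]
    refine lt_of_le_of_lt (measure_mono fun x hx => ?_)
      (measure_closedBall_lt_top (x := (0 : EuclideanSpace ℝ (Fin d))) (r := R))
    simpa using hΩ.norm_le x hx
  obtain ⟨σ, hσ, u, hu⟩ := exists_weakly_convergent_subseq (fun j => (U j).1) C h0
  refine ⟨σ, hσ, u, ?_⟩
  obtain ⟨φ, s, ha, hs⟩ := hΩ.exists_admissible
  set S : ℕ → L2 Ω → EuclideanSpace ℝ (Fin d) → ℂ :=
    fun k v => smear (φ k) (s k) (extendZero Ω v) with hS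
  have hSc : ∀ k v, Continuous (S k v) := fun k v =>
    (contDiff_smear (locallyIntegrable_extendZero hm v)).continuous
  have hlimu : Tendsto (fun k => ∫⁻ x in Ω, ‖S k u x - u x‖ₑ ^ 2) atTop (𝓝 0) := by
    refine (tendsto_lintegral_smear_sub hΩ ha hs (measurable_extendZero hm u)
      (memLp_extendZero hm u)).congr fun k => ?_
    refine setLIntegral_congr_fun hm fun x hx => ?_
    simp only [hS, extendZero_of_mem u hx]
  set A : ℕ → ℝ≥0∞ := fun k => 8 * ENNReal.ofReal (4 * (((1 - s k) * (R + 1)) ^ 2 * 2 ^ d)) *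
    ∑ _i : Fin d, ENNReal.ofReal C ^ 2 with hA
  have hAlim : Tendsto A atTop (𝓝 (8 * 0 * ∑ _i : Fin d, ENNReal.ofReal C ^ 2)) := by
    refine ENNReal.Tendsto.mul_const (ENNReal.Tendsto.const_mul (tendsto_smear_const hs R d)
      (Or.inr (by norm_num))) (Or.inr ?_)
    exact (ENNReal.sum_lt_top.mpr fun i _ => ENNReal.pow_lt_top ENNReal.ofReal_lt_top).ne
  rw [mul_zero, zero_mul] at hAlim
  -- The gradient bound makes the smearing error uniform in j.
  have hUA : ∀ k j, ∫⁻ x in Ω, ‖S k (U j).1 x - (U j).1 x‖ₑ ^ 2 ≤ A k := by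
    intro k j
    refine (lintegral_smear_sub_sq_le_of_mem_H1 hΩ (ha k) (hU j)).trans ?_
    refine mul_le_mul_right (Finset.sum_le_sum fun i _ => pow_le_pow_left' ?_ 2) _
    rw [← ofReal_norm]
    exact ENNReal.ofReal_le_ofReal (h1 j i)
  -- At a fixed smearing level, weak convergence becomes bounded pointwise convergence, hence strong
  -- convergence.
  have hD : ∀ k, Tendsto (fun j => ∫⁻ x in Ω, ‖S k (U (σ j)).1 x - S k u x‖ₑ ^ 2) atTop
      (𝓝 0) := by
    intro k
    obtain ⟨M, hM0, hM⟩ := exists_normed_le (φ k)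
    have hpt : ∀ x, Tendsto (fun j => ‖S k (U (σ j)).1 x - S k u x‖ₑ ^ 2) atTop (𝓝 0) := by
      intro x
      obtain ⟨κ, hκ⟩ := exists_smear_extendZero_eq_inner hm (φ k) (s k) x
      have e1 : Tendsto (fun j => S k (U (σ j)).1 x - S k u x) atTop (𝓝 0) := by
        simp only [hS, hκ]
        simpa using (hu κ).sub_const (inner ℂ κ u)
      have e2 := ENNReal.Tendsto.pow (n := 2) e1.enorm
      simpa using e2
    have hbd : ∀ j, ∀ x, ‖S k (U (σ j)).1 x - S k u x‖ₑ ^ 2 ≤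
        2 * (ENNReal.ofReal M * ENNReal.ofReal C ^ 2 + ENNReal.ofReal M * ‖u‖ₑ ^ 2) := by
      intro j x
      rw [sub_eq_add_neg]
      refine (enorm_add_sq_le _ _).trans ?_
      rw [enorm_neg]
      refine mul_le_mul_right (add_le_add ?_ (enorm_smear_extendZero_sq_le hm hM _ u x)) _
      refine (enorm_smear_extendZero_sq_le hm hM _ _ x).trans ?_
      gcongr
      rw [← ofReal_norm]
      exact ENNReal.ofReal_le_ofReal (h0 _)
    have := tendsto_lintegral_of_dominated_convergence (μ := volume.restrict Ω)
      (F := fun j x => ‖S k (U (σ j)).1 x - S k u x‖ₑ ^ 2) (f := fun _ => 0)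
      (fun _ => 2 * (ENNReal.ofReal M * ENNReal.ofReal C ^ 2 + ENNReal.ofReal M * ‖u‖ₑ ^ 2))
      (fun j => ((hSc k _).sub (hSc k _)).enorm.measurable.pow_const 2)
      (fun j => Eventually.of_forall (hbd j)) ?_ (Eventually.of_forall hpt)
    · simpa using this
    · rw [lintegral_const]
      refine ENNReal.mul_ne_top (ENNReal.mul_ne_top (by norm_num) (ENNReal.add_ne_top.mpr ⟨?_, ?_⟩))
        (measure_ne_top _ _)
      · exact ENNReal.mul_ne_top ENNReal.ofReal_ne_top (ENNReal.pow_ne_top ENNReal.ofReal_ne_top)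
      · exact ENNReal.mul_ne_top ENNReal.ofReal_ne_top (ENNReal.pow_ne_top enorm_ne_top)
  have hsplit : ∀ k j, ‖(U (σ j)).1 - u‖ₑ ^ 2 ≤ 2 * (A k + 2 *
      ((∫⁻ x in Ω, ‖S k (U (σ j)).1 x - S k u x‖ₑ ^ 2) + ∫⁻ x in Ω, ‖S k u x - u x‖ₑ ^ 2)) := by
    intro k j
    rw [← lintegral_enorm_sq_eq]
    have hm1 : AEStronglyMeasurable (U (σ j)).1 (volume.restrict Ω) := Lp.aestronglyMeasurable _
    calc _ = ∫⁻ x in Ω, ‖((U (σ j)).1 x - S k (U (σ j)).1 x) +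
          ((S k (U (σ j)).1 x - S k u x) + (S k u x - u x))‖ₑ ^ 2 := by
          refine lintegral_congr_ae ?_
          filter_upwards [Lp.coeFn_sub (U (σ j)).1 u] with x hx
          rw [hx, Pi.sub_apply]
          congr 2
          ring
      _ ≤ 2 * ((∫⁻ x in Ω, ‖(U (σ j)).1 x - S k (U (σ j)).1 x‖ₑ ^ 2) +
          ∫⁻ x in Ω, ‖(S k (U (σ j)).1 x - S k u x) + (S k u x - u x)‖ₑ ^ 2) :=
          lintegral_enorm_add_sq_le (hm1.sub (hSc k _).aestronglyMeasurable)
      _ ≤ _ := by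
          refine mul_le_mul_right (add_le_add ?_ ?_) _
          · refine le_trans (le_of_eq (lintegral_congr fun x => ?_)) (hUA k (σ j))
            rw [← enorm_neg, neg_sub]
          · exact lintegral_enorm_add_sq_le ((hSc k _).sub (hSc k _)).aestronglyMeasurable
  have hsq : Tendsto (fun j => ‖(U (σ j)).1 - u‖ₑ ^ 2) atTop (𝓝 0) := by
    rw [ENNReal.tendsto_nhds_zero]
    intro ε hε
    have hε2 : 0 < ε / 2 := ENNReal.half_pos hε.ne'
    have hk : Tendsto (fun k => 2 * (A k + 2 * (0 + ∫⁻ x in Ω, ‖S k u x - u x‖ₑ ^ 2))) atTop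
        (𝓝 (2 * (0 + 2 * (0 + 0)))) :=
      ENNReal.Tendsto.const_mul (hAlim.add (ENNReal.Tendsto.const_mul (hlimu.const_add 0)
        (Or.inr (by norm_num)))) (Or.inr (by norm_num))
    simp only [add_zero, mul_zero] at hk
    -- The smearing level is fixed before j tends to infinity.
    obtain ⟨k, hk⟩ := ((tendsto_order.mp hk).2 ε hε).exists
    have hj : Tendsto (fun j => 2 * (A k + 2 * ((∫⁻ x in Ω, ‖S k (U (σ j)).1 x - S k u x‖ₑ ^ 2) +
        ∫⁻ x in Ω, ‖S k u x - u x‖ₑ ^ 2))) atTop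
        (𝓝 (2 * (A k + 2 * (0 + ∫⁻ x in Ω, ‖S k u x - u x‖ₑ ^ 2)))) :=
      ENNReal.Tendsto.const_mul (((ENNReal.Tendsto.const_mul ((hD k).add_const _)
        (Or.inr (by norm_num))).const_add _)) (Or.inr (by norm_num))
    filter_upwards [(tendsto_order.mp hj).2 ε hk] with j hj
    exact (hsplit k j).trans hj.le
  rw [tendsto_iff_norm_sub_tendsto_zero]
  have h2 := (ENNReal.tendsto_toReal ENNReal.zero_ne_top).comp hsq
  have h3 : Tendsto (fun j => ‖(U (σ j)).1 - u‖ ^ 2) atTop (𝓝 0) := by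
    simpa [Function.comp_def] using h2
  have h4 := h3.sqrt
  simpa using h4

end Compactness

/-! ### H¹ as a closed subspace containing the smooth functions. -/

section SobolevSpace

variable {d : ℕ} {Ω : Set (EuclideanSpace ℝ (Fin d))} {R : ℝ}

/-- With both sides written as inner products against fixed L² functions, linearity and closedness
of H¹ are inherited from the inner product. -/
theorem isWeakGradient_iff {u : L2 Ω} {g : Fin d → L2 Ω} : IsWeakGradient Ω u g ↔
    ∀ (i : Fin d) (φ : EuclideanSpace ℝ (Fin d) → ℝ),
    ContDiff ℝ ∞ φ → HasCompactSupport φ → tsupport φ ⊆ Ω → ∀ κ κ' : L2 Ω,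
      (∀ v : L2 Ω, ∫ x in Ω, (fderiv ℝ φ x (EuclideanSpace.single i 1)) • v x = inner ℂ κ' v) →
      (∀ v : L2 Ω, ∫ x in Ω, φ x • v x = inner ℂ κ v) → inner ℂ κ' u = -inner ℂ κ (g i) := by
  constructor
  · intro h i φ h1 h2 h3 κ κ' e1 e2
    rw [← e1, ← e2]
    exact h i φ h1 h2 h3
  · intro h i φ h1 h2 h3
    have h1c : Continuous fun x => fderiv ℝ φ x (EuclideanSpace.single i 1) :=
      (h1.continuous_fderiv (by simp)).clm_apply continuous_const
    obtain ⟨κ', e1⟩ := exists_integral_smul_eq_inner Ω h1c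
      ((h2.fderiv ℝ).comp_left (g := fun L : EuclideanSpace ℝ (Fin d) →L[ℝ] ℝ =>
        L (EuclideanSpace.single i 1)) rfl)
    obtain ⟨κ, e2⟩ := exists_integral_smul_eq_inner Ω h1.continuous h2
    rw [e1, e2]
    exact h i φ h1 h2 h3 κ κ' e1 e2

/-- `H¹(Ω)` as a linear subspace of `L²(Ω)^{1+d}`. -/
def h1Submodule (Ω : Set (EuclideanSpace ℝ (Fin d))) : Submodule ℂ (L2 Ω × (Fin d → L2 Ω)) where
  carrier := H1 Ω
  zero_mem' := by
    change IsWeakGradient Ω _ _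
    rw [isWeakGradient_iff]
    intros
    simp
  add_mem' := by
    intro U W hU hW
    change IsWeakGradient Ω _ _ at *
    rw [isWeakGradient_iff] at *
    intro i φ h1 h2 h3 κ κ' e1 e2
    rw [Prod.fst_add, Prod.snd_add, Pi.add_apply, inner_add_right, inner_add_right,
      hU i φ h1 h2 h3 κ κ' e1 e2, hW i φ h1 h2 h3 κ κ' e1 e2, neg_add]
  smul_mem' := by
    intro c U hU
    change IsWeakGradient Ω _ _ at *
    rw [isWeakGradient_iff] at *
    intro i φ h1 h2 h3 κ κ' e1 e2
    rw [Prod.smul_fst, Prod.smul_snd, Pi.smul_apply, inner_smul_right, inner_smul_right,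
      hU i φ h1 h2 h3 κ κ' e1 e2, mul_neg]

theorem mem_h1Submodule {U : L2 Ω × (Fin d → L2 Ω)} : U ∈ h1Submodule Ω ↔ U ∈ H1 Ω := Iff.rfl

theorem mem_H1_of_tendsto {U : ℕ → L2 Ω × (Fin d → L2 Ω)} (hU : ∀ k, U k ∈ H1 Ω) {u : L2 Ω}
    {g : Fin d → L2 Ω} (hu : Tendsto (fun k => (U k).1) atTop (𝓝 u))
    (hg : ∀ i, Tendsto (fun k => (U k).2 i) atTop (𝓝 (g i))) : (u, g) ∈ H1 Ω := by
  change IsWeakGradient Ω u g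
  rw [isWeakGradient_iff]
  intro i φ h1 h2 h3 κ κ' e1 e2
  refine tendsto_nhds_unique (tendsto_const_nhds.inner hu) ?_
  refine (tendsto_const_nhds.inner (hg i)).neg.congr fun k => ?_
  exact (isWeakGradient_iff.mp (hU k) i φ h1 h2 h3 κ κ' e1 e2).symm

theorem memLp_of_continuous (hΩ : StarContracting Ω R) {f : EuclideanSpace ℝ (Fin d) → ℂ}
    (hf : Continuous f) : MemLp f 2 (volume.restrict Ω) := by
  refine memLp_two_of_lintegral hf.aestronglyMeasurable ?_
  refine lt_of_eq_of_lt (lintegral_congr fun x => ?_)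
    (lintegral_ofReal_lt_top_of_continuous hΩ (hf.norm.pow 2))
  rw [Pi.pow_apply, ← ofReal_norm, ENNReal.ofReal_pow (norm_nonneg _)]

/-- Functions that are `C¹` on the whole space belong to `H¹(Ω)`. -/
theorem exists_mem_H1_of_contDiff (hΩ : StarContracting Ω R)
    {f : EuclideanSpace ℝ (Fin d) → ℂ} (hf : ContDiff ℝ 1 f) :
    ∃ U ∈ H1 Ω, U.1 =ᵐ[volume.restrict Ω] f ∧
      ∀ i, U.2 i =ᵐ[volume.restrict Ω] fun x => fderiv ℝ f x (EuclideanSpace.single i 1) := by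
  have hdc : ∀ i, Continuous fun x => fderiv ℝ f x (EuclideanSpace.single i 1) := fun i =>
    (hf.continuous_fderiv one_ne_zero).clm_apply continuous_const
  obtain ⟨W, hW⟩ : ∃ W : L2 Ω, W =ᵐ[volume.restrict Ω] f :=
    ⟨_, (memLp_of_continuous hΩ hf.continuous).coeFn_toLp⟩
  have hex : ∀ i, ∃ W : L2 Ω, W =ᵐ[volume.restrict Ω]
      fun x => fderiv ℝ f x (EuclideanSpace.single i 1) :=
    fun i => ⟨_, (memLp_of_continuous hΩ (hdc i)).coeFn_toLp⟩
  choose G hG using hex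
  refine ⟨(W, G), ?_, hW, hG⟩
  intro i φ h1 h2 h3
  have e1 : ∫ x in Ω, (fderiv ℝ φ x (EuclideanSpace.single i 1)) • W x =
      ∫ x, (fderiv ℝ φ x (EuclideanSpace.single i 1)) • f x := by
    rw [← setIntegral_eq_integral_of_forall_compl_eq_zero (s := Ω) (μ := volume)]
    · refine integral_congr_ae ?_
      filter_upwards [hW] with x hx
      rw [hx]
    · intro x hx
      rw [fderiv_of_notMem_tsupport (f := φ) ℝ fun h => hx (h3 h)]
      simp
  have e2 : ∫ x in Ω, φ x • G i x =
      ∫ x, φ x • fderiv ℝ f x (EuclideanSpace.single i 1) := by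
    rw [← setIntegral_eq_integral_of_forall_compl_eq_zero (s := Ω) (μ := volume)]
    · refine integral_congr_ae ?_
      filter_upwards [hG i] with x hx
      rw [hx]
    · intro x hx
      rw [image_eq_zero_of_notMem_tsupport fun h => hx (h3 h), zero_smul]
  have h1c : Continuous fun x => fderiv ℝ φ x (EuclideanSpace.single i 1) :=
    (h1.continuous_fderiv (by simp)).clm_apply continuous_const
  have h2' : HasCompactSupport fun x => fderiv ℝ φ x (EuclideanSpace.single i 1) :=
    (h2.fderiv ℝ).comp_left (g := fun L : EuclideanSpace ℝ (Fin d) →L[ℝ] ℝ =>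
        L (EuclideanSpace.single i 1)) rfl
  have hfc := hf.continuous
  have hφc := h1.continuous
  change ∫ x in Ω, (fderiv ℝ φ x (EuclideanSpace.single i 1)) • W x =
    -∫ x in Ω, φ x • G i x
  rw [e1, e2, integral_smul_fderiv_eq_neg_fderiv_smul_of_integrable, neg_neg]
  · exact (h1c.smul hfc).integrable_of_hasCompactSupport h2'.smul_right
  · exact (hφc.smul (hdc i)).integrable_of_hasCompactSupport h2.smul_right
  · exact (hφc.smul hfc).integrable_of_hasCompactSupport h2.smul_right
  · exact fun x _ => h1.differentiable (by simp) x
  · exact fun x _ => hf.differentiable one_ne_zero x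

end SobolevSpace

/-! ### Form-bounded perturbations of the Neumann Laplacian. -/

section FormBounded

variable {d : ℕ} {Ω : Set (EuclideanSpace ℝ (Fin d))} {R : ℝ}
  {V : EuclideanSpace ℝ (Fin d) → ℝ}

/-- `V` is form-bounded relative to the Neumann Laplacian with relative bound zero. -/
def IsFormSmall (Ω : Set (EuclideanSpace ℝ (Fin d))) (V : EuclideanSpace ℝ (Fin d) → ℝ) : Prop :=
  ∀ ε : ℝ, 0 < ε → ∃ C : ℝ, 0 ≤ C ∧ ∀ U ∈ H1 Ω,
    ∫⁻ x in Ω, ENNReal.ofReal (|V x| * ‖U.1 x‖ ^ 2) ≤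
      ENNReal.ofReal (ε * ∑ i, ‖U.2 i‖ ^ 2 + C * ‖U.1‖ ^ 2)

/-- Bound zero, unlike a fixed relative bound, survives every coupling constant. -/
theorem IsFormSmall.const_mul (hV : IsFormSmall Ω V) {t : ℝ} (ht : 0 < t) :
    IsFormSmall Ω fun x => t * V x := by
  intro ε hε
  obtain ⟨C, hC, h⟩ := hV (ε / t) (by positivity)
  refine ⟨t * C, by positivity, fun U hU => ?_⟩
  calc _ = ENNReal.ofReal t * ∫⁻ x in Ω, ENNReal.ofReal (|V x| * ‖U.1 x‖ ^ 2) := by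
        rw [← lintegral_const_mul' _ _ ENNReal.ofReal_ne_top]
        refine lintegral_congr fun x => ?_
        rw [← ENNReal.ofReal_mul ht.le, abs_mul, abs_of_pos ht, mul_assoc]
    _ ≤ ENNReal.ofReal t * ENNReal.ofReal (ε / t * ∑ i, ‖U.2 i‖ ^ 2 + C * ‖U.1‖ ^ 2) := by
        gcongr
        exact h U hU
    _ = _ := by
        rw [← ENNReal.ofReal_mul ht.le]
        congr 1
        field_simp

theorem IsFormSmall.integrable (hV : IsFormSmall Ω V) (hVm : Measurable V)
    {U : L2 Ω × (Fin d → L2 Ω)} (hU : U ∈ H1 Ω) :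
    Integrable (fun x => V x * ‖U.1 x‖ ^ 2) (volume.restrict Ω) := by
  obtain ⟨C, -, h⟩ := hV 1 one_pos
  refine ⟨(hVm.mul ((Lp.stronglyMeasurable U.1).measurable.norm.pow_const 2)).aestronglyMeasurable,
    ?_⟩
  refine lt_of_le_of_lt (le_of_eq_of_le (lintegral_congr fun x => ?_) (h U hU)) ENNReal.ofReal_lt_top
  rw [← ofReal_norm, norm_mul, Real.norm_eq_abs, norm_pow, norm_norm]

theorem IsFormSmall.abs_integral_le (hV : IsFormSmall Ω V) {ε : ℝ}
    (hε : 0 < ε) : ∃ C : ℝ, 0 ≤ C ∧ ∀ U ∈ H1 Ω,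
      |∫ x in Ω, V x * ‖U.1 x‖ ^ 2| ≤ ε * ∑ i, ‖U.2 i‖ ^ 2 + C * ‖U.1‖ ^ 2 := by
  obtain ⟨C, hC, h⟩ := hV ε hε
  refine ⟨C, hC, fun U hU => ?_⟩
  have hpos : 0 ≤ ε * ∑ i, ‖U.2 i‖ ^ 2 + C * ‖U.1‖ ^ 2 := by positivity
  rw [← ENNReal.ofReal_le_ofReal_iff hpos, ← Real.norm_eq_abs, ofReal_norm]
  refine (enorm_integral_le_lintegral_enorm _).trans
    (le_of_eq_of_le (lintegral_congr fun x => ?_) (h U hU))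
  rw [← ofReal_norm, norm_mul, Real.norm_eq_abs, norm_pow, norm_norm]

theorem formDomain_eq_H1 (hV : IsFormSmall Ω V) (hVm : Measurable V) : formDomain Ω V = H1 Ω :=
  Set.ext fun _ => ⟨fun h => h.1, fun h => ⟨h, hV.integrable hVm h⟩⟩

/-- Taking ε = 1/2 makes the form comparable with the H¹ norm, up to a multiple of the L² norm. -/
theorem exists_quadForm_bounds (hV : IsFormSmall Ω V) :
    ∃ C : ℝ, 0 ≤ C ∧ ∀ U ∈ H1 Ω,
      1 / 2 * ∑ i, ‖U.2 i‖ ^ 2 - C * ‖U.1‖ ^ 2 ≤ quadForm Ω V U ∧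
      quadForm Ω V U ≤ 3 / 2 * ∑ i, ‖U.2 i‖ ^ 2 + C * ‖U.1‖ ^ 2 := by
  obtain ⟨C, hC, h⟩ := hV.abs_integral_le (ε := 1 / 2) (by norm_num)
  refine ⟨C, hC, fun U hU => ?_⟩
  have := abs_le.mp (h U hU)
  unfold quadForm
  constructor <;> linarith [this.1, this.2]

/-- Sequences that are Cauchy both for the form and in L² have Cauchy gradients, so closedness
reduces to that of H¹. -/
theorem isWellPosed_of_isFormSmall (hΩ : StarContracting Ω R) (hV : IsFormSmall Ω V)
    (hVm : Measurable V) : IsWellPosed Ω V := by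
  obtain ⟨C, hC, hb⟩ := exists_quadForm_bounds hV
  rw [IsWellPosed, formDomain_eq_H1 hV hVm]
  refine ⟨?_, ⟨C, fun U hU => ?_⟩, ?_⟩
  · refine (Lp.dense_hasCompactSupport_contDiff (F := ℂ) (μ := volume.restrict Ω) (p := 2)
      (by norm_num)).mono ?_
    rintro u ⟨g, hug, -, hg⟩
    obtain ⟨U, hU, hU1, -⟩ := exists_mem_H1_of_contDiff hΩ
      (hg.of_le (by exact_mod_cast le_top) : ContDiff ℝ 1 g)
    exact ⟨U, hU, Lp.ext (hU1.trans hug.symm)⟩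
  · have h1 := (hb U hU).1
    have h2 : 0 ≤ ∑ i, ‖U.2 i‖ ^ 2 := Finset.sum_nonneg fun _ _ => by positivity
    linarith
  · intro U u hU hu hq
    have hsub : ∀ k l, U k - U l ∈ H1 Ω := fun k l =>
      (h1Submodule Ω).sub_mem (mem_h1Submodule.mpr (hU k)) (mem_h1Submodule.mpr (hU l))
    have hcau : Tendsto (fun p : ℕ × ℕ => ‖(U p.1).1 - (U p.2).1‖) atTop (𝓝 0) := by
      have := cauchySeq_iff_tendsto_dist_atTop_0.mp hu.cauchySeq
      simpa only [dist_eq_norm] using this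
    have hgrad : ∀ i, CauchySeq fun k => (U k).2 i := by
      intro i
      rw [cauchySeq_iff_tendsto_dist_atTop_0]
      have hup : Tendsto (fun p : ℕ × ℕ => √(2 * (quadForm Ω V (U p.1 - U p.2) +
          C * ‖(U p.1).1 - (U p.2).1‖ ^ 2))) atTop (𝓝 0) := by
        have := ((hq.add ((hcau.pow 2).const_mul C)).const_mul 2).sqrt
        simpa using this
      refine squeeze_zero (fun _ => dist_nonneg) (fun p => ?_) hup
      refine Real.le_sqrt_of_sq_le ?_
      have h1 := (hb _ (hsub p.1 p.2)).1
      have h2 : ‖(U p.1 - U p.2).2 i‖ ^ 2 ≤ ∑ i, ‖(U p.1 - U p.2).2 i‖ ^ 2 :=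
        Finset.single_le_sum (f := fun i => ‖(U p.1 - U p.2).2 i‖ ^ 2)
          (fun _ _ => by positivity) (Finset.mem_univ i)
      rw [dist_eq_norm]
      simp only [Prod.fst_sub, Prod.snd_sub, Pi.sub_apply] at h1 h2
      linarith
    choose g hg using fun i => cauchySeq_tendsto_of_complete (hgrad i)
    have hW : (u, g) ∈ H1 Ω := mem_H1_of_tendsto hU hu hg
    refine ⟨(u, g), hW, rfl, ?_⟩
    have hn1 : Tendsto (fun k => ‖(U k).1 - u‖ ^ 2) atTop (𝓝 0) := by
      simpa using ((hu.sub_const u).norm).pow 2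
    have hn2 : Tendsto (fun k => ∑ i, ‖(U k).2 i - g i‖ ^ 2) atTop (𝓝 0) := by
      have : Tendsto (fun k => ∑ i, ‖(U k).2 i - g i‖ ^ 2) atTop (𝓝 (∑ _i : Fin d, (0 : ℝ))) :=
        tendsto_finsetSum _ fun i _ => by simpa using (((hg i).sub_const (g i)).norm).pow 2
      simpa using this
    have hsW : ∀ k, U k - (u, g) ∈ H1 Ω := fun k =>
      (h1Submodule Ω).sub_mem (mem_h1Submodule.mpr (hU k)) (mem_h1Submodule.mpr hW)
    have hlo : Tendsto (fun k => 1 / 2 * ∑ i, ‖(U k).2 i - g i‖ ^ 2 - C * ‖(U k).1 - u‖ ^ 2) atTop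
        (𝓝 0) := by
      have := (hn2.const_mul (1 / 2)).sub (hn1.const_mul C)
      rwa [mul_zero, mul_zero, sub_zero] at this
    have hhi : Tendsto (fun k => 3 / 2 * ∑ i, ‖(U k).2 i - g i‖ ^ 2 + C * ‖(U k).1 - u‖ ^ 2) atTop
        (𝓝 0) := by
      have := (hn2.const_mul (3 / 2)).add (hn1.const_mul C)
      rwa [mul_zero, mul_zero, add_zero] at this
    exact tendsto_of_tendsto_of_tendsto_of_le_of_le hlo hhi (fun k => (hb _ (hsW k)).1)
      (fun k => (hb _ (hsW k)).2)

end FormBounded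

/-! ### The variational bound for the Schrödinger form. -/

section NegativeEigenvalues

variable {d : ℕ} {Ω : Set (EuclideanSpace ℝ (Fin d))} {R : ℝ}
  {V : EuclideanSpace ℝ (Fin d) → ℝ}

theorem IsFormSmall.integrable_inner (hV : IsFormSmall Ω V) (hVm : Measurable V)
    {U W : L2 Ω × (Fin d → L2 Ω)} (hU : U ∈ H1 Ω) (hW : W ∈ H1 Ω) :
    Integrable (fun x => (V x : ℂ) * inner ℂ (U.1 x) (W.1 x)) (volume.restrict Ω) := by
  refine ((hV.integrable hVm hU).norm.add (hV.integrable hVm hW).norm).mono' ?_ ?_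
  · have h1 : Measurable fun x => (V x : ℂ) := Complex.measurable_ofReal.comp hVm
    exact h1.aestronglyMeasurable.mul ((Lp.aestronglyMeasurable _).inner (Lp.aestronglyMeasurable _))
  · refine Eventually.of_forall fun x => ?_
    have h1 := norm_inner_le_norm (𝕜 := ℂ) (U.1 x) (W.1 x)
    simp only [norm_mul, Complex.norm_real, norm_pow, norm_norm, Pi.add_apply, ← mul_add]
    refine mul_le_mul_of_nonneg_left (h1.trans ?_) (norm_nonneg _)
    nlinarith [sq_nonneg (‖U.1 x‖ - ‖W.1 x‖), norm_nonneg (U.1 x), norm_nonneg (W.1 x)]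

theorem conj_form (U W : L2 Ω × (Fin d → L2 Ω)) :
    (starRingEnd ℂ) (form Ω V U W) = form Ω V W U := by
  simp only [form, map_add, map_sum, inner_conj_symm, ← integral_conj, map_mul, Complex.conj_ofReal]

theorem form_add_right (hV : IsFormSmall Ω V) (hVm : Measurable V)
    {U W W' : L2 Ω × (Fin d → L2 Ω)} (hU : U ∈ H1 Ω) (hW : W ∈ H1 Ω) (hW' : W' ∈ H1 Ω) :
    form Ω V U (W + W') = form Ω V U W + form Ω V U W' := by
  have h : ∫ x in Ω, (V x : ℂ) * inner ℂ (U.1 x) ((W.1 + W'.1 : L2 Ω) x) =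
      (∫ x in Ω, (V x : ℂ) * inner ℂ (U.1 x) (W.1 x)) +
        ∫ x in Ω, (V x : ℂ) * inner ℂ (U.1 x) (W'.1 x) := by
    rw [← integral_add (hV.integrable_inner hVm hU hW) (hV.integrable_inner hVm hU hW')]
    refine integral_congr_ae ?_
    filter_upwards [Lp.coeFn_add W.1 W'.1] with x hx
    rw [hx, Pi.add_apply, inner_add_right, mul_add]
  simp only [form, Prod.fst_add, Prod.snd_add, Pi.add_apply, inner_add_right,
    Finset.sum_add_distrib, h]
  ring

theorem form_smul_right (c : ℂ) (U W : L2 Ω × (Fin d → L2 Ω)) :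
    form Ω V U (c • W) = c * form Ω V U W := by
  have h : ∫ x in Ω, (V x : ℂ) * inner ℂ (U.1 x) ((c • W.1 : L2 Ω) x) =
      c * ∫ x in Ω, (V x : ℂ) * inner ℂ (U.1 x) (W.1 x) := by
    rw [← integral_const_mul]
    refine integral_congr_ae ?_
    filter_upwards [Lp.coeFn_smul c W.1] with x hx
    rw [hx, Pi.smul_apply, inner_smul_right]
    ring
  simp only [form, Prod.smul_fst, Prod.smul_snd, Pi.smul_apply, inner_smul_right, h, mul_add,
    Finset.mul_sum]

theorem quadForm_eq_re_form (U : L2 Ω × (Fin d → L2 Ω)) :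
    quadForm Ω V U = (form Ω V U U).re := by
  have h : ∫ x in Ω, (V x : ℂ) * inner ℂ (U.1 x) (U.1 x) =
      ((∫ x in Ω, V x * ‖U.1 x‖ ^ 2 : ℝ) : ℂ) := by
    refine Eq.trans ?_ (integral_ofReal (𝕜 := ℂ))
    refine integral_congr_ae (Eventually.of_forall fun x => ?_)
    simp only [inner_self_eq_norm_sq_to_K]
    push_cast
    rfl
  simp only [quadForm, form, h, Complex.add_re, Complex.re_sum, Complex.ofReal_re]
  congr 1
  refine Finset.sum_congr rfl fun i _ => ?_
  rw [inner_self_eq_norm_sq_to_K]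
  norm_cast

/-- The form of `-Δ + V` as a sesquilinear map on `H¹(Ω)`. -/
noncomputable def sesqForm (hV : IsFormSmall Ω V) (hVm : Measurable V) :
    h1Submodule Ω →ₗ⋆[ℂ] h1Submodule Ω →ₗ[ℂ] ℂ :=
  LinearMap.mk₂'ₛₗ (starRingEnd ℂ) (RingHom.id ℂ) (fun U W => form Ω V U W)
    (fun U U' W => by
      rw [← conj_form, Submodule.coe_add, form_add_right hV hVm W.2 U.2 U'.2, map_add, conj_form,
        conj_form])
    (fun c U W => by
      rw [← conj_form, Submodule.coe_smul, form_smul_right, map_mul, conj_form]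
      rfl)
    (fun U W W' => form_add_right hV hVm U.2 W.2 W'.2)
    (fun c U W => form_smul_right c _ _)

/-- A family of form-orthogonal functions in `H¹(Ω)` with negative energy bounds the number of
negative eigenvalues from below. -/
theorem le_numNegEigenvalues (hΩ : StarContracting Ω R) (hV : IsFormSmall Ω V)
    (hVm : Measurable V) {N : ℕ} (e : Fin N → L2 Ω × (Fin d → L2 Ω)) (he : ∀ i, e i ∈ H1 Ω)
    (horth : ∀ i j, i ≠ j → form Ω V (e i) (e j) = 0) (hneg : ∀ i, quadForm Ω V (e i) < 0) :
    (N : ℕ∞) ≤ numNegEigenvalues Ω V := by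
  obtain ⟨C, hC, hb⟩ := exists_quadForm_bounds hV
  obtain ⟨-, ⟨m, hm⟩, hcl⟩ := isWellPosed_of_isFormSmall hΩ hV hVm
  rw [formDomain_eq_H1 hV hVm] at hm hcl
  have hq : ∀ x : h1Submodule Ω, (sesqForm hV hVm x x).re = quadForm Ω V x := fun x =>
    (quadForm_eq_re_form _).symm
  have hset : {u : L2 Ω | ∃ μ : ℝ, μ < 0 ∧ (u, (μ : ℂ) • u) ∈ operatorGraph Ω V} =
      {u : L2 Ω | ∃ μ : ℝ, μ < 0 ∧ ∃ x : h1Submodule Ω,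
        ((LinearMap.fst ℂ (L2 Ω) (Fin d → L2 Ω)).comp (h1Submodule Ω).subtype) x = u ∧
          ∀ w : h1Submodule Ω, sesqForm hV hVm w x = inner ℂ
            (((LinearMap.fst ℂ (L2 Ω) (Fin d → L2 Ω)).comp (h1Submodule Ω).subtype) w)
              ((μ : ℂ) • u)} := by
    ext u
    simp only [operatorGraph, formDomain_eq_H1 hV hVm]
    constructor
    · rintro ⟨μ, hμ, U, hU, hUu, h⟩
      exact ⟨μ, hμ, ⟨U, hU⟩, hUu, fun w => h w w.2⟩
    · rintro ⟨μ, hμ, x, hx, h⟩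
      exact ⟨μ, hμ, x, x.2, hx, fun W hW => h ⟨W, hW⟩⟩
  have key := le_rank_span_negative_eigenvectors
    ((LinearMap.fst ℂ (L2 Ω) (Fin d → L2 Ω)).comp (h1Submodule Ω).subtype) (sesqForm hV hVm)
    (fun x y => conj_form _ _) m (fun x => by rw [hq]; exact hm x x.2)
    (fun x u hu hx => by
      simp only [hq] at hx ⊢
      obtain ⟨W, hW, hWu, hlim⟩ := hcl (fun k => (x k : L2 Ω × (Fin d → L2 Ω))) u
        (fun k => (x k).2) hu hx
      exact ⟨⟨W, hW⟩, hWu, hlim⟩)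
    -- Bounds on the form and on the L² norm bound the gradients, so Rellich's theorem provides the
    -- compactness.
    (fun x D h0 h1 => by
      simp only [hq] at h1
      refine exists_tendsto_subseq_of_bounded hΩ (fun k => (x k : L2 Ω × (Fin d → L2 Ω)))
        (fun k => (x k).2) (max D √(2 * (D + C * D ^ 2)))
        (fun k => (h0 k).trans (le_max_left _ _)) (fun k i => le_trans ?_ (le_max_right _ _))
      refine Real.le_sqrt_of_sq_le ?_
      have h2 := (hb _ (x k).2).1
      have h3 : ‖(x k : L2 Ω × (Fin d → L2 Ω)).2 i‖ ^ 2 ≤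
          ∑ i, ‖(x k : L2 Ω × (Fin d → L2 Ω)).2 i‖ ^ 2 :=
        Finset.single_le_sum (f := fun i => ‖(x k : L2 Ω × (Fin d → L2 Ω)).2 i‖ ^ 2)
          (fun _ _ => by positivity) (Finset.mem_univ i)
      have h4 : ‖(x k : L2 Ω × (Fin d → L2 Ω)).1‖ ^ 2 ≤ D ^ 2 :=
        pow_le_pow_left₀ (norm_nonneg _) (h0 k) 2
      have h5 := h1 k
      have h6 := mul_le_mul_of_nonneg_left h4 hC
      linarith)
    (fun i => ⟨e i, he i⟩) horth (fun i => by rw [hq]; exact hneg i)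
  rw [numNegEigenvalues, hset]
  exact key

/-- Version of `le_numNegEigenvalues` for `C¹` functions with disjoint supports. -/
theorem le_numNegEigenvalues_of_contDiff (hΩ : StarContracting Ω R) (hV : IsFormSmall Ω V)
    (hVm : Measurable V) {N : ℕ} (f : Fin N → EuclideanSpace ℝ (Fin d) → ℂ)
    (hf : ∀ i, ContDiff ℝ 1 (f i)) (hdisj : ∀ i j, i ≠ j → Disjoint (tsupport (f i)) (tsupport (f j)))
    (hneg : ∀ i, (∫ x in Ω, gradSq (f i) x) + ∫ x in Ω, V x * ‖f i x‖ ^ 2 < 0) :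
    (N : ℕ∞) ≤ numNegEigenvalues Ω V := by
  choose e he he0 he1 using fun i => exists_mem_H1_of_contDiff hΩ (hf i)
  have hdc : ∀ i l, Continuous fun x => fderiv ℝ (f i) x (EuclideanSpace.single l 1) := fun i l =>
    ((hf i).continuous_fderiv one_ne_zero).clm_apply continuous_const
  refine le_numNegEigenvalues hΩ hV hVm e he (fun i j hij => ?_) (fun i => ?_)
  · have hx : ∀ x, x ∉ tsupport (f i) ∨ x ∉ tsupport (f j) := fun x => by
      by_contra hc
      push Not at hc
      exact Set.disjoint_left.mp (hdisj i j hij) hc.1 hc.2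
    have h1 : ∀ l, inner ℂ ((e i).2 l) ((e j).2 l) = (0 : ℂ) := by
      intro l
      rw [L2.inner_def]
      refine integral_eq_zero_of_ae ?_
      filter_upwards [he1 i l, he1 j l] with x h2 h3
      rw [h2, h3]
      rcases hx x with h | h
      · rw [fderiv_of_notMem_tsupport ℝ h]; simp
      · rw [fderiv_of_notMem_tsupport ℝ h]; simp
    have h2 : ∫ x in Ω, (V x : ℂ) * inner ℂ ((e i).1 x) ((e j).1 x) = 0 := by
      refine integral_eq_zero_of_ae ?_
      filter_upwards [he0 i, he0 j] with x h2 h3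
      rw [h2, h3]
      rcases hx x with h | h
      · rw [image_eq_zero_of_notMem_tsupport h]; simp
      · rw [image_eq_zero_of_notMem_tsupport h]; simp
    simp only [form, h1, h2, Finset.sum_const_zero, add_zero]
  · refine lt_of_eq_of_lt ?_ (hneg i)
    unfold quadForm
    congr 1
    · unfold gradSq
      rw [integral_finsetSum]
      · refine Finset.sum_congr rfl fun l _ => ?_
        have h1 : ((‖(e i).2 l‖ ^ 2 : ℝ) : ℂ) =
            ((∫ x in Ω, ‖fderiv ℝ (f i) x (EuclideanSpace.single l 1)‖ ^ 2 : ℝ) : ℂ) := by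
          have h2 := inner_self_eq_norm_sq_to_K (𝕜 := ℂ) ((e i).2 l)
          rw [L2.inner_def] at h2
          refine Eq.trans (by push_cast; exact h2.symm)
            (Eq.trans (integral_congr_ae ?_) (integral_ofReal (𝕜 := ℂ)))
          filter_upwards [he1 i l] with x hx
          rw [hx, inner_self_eq_norm_sq_to_K]
          push_cast
          rfl
        exact_mod_cast h1
      · intro l _
        exact (memLp_of_continuous hΩ (hdc i l)).integrable_norm_pow two_ne_zero
    · refine integral_congr_ae ?_
      filter_upwards [he0 i] with x hx
      rw [hx]

end NegativeEigenvalues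

/-! ### The potential: integrability and form-smallness. -/

section CuspPotential

variable {n : ℕ} {γ : ℝ}

theorem starContracting_doubleCusp (h0 : 0 < γ) (h1 : γ ≤ 1) :
    StarContracting (doubleCusp n γ) 2 where
  isOpen := isOpen_doubleCusp h0
  radius_nonneg := zero_le_two
  norm_le := fun _ hx => (norm_lt_two_of_mem_doubleCusp h0 hx).le
  smul_mem := fun _ hx _ hs => smul_mem_doubleCusp h0 hs.1 hs.2 hx
  room := by
    intro s hs
    have hpos : 0 < 1 - s ^ γ := sub_pos.mpr (Real.rpow_lt_one hs.1.le hs.2 h0)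
    have hc : Tendsto (fun ε : ℝ => ε ^ γ + ε) (𝓝[>] 0) (𝓝 0) := by
      have : Continuous fun ε : ℝ => ε ^ γ + ε :=
        (continuous_id.rpow_const fun _ => Or.inr h0.le).add continuous_id
      have h := this.tendsto 0
      simp only [Real.zero_rpow h0.ne', add_zero] at h
      exact h.mono_left nhdsWithin_le_nhds
    obtain ⟨ε, hε, hε0⟩ := ((hc.eventually (gt_mem_nhds hpos)).and self_mem_nhdsWithin).exists
    exact ⟨ε, hε0, fun x hx z hz => smul_add_mem_doubleCusp h0 h1 hs.1 hs.2.le hε.le hx hz⟩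

/-- The logarithmic weight of the potential, as a function of the distance to the tip. -/
noncomputable def logWeight (n : ℕ) (r : ℝ) : ℝ := (2 - Real.log r) ^ (-(1 / ((n : ℝ) + 1)))

/-- The potential `-r⁻² (2 - log r)^(-1/d)`, where `r` is the height below the upper tip. -/
noncomputable def cuspPotential (n : ℕ) (x : EuclideanSpace ℝ (Fin (n + 1))) : ℝ :=
  -(((1 - x 0) ^ 2)⁻¹ * logWeight n (1 - x 0))

/-- The constant 2 keeps the base of the logarithmic weight at least 1 over the full range of depths
0 < r < 2. -/
theorem one_le_two_sub_log {r : ℝ} (h0 : 0 < r) (h2 : r < 2) : 1 ≤ 2 - Real.log r := by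
  linarith [Real.log_le_sub_one_of_pos h0]

theorem logWeight_pos {r : ℝ} (h0 : 0 < r) (h2 : r < 2) : 0 < logWeight n r :=
  Real.rpow_pos_of_pos (by linarith [one_le_two_sub_log h0 h2]) _

theorem logWeight_le_one {r : ℝ} (h0 : 0 < r) (h2 : r < 2) : logWeight n r ≤ 1 :=
  Real.rpow_le_one_of_one_le_of_nonpos (one_le_two_sub_log h0 h2)
    (neg_nonpos.mpr (by positivity))

theorem tendsto_logWeight : Tendsto (logWeight n) (𝓝[>] 0) (𝓝 0) := by
  have h1 : Tendsto (fun r : ℝ => 2 - Real.log r) (𝓝[>] 0) atTop := by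
    simp only [sub_eq_add_neg]
    exact tendsto_atTop_add_const_left _ 2
      (tendsto_neg_atBot_atTop.comp Real.tendsto_log_nhdsGT_zero)
  exact (tendsto_rpow_neg_atTop (y := 1 / ((n : ℝ) + 1)) (by positivity)).comp h1

theorem measurable_one_sub_head :
    Measurable fun x : EuclideanSpace ℝ (Fin (n + 1)) => 1 - x 0 := by
  have h : Continuous fun x : EuclideanSpace ℝ (Fin (n + 1)) => 1 - x 0 := by fun_prop
  exact h.measurable

theorem measurable_cuspPotential : Measurable (cuspPotential n) := by
  unfold cuspPotential logWeight
  have h1 := measurable_one_sub_head (n := n)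
  exact (((h1.pow_const 2).inv).mul ((h1.log.const_sub 2).pow_const _)).neg

theorem one_sub_head_mem_Ioo {x : EuclideanSpace ℝ (Fin (n + 1))} (hx : x ∈ doubleCusp n γ) :
    1 - x 0 ∈ Set.Ioo (0 : ℝ) 2 := by
  have := abs_lt.mp (abs_head_lt_one_of_mem hx)
  constructor <;> linarith [this.1, this.2]

theorem cuspPotential_nonpos {x : EuclideanSpace ℝ (Fin (n + 1))} (hx : x ∈ doubleCusp n γ) :
    cuspPotential n x ≤ 0 := by
  have h := one_sub_head_mem_Ioo hx
  have := logWeight_pos (n := n) h.1 h.2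
  unfold cuspPotential
  rw [neg_nonpos]
  positivity

theorem abs_cuspPotential {x : EuclideanSpace ℝ (Fin (n + 1))} (hx : x ∈ doubleCusp n γ) :
    |cuspPotential n x| = ((1 - x 0) ^ 2)⁻¹ * logWeight n (1 - x 0) := by
  rw [abs_of_nonpos (cuspPotential_nonpos hx), cuspPotential, neg_neg]

theorem lintegral_energy {d : ℕ} {Ω : Set (EuclideanSpace ℝ (Fin d))}
    {f : EuclideanSpace ℝ (Fin d) → ℂ} (hf : ContDiff ℝ 1 f) :
    ∫⁻ x in Ω, ENNReal.ofReal (gradSq f x + ‖f x‖ ^ 2) =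
      ∑ i, (∫⁻ x in Ω, ‖fderiv ℝ f x (EuclideanSpace.single i 1)‖ₑ ^ 2) +
        ∫⁻ x in Ω, ‖f x‖ₑ ^ 2 := by
  have hdc : ∀ i, Continuous fun x => fderiv ℝ f x (EuclideanSpace.single i 1) := fun i =>
    (hf.continuous_fderiv one_ne_zero).clm_apply continuous_const
  rw [← lintegral_finsetSum _ fun i _ => (hdc i).measurable.enorm.pow_const 2,
    ← lintegral_add_left (Finset.measurable_sum _ fun i _ => (hdc i).measurable.enorm.pow_const 2)]
  refine lintegral_congr fun x => ?_
  rw [ENNReal.ofReal_add (gradSq_nonneg _ _) (by positivity), ofReal_gradSq_eq,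
    ENNReal.ofReal_pow (norm_nonneg _), ofReal_norm]

/-- A function in `H¹` is an almost everywhere limit of smooth functions of bounded energy. -/
theorem exists_seq_tendsto_ae_energy_le {d : ℕ} {Ω : Set (EuclideanSpace ℝ (Fin d))} {R : ℝ}
    (hΩ : StarContracting Ω R) {U : L2 Ω × (Fin d → L2 Ω)} (hU : U ∈ H1 Ω) :
    ∃ f : ℕ → EuclideanSpace ℝ (Fin d) → ℂ, (∀ k, ContDiff ℝ 1 (f k)) ∧
      (∀ᵐ x ∂volume.restrict Ω, Tendsto (fun k => f k x) atTop (𝓝 (U.1 x))) ∧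
      ∃ b : ℕ → ℝ≥0∞, (∀ k, ∫⁻ x in Ω, ENNReal.ofReal (gradSq (f k) x + ‖f k x‖ ^ 2) ≤ b k) ∧
        Tendsto b atTop (𝓝 (ENNReal.ofReal (2 * (∑ i, ‖U.2 i‖ ^ 2 + ‖U.1‖ ^ 2)))) := by
  obtain ⟨f, hf, hlim, hlimd⟩ := exists_smooth_approx hΩ hU
  have hf1 : ∀ k, ContDiff ℝ 1 (f k) := fun k => (hf k).of_le (by exact_mod_cast le_top)
  -- L² convergence gives convergence in measure, hence almost everywhere along a subsequence.
  have hmeas : TendstoInMeasure (volume.restrict Ω) f atTop U.1 := by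
    refine tendstoInMeasure_of_tendsto_eLpNorm (p := 2) two_ne_zero
      (fun k => (hf k).continuous.aestronglyMeasurable) (Lp.aestronglyMeasurable _) ?_
    have h2 := hlim.ennrpow_const (1 / 2)
    rw [ENNReal.zero_rpow_of_pos (by norm_num)] at h2
    refine h2.congr fun k => ?_
    rw [show (∫⁻ x in Ω, ‖f k x - U.1 x‖ₑ ^ 2) = ∫⁻ x in Ω, ‖(f k - ⇑U.1) x‖ₑ ^ 2 from rfl,
      ← eLpNorm_two_sq, ← ENNReal.rpow_natCast, ← ENNReal.rpow_mul]
    norm_num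
  obtain ⟨ns, hns, hae⟩ := hmeas.exists_seq_tendsto_ae
  have hdc : ∀ k i, Continuous fun x => fderiv ℝ (f k) x (EuclideanSpace.single i 1) := fun k i =>
    ((hf1 k).continuous_fderiv one_ne_zero).clm_apply continuous_const
  set b : ℕ → ℝ≥0∞ := fun k => ∑ i, 2 * ((∫⁻ x in Ω,
    ‖fderiv ℝ (f k) x (EuclideanSpace.single i 1) - U.2 i x‖ₑ ^ 2) + ‖U.2 i‖ₑ ^ 2) +
      2 * ((∫⁻ x in Ω, ‖f k x - U.1 x‖ₑ ^ 2) + ‖U.1‖ₑ ^ 2) with hb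
  have hblim : Tendsto b atTop (𝓝 (∑ i, 2 * (0 + ‖U.2 i‖ₑ ^ 2) + 2 * (0 + ‖U.1‖ₑ ^ 2))) :=
    (tendsto_finsetSum _ fun i _ => ENNReal.Tendsto.const_mul ((hlimd i).add tendsto_const_nhds)
      (Or.inr ENNReal.ofNat_ne_top)).add
      (ENNReal.Tendsto.const_mul (hlim.add tendsto_const_nhds) (Or.inr ENNReal.ofNat_ne_top))
  have hval : ∑ i, 2 * (0 + ‖U.2 i‖ₑ ^ 2) + 2 * (0 + ‖U.1‖ₑ ^ 2) =
      ENNReal.ofReal (2 * (∑ i, ‖U.2 i‖ ^ 2 + ‖U.1‖ ^ 2)) := by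
    simp only [zero_add, ← Finset.mul_sum, ← mul_add, ← ofReal_norm,
      ← ENNReal.ofReal_pow (norm_nonneg _)]
    rw [← ENNReal.ofReal_sum_of_nonneg fun _ _ => by positivity,
      ← ENNReal.ofReal_add (Finset.sum_nonneg fun _ _ => by positivity) (by positivity),
      ENNReal.ofReal_mul zero_le_two, ENNReal.ofReal_ofNat]
  rw [hval] at hblim
  refine ⟨fun k => f (ns k), fun k => hf1 _, hae, fun k => b (ns k), fun k => ?_,
    hblim.comp hns.tendsto_atTop⟩
  rw [lintegral_energy (hf1 _)]
  refine add_le_add (Finset.sum_le_sum fun i _ => ?_) ?_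
  · have h := lintegral_enorm_add_sq_le (μ := volume.restrict Ω) (g := U.2 i)
      ((hdc (ns k) i).aestronglyMeasurable.sub (Lp.aestronglyMeasurable (U.2 i)))
    simpa only [Pi.sub_apply, sub_add_cancel, lintegral_enorm_sq_eq] using h
  · have h := lintegral_enorm_add_sq_le (μ := volume.restrict Ω) (g := U.1)
      ((hf (ns k)).continuous.aestronglyMeasurable.sub (Lp.aestronglyMeasurable U.1))
    simpa only [Pi.sub_apply, sub_add_cancel, lintegral_enorm_sq_eq] using h

/-- Hardy's inequality near the tip for functions in `H¹`. -/
theorem hardy_doubleCusp_of_mem_H1 (h0 : 0 < γ) (h1 : γ ≤ 1) (ha : 1 < n / γ) :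
    ∃ C : ℝ, 0 ≤ C ∧ ∀ U ∈ H1 (doubleCusp n γ),
      ∫⁻ x in doubleCusp n γ ∩ {x | 0 < x 0},
        ENNReal.ofReal (((1 - x 0) ^ 2)⁻¹ * ‖U.1 x‖ ^ 2) ≤
        ENNReal.ofReal (C * (∑ i, ‖U.2 i‖ ^ 2 + ‖U.1‖ ^ 2)) := by
  obtain ⟨C, hC, hH⟩ := hardy_doubleCusp (n := n) h0 h1 ha
  refine ⟨C * 2, by positivity, fun U hU => ?_⟩
  obtain ⟨f, hf, hae, b, hle, hb⟩ :=
    exists_seq_tendsto_ae_energy_le (starContracting_doubleCusp (n := n) h0 h1) hU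
  have hae' : ∀ᵐ x ∂volume.restrict (doubleCusp n γ ∩ {x | 0 < x 0}),
      Tendsto (fun k => f k x) atTop (𝓝 (U.1 x)) :=
    ae_restrict_of_ae_restrict_of_subset Set.inter_subset_left hae
  have hmk : ∀ k, Measurable fun x : EuclideanSpace ℝ (Fin (n + 1)) =>
      ENNReal.ofReal (((1 - x 0) ^ 2)⁻¹ * ‖f k x‖ ^ 2) := fun k =>
    (((measurable_one_sub_head.pow_const 2).inv).mul
      ((hf k).continuous.norm.measurable.pow_const 2)).ennreal_ofReal
  -- Fatou's lemma carries the inequality from smooth functions to H¹.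
  calc _ = ∫⁻ x in doubleCusp n γ ∩ {x | 0 < x 0}, liminf (fun k =>
        ENNReal.ofReal (((1 - x 0) ^ 2)⁻¹ * ‖f k x‖ ^ 2)) atTop := by
        refine lintegral_congr_ae ?_
        filter_upwards [hae'] with x hx
        exact (ENNReal.tendsto_ofReal ((hx.norm.pow 2).const_mul _)).liminf_eq.symm
    _ ≤ liminf (fun k => ∫⁻ x in doubleCusp n γ ∩ {x | 0 < x 0},
        ENNReal.ofReal (((1 - x 0) ^ 2)⁻¹ * ‖f k x‖ ^ 2)) atTop := lintegral_liminf_le hmk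
    _ ≤ liminf (fun k => ENNReal.ofReal C * b k) atTop :=
        liminf_le_liminf (Eventually.of_forall fun k => (hH _ (hf k)).trans
          (by gcongr; exact hle _))
    _ = _ := by
        rw [(ENNReal.Tendsto.const_mul hb (Or.inr ENNReal.ofReal_ne_top)).liminf_eq,
          ← ENNReal.ofReal_mul hC, mul_assoc]

/-- Below depth δ the logarithmic weight is at most η, so |V| is at most η times the Hardy weight;
at larger depths |V| ≤ δ⁻². -/
theorem isFormSmall_cuspPotential (h0 : 0 < γ) (h1 : γ ≤ 1) (ha : 1 < n / γ) :
    IsFormSmall (doubleCusp n γ) (cuspPotential n) := by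
  obtain ⟨C, hC, hH⟩ := hardy_doubleCusp_of_mem_H1 (n := n) h0 h1 ha
  intro ε hε
  set η := ε / (C + 1) with hη
  have hη0 : 0 < η := by positivity
  -- The bound δ ≤ 1 places depths below δ in the upper half, where Hardy's inequality is available.
  obtain ⟨δ, hδ, hδ1, hℓ⟩ : ∃ δ : ℝ, 0 < δ ∧ δ ≤ 1 ∧ ∀ r, 0 < r → r < δ → logWeight n r ≤ η := by
    have h := tendsto_logWeight (n := n) |>.eventually (ge_mem_nhds hη0)
    obtain ⟨δ, hδ, hs⟩ := mem_nhdsGT_iff_exists_Ioo_subset.mp h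
    exact ⟨min δ 1, lt_min hδ one_pos, min_le_right _ _,
      fun r hr hrδ => hs ⟨hr, hrδ.trans_le (min_le_left _ _)⟩⟩
  have hηC : η * C ≤ ε := by
    rw [hη, div_mul_eq_mul_div, div_le_iff₀ (by positivity)]
    nlinarith
  refine ⟨ε + (δ ^ 2)⁻¹, by positivity, fun U hU => ?_⟩
  have hΩm := (isOpen_doubleCusp (n := n) h0).measurableSet
  set S := {x : EuclideanSpace ℝ (Fin (n + 1)) | 0 < x 0} with hS
  have hSm : MeasurableSet S := (isOpen_lt continuous_const (by fun_prop)).measurableSet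
  set h : EuclideanSpace ℝ (Fin (n + 1)) → ℝ≥0∞ :=
    fun x => ENNReal.ofReal (((1 - x 0) ^ 2)⁻¹ * ‖U.1 x‖ ^ 2) with hh
  have hpt : ∀ x ∈ doubleCusp n γ, ENNReal.ofReal (|cuspPotential n x| * ‖U.1 x‖ ^ 2) ≤
      ENNReal.ofReal η * S.indicator h x + ENNReal.ofReal ((δ ^ 2)⁻¹) * ‖U.1 x‖ₑ ^ 2 := by
    intro x hx
    have hr := one_sub_head_mem_Ioo hx
    rw [abs_cuspPotential hx]
    by_cases hxδ : 1 - x 0 < δ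
    · refine le_add_right ?_
      rw [Set.indicator_of_mem (show x ∈ S by rw [hS, Set.mem_ofPred_eq]; linarith), hh,
        ← ENNReal.ofReal_mul hη0.le]
      refine ENNReal.ofReal_le_ofReal ?_
      rw [← mul_assoc]
      refine mul_le_mul_of_nonneg_right ?_ (by positivity)
      rw [mul_comm]
      exact mul_le_mul_of_nonneg_right (hℓ _ hr.1 hxδ) (by positivity)
    · refine le_add_left ?_
      rw [← ofReal_norm, ← ENNReal.ofReal_pow (norm_nonneg _), ← ENNReal.ofReal_mul (by positivity)]
      refine ENNReal.ofReal_le_ofReal (mul_le_mul_of_nonneg_right ?_ (by positivity))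
      push Not at hxδ
      refine (mul_le_of_le_one_right (by positivity) (logWeight_le_one hr.1 hr.2)).trans ?_
      gcongr
  calc _ ≤ ∫⁻ x in doubleCusp n γ,
        (ENNReal.ofReal η * S.indicator h x + ENNReal.ofReal ((δ ^ 2)⁻¹) * ‖U.1 x‖ₑ ^ 2) :=
        setLIntegral_mono' hΩm hpt
    _ = ENNReal.ofReal η * (∫⁻ x in doubleCusp n γ ∩ S, h x) +
        ENNReal.ofReal ((δ ^ 2)⁻¹) * ‖U.1‖ₑ ^ 2 := by
        rw [lintegral_add_right' _ (((Lp.aestronglyMeasurable U.1).enorm.pow_const 2).const_mul _),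
          lintegral_const_mul' _ _ ENNReal.ofReal_ne_top,
          lintegral_const_mul' _ _ ENNReal.ofReal_ne_top, lintegral_enorm_sq_eq,
          setLIntegral_indicator hSm, Set.inter_comm]
    _ ≤ ENNReal.ofReal η * ENNReal.ofReal (C * (∑ i, ‖U.2 i‖ ^ 2 + ‖U.1‖ ^ 2)) +
        ENNReal.ofReal ((δ ^ 2)⁻¹) * ‖U.1‖ₑ ^ 2 := by
        gcongr
        exact hH U hU
    _ ≤ _ := by
        have hs : 0 ≤ ∑ i, ‖U.2 i‖ ^ 2 := Finset.sum_nonneg fun _ _ => by positivity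
        rw [← ofReal_norm, ← ENNReal.ofReal_pow (norm_nonneg _), ← ENNReal.ofReal_mul hη0.le,
          ← ENNReal.ofReal_mul (by positivity), ← ENNReal.ofReal_add (by positivity) (by positivity)]
        refine ENNReal.ofReal_le_ofReal ?_
        rw [← mul_assoc]
        have := mul_le_mul_of_nonneg_right hηC
          (show 0 ≤ ∑ i, ‖U.2 i‖ ^ 2 + ‖U.1‖ ^ 2 by positivity)
        linarith

/-- Bounding the logarithm by one, the integral near the tip is that of r^(n/γ - (n + 1)), whose
exponent exceeds -1 precisely when n < n/γ. In the lower half, depth at least 1 makes the integrand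
at most 1. -/
theorem memLp_cuspPotential (h0 : 0 < γ) (hn : 1 ≤ n) (ha : n < n / γ) :
    MemLp (cuspPotential n) (((n + 1 : ℕ) : ℝ≥0∞) / 2) (volume.restrict (doubleCusp n γ)) := by
  refine ⟨measurable_cuspPotential.aestronglyMeasurable, ?_⟩
  have hp0 : ((n + 1 : ℕ) : ℝ≥0∞) / 2 ≠ 0 := by simp
  have hpt : ((n + 1 : ℕ) : ℝ≥0∞) / 2 ≠ ⊤ := ENNReal.div_ne_top (ENNReal.natCast_ne_top _) two_ne_zero
  rw [eLpNorm_lt_top_iff_lintegral_rpow_enorm_lt_top hp0 hpt]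
  have hp : (((n + 1 : ℕ) : ℝ≥0∞) / 2).toReal = ((n : ℝ) + 1) / 2 := by
    rw [ENNReal.toReal_div, ENNReal.toReal_natCast, ENNReal.toReal_ofNat]
    push_cast
    rfl
  rw [hp]
  have hΩm := (isOpen_doubleCusp (n := n) h0).measurableSet
  set S := {x : EuclideanSpace ℝ (Fin (n + 1)) | 0 < x 0} with hS
  have hSm : MeasurableSet S := (isOpen_lt continuous_const (by fun_prop)).measurableSet
  have hm : Measurable fun x : EuclideanSpace ℝ (Fin (n + 1)) =>
      ENNReal.ofReal ((1 - x 0) ^ (-((n : ℝ) + 1))) :=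
    (measurable_one_sub_head.pow_const _).ennreal_ofReal
  have hpt : ∀ x ∈ doubleCusp n γ, ‖cuspPotential n x‖ₑ ^ (((n : ℝ) + 1) / 2) ≤
      ENNReal.ofReal ((1 - x 0) ^ (-((n : ℝ) + 1))) := by
    intro x hx
    have hr := one_sub_head_mem_Ioo hx
    rw [← ofReal_norm, Real.norm_eq_abs, ENNReal.ofReal_rpow_of_nonneg (abs_nonneg _) (by positivity)]
    refine ENNReal.ofReal_le_ofReal ?_
    have h1 : |cuspPotential n x| ≤ (1 - x 0) ^ (-2 : ℝ) := by
      rw [abs_cuspPotential hx, Real.rpow_neg hr.1.le, Real.rpow_two]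
      exact mul_le_of_le_one_right (by positivity) (logWeight_le_one hr.1 hr.2)
    refine (Real.rpow_le_rpow (abs_nonneg _) h1 (by positivity)).trans_eq ?_
    rw [← Real.rpow_mul hr.1.le]
    congr 1
    ring
  refine (setLIntegral_mono' hΩm hpt).trans_lt ?_
  rw [← lintegral_inter_add_sdiff _ _ hSm, ENNReal.add_lt_top]
  constructor
  · rw [lintegral_upper_doubleCusp h0 hm, setLIntegral_congr_fun measurableSet_ball
      (g := fun _ => ∫⁻ r in Set.Ioo (0 : ℝ) 1, ENNReal.ofReal (r ^ (n / γ - (n + 1)))),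
      setLIntegral_const]
    · refine ENNReal.mul_lt_top ?_ measure_ball_lt_top
      have h2 : IntegrableOn (fun r : ℝ => r ^ (n / γ - (n + 1))) (Set.Ioo 0 1) :=
        (intervalIntegral.integrableOn_Ioo_rpow_iff one_pos).mpr (by linarith)
      exact h2.lintegral_lt_top
    · intro ξ _
      refine setLIntegral_congr_fun measurableSet_Ioo fun r hr => ?_
      simp only [glue_zero, sub_sub_cancel]
      rw [← ENNReal.ofReal_mul (Real.rpow_nonneg hr.1.le _), ← Real.rpow_add hr.1, sub_eq_add_neg]
  · have hvol : volume (doubleCusp n γ) < ⊤ := (isBounded_doubleCusp h0).measure_lt_top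
    refine (setLIntegral_mono' (g := fun _ => 1) (hΩm.diff hSm) fun x hx => ?_).trans_lt ?_
    · rw [ENNReal.ofReal_le_one]
      have : x 0 ≤ 0 := not_lt.mp hx.2
      exact Real.rpow_le_one_of_one_le_of_nonpos (by linarith) (by linarith)
    · rw [setLIntegral_one]
      exact (measure_mono Set.sdiff_subset).trans_lt hvol

end CuspPotential

/-! ### Dyadic trial functions and the eigenvalue count. -/

section TrialFunctions

variable {n : ℕ} {γ : ℝ}

/-- The points at distance between `α` and `β` below the level of the upper tip. -/
def slab (n : ℕ) (α β : ℝ) : Set (EuclideanSpace ℝ (Fin (n + 1))) := {x | 1 - x 0 ∈ Set.Icc α β}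

theorem measurableSet_slab (α β : ℝ) : MeasurableSet (slab n α β) :=
  measurable_one_sub_head measurableSet_Icc

theorem volume_doubleCusp_inter_slab (h0 : 0 < γ) {α β : ℝ} (hα : 0 < α) (hβ : β < 1) :
    volume (doubleCusp n γ ∩ slab n α β) =
      (∫⁻ r in Set.Icc α β, ENNReal.ofReal (r ^ (n / γ))) *
        volume (Metric.ball (0 : EuclideanSpace ℝ (Fin n)) 1) := by
  have hsub : slab n α β ⊆ {x | 0 < x 0} := fun x hx => by
    have := hx.2
    rw [Set.mem_ofPred_eq]
    linarith
  have hm := measurableSet_slab (n := n) α β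
  have hmem : ∀ (r : ℝ) (ξ : EuclideanSpace ℝ (Fin n)),
      glue n (1 - r) (r ^ (1 / γ) • ξ) ∈ slab n α β ↔ r ∈ Set.Icc α β := fun r ξ => by
    rw [slab, Set.mem_ofPred_eq, glue_zero, sub_sub_cancel]
  have hI : Set.Icc α β ∩ Set.Ioo 0 1 = Set.Icc α β :=
    Set.inter_eq_left.mpr fun r hr => ⟨hα.trans_le hr.1, hr.2.trans_lt hβ⟩
  rw [← Set.inter_eq_self_of_subset_right hsub, ← Set.inter_assoc, ← setLIntegral_one,
    Set.inter_comm, ← setLIntegral_indicator hm,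
    lintegral_upper_doubleCusp h0 (measurable_const.indicator hm),
    setLIntegral_congr_fun measurableSet_ball
      (g := fun _ => ∫⁻ r in Set.Icc α β, ENNReal.ofReal (r ^ (n / γ))), setLIntegral_const]
  intro ξ _
  change _ = ∫⁻ r in Set.Icc α β, _
  rw [← hI, ← setLIntegral_indicator measurableSet_Icc]
  refine lintegral_congr fun r => ?_
  by_cases hr : r ∈ Set.Icc α β
  · rw [Set.indicator_of_mem hr, Set.indicator_of_mem (hmem r ξ |>.mpr hr), mul_one]
  · rw [Set.indicator_of_notMem hr, Set.indicator_of_notMem (hmem r ξ |>.not.mpr hr), mul_zero]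

theorem measureReal_slab_le (h0 : 0 < γ) {α β : ℝ} (hα : 0 < α) (hαβ : α ≤ β) (hβ : β < 1) :
    volume.real (doubleCusp n γ ∩ slab n α β) ≤
      β ^ (n / γ) * (β - α) * volume.real (Metric.ball (0 : EuclideanSpace ℝ (Fin n)) 1) := by
  have hβ0 : 0 ≤ β := hα.le.trans hαβ
  rw [measureReal_def, volume_doubleCusp_inter_slab h0 hα hβ, ENNReal.toReal_mul]
  refine mul_le_mul_of_nonneg_right ?_ measureReal_nonneg
  refine ENNReal.toReal_le_of_le_ofReal
    (mul_nonneg (Real.rpow_nonneg hβ0 _) (sub_nonneg.mpr hαβ)) ?_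
  calc _ ≤ ∫⁻ _ in Set.Icc α β, ENNReal.ofReal (β ^ (n / γ)) :=
        setLIntegral_mono' measurableSet_Icc fun r hr => ENNReal.ofReal_le_ofReal
          (Real.rpow_le_rpow (hα.le.trans hr.1) hr.2 (by positivity))
    _ = _ := by
        rw [setLIntegral_const, Real.volume_Icc, ← ENNReal.ofReal_mul (Real.rpow_nonneg hβ0 _)]

theorem le_measureReal_slab (h0 : 0 < γ) {α β : ℝ} (hα : 0 < α) (hβ : β < 1) :
    α ^ (n / γ) * (β - α) * volume.real (Metric.ball (0 : EuclideanSpace ℝ (Fin n)) 1) ≤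
      volume.real (doubleCusp n γ ∩ slab n α β) := by
  have hfin : volume (doubleCusp n γ ∩ slab n α β) < ⊤ :=
    (measure_mono Set.inter_subset_left).trans_lt (isBounded_doubleCusp h0).measure_lt_top
  rw [measureReal_def, measureReal_def, ← ENNReal.ofReal_le_iff_le_toReal hfin.ne,
    volume_doubleCusp_inter_slab h0 hα hβ, ENNReal.ofReal_mul' ENNReal.toReal_nonneg,
    ENNReal.ofReal_toReal measure_ball_lt_top.ne]
  gcongr
  calc ENNReal.ofReal (α ^ (n / γ) * (β - α)) = ∫⁻ _ in Set.Icc α β, ENNReal.ofReal (α ^ (n / γ)) := by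
        rw [setLIntegral_const, Real.volume_Icc, ← ENNReal.ofReal_mul (Real.rpow_nonneg hα.le _)]
    _ ≤ _ := setLIntegral_mono' measurableSet_Icc fun r hr => ENNReal.ofReal_le_ofReal
          (Real.rpow_le_rpow hα.le hr.1 (by positivity))

/-- A bump equal to one on `[11/16, 13/16]` and supported in `[5/8, 7/8]`. -/
noncomputable def profile : ContDiffBump (3 / 4 : ℝ) where
  rIn := 1 / 16
  rOut := 1 / 8
  rIn_pos := by norm_num
  rIn_lt_rOut := by norm_num

theorem tsupport_profile : tsupport profile = Set.Icc (5 / 8) (7 / 8) := by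
  rw [profile.tsupport_eq, Real.closedBall_eq_Icc]
  norm_num [profile]

theorem profile_eq_one {r : ℝ} (hr : r ∈ Set.Icc (11 / 16 : ℝ) (13 / 16)) : profile r = 1 := by
  refine profile.one_of_mem_closedBall ?_
  rw [Real.closedBall_eq_Icc]
  refine Set.Icc_subset_Icc ?_ ?_ hr <;> norm_num [profile]

theorem exists_abs_deriv_profile_le : ∃ L : ℝ, 0 < L ∧ ∀ r, |deriv profile r| ≤ L := by
  have hc : Continuous (deriv profile) :=
    (profile.contDiff (n := 1)).continuous_deriv le_rfl
  obtain ⟨L, hL⟩ := hc.bounded_above_of_compact_support profile.hasCompactSupport.deriv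
  exact ⟨max L 1, by positivity, fun r => (hL r).trans (le_max_left _ _)⟩

/-- The profile rescaled to live at distance of order `2⁻ᵏ` from the upper tip. -/
noncomputable def trial (n k : ℕ) (x : EuclideanSpace ℝ (Fin (n + 1))) : ℂ :=
  (profile (2 ^ k * (1 - x 0)) : ℂ)

theorem contDiff_trial (k : ℕ) : ContDiff ℝ 1 (trial n k) := by
  have h : ContDiff ℝ 1 fun x : EuclideanSpace ℝ (Fin (n + 1)) => 2 ^ k * (1 - x 0) := by fun_prop
  exact Complex.ofRealCLM.contDiff.comp (profile.contDiff.comp h)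

theorem mem_slab_scaled_iff {k : ℕ} {α β : ℝ} {x : EuclideanSpace ℝ (Fin (n + 1))} :
    x ∈ slab n (α * (2 ^ k)⁻¹) (β * (2 ^ k)⁻¹) ↔ 2 ^ k * (1 - x 0) ∈ Set.Icc α β := by
  have h : (0 : ℝ) < 2 ^ k := by positivity
  simp only [slab, Set.mem_ofPred_eq, Set.mem_Icc, ← div_eq_mul_inv, div_le_iff₀ h, le_div_iff₀ h,
    mul_comm (2 ^ k : ℝ)]

theorem tsupport_trial_subset (k : ℕ) :
    tsupport (trial n k) ⊆ {x | 2 ^ k * (1 - x 0) ∈ Set.Icc (5 / 8 : ℝ) (7 / 8)} := by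
  have h : Continuous fun x : EuclideanSpace ℝ (Fin (n + 1)) => (2 ^ k * (1 - x 0) : ℝ) := by
    fun_prop
  refine closure_minimal (fun x hx => ?_) (isClosed_Icc.preimage h)
  rw [Set.mem_ofPred_eq, ← tsupport_profile]
  refine subset_tsupport _ ?_
  rw [Function.mem_support] at hx ⊢
  exact fun h0 => hx (by rw [trial, h0, Complex.ofReal_zero])

/-- Depths in the k-th support lie in 2⁻ᵏ [5/8, 7/8], and 7/8 < 2 · 5/8. -/
theorem disjoint_tsupport_trial {j k : ℕ} (hjk : j ≠ k) :
    Disjoint (tsupport (trial n j)) (tsupport (trial n k)) := by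
  wlog h : j < k generalizing j k
  · exact (this hjk.symm (by omega)).symm
  refine Set.disjoint_left.mpr fun x hj hk => ?_
  have h1 := (tsupport_trial_subset j hj).1
  have h2 := (tsupport_trial_subset k hk).2
  have h3 : (0 : ℝ) < 2 ^ j := by positivity
  have h4 : (2 : ℝ) ^ (j + 1) ≤ 2 ^ k := pow_le_pow_right₀ one_le_two h
  have h5 : 0 < 1 - x 0 := by
    by_contra hc
    nlinarith
  have h6 := mul_le_mul_of_nonneg_right h4 h5.le
  rw [pow_succ] at h6
  linarith

theorem norm_fderiv_trial_single (k : ℕ) (x : EuclideanSpace ℝ (Fin (n + 1))) (i : Fin (n + 1)) :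
    ‖fderiv ℝ (trial n k) x (EuclideanSpace.single i 1)‖ ≤
      2 ^ k * |deriv profile (2 ^ k * (1 - x 0))| := by
  have h1 : HasFDerivAt (fun x : EuclideanSpace ℝ (Fin (n + 1)) => 2 ^ k * (1 - x 0))
      ((2 ^ k : ℝ) • -(EuclideanSpace.proj (𝕜 := ℝ) (0 : Fin (n + 1)))) x :=
    ((EuclideanSpace.proj (𝕜 := ℝ) (0 : Fin (n + 1))).hasFDerivAt.const_sub 1).const_mul _
  have h2 := ((profile.contDiff (n := 1)).differentiable one_ne_zero
    (2 ^ k * (1 - x 0))).hasDerivAt.comp_hasFDerivAt x h1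
  have h3 : HasFDerivAt (trial n k) _ x := Complex.ofRealCLM.hasFDerivAt.comp x h2
  rw [h3.fderiv]
  have h4 : |(EuclideanSpace.single i (1 : ℝ) : EuclideanSpace ℝ (Fin (n + 1))) 0| ≤ 1 := by
    rw [PiLp.single_apply]
    split_ifs <;> simp
  simp only [ContinuousLinearMap.comp_apply, smul_apply,
    neg_apply, PiLp.proj_apply, smul_eq_mul, Complex.ofRealCLM_apply,
    Complex.norm_real, Real.norm_eq_abs, abs_mul, abs_neg, abs_pow, abs_two]
  have h5 : 0 ≤ 2 ^ k * |deriv profile (2 ^ k * (1 - x 0))| := by positivity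
  nlinarith [mul_le_mul_of_nonneg_left h4 h5]

theorem gradSq_trial_le {L : ℝ} (hL : ∀ r, |deriv profile r| ≤ L) (k : ℕ)
    (x : EuclideanSpace ℝ (Fin (n + 1))) :
    gradSq (trial n k) x ≤ (slab n (5 / 8 * (2 ^ k)⁻¹) (7 / 8 * (2 ^ k)⁻¹)).indicator
      (fun _ => (n + 1) * (4 ^ k * L ^ 2)) x := by
  by_cases hx : x ∈ slab n (5 / 8 * (2 ^ k)⁻¹) (7 / 8 * (2 ^ k)⁻¹)
  · rw [Set.indicator_of_mem hx, gradSq]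
    have h : ∀ i, ‖fderiv ℝ (trial n k) x (EuclideanSpace.single i 1)‖ ^ 2 ≤ 4 ^ k * L ^ 2 := by
      intro i
      have h1 : ‖fderiv ℝ (trial n k) x (EuclideanSpace.single i 1)‖ ≤ 2 ^ k * L :=
        (norm_fderiv_trial_single k x i).trans (by gcongr; exact hL _)
      refine (pow_le_pow_left₀ (norm_nonneg _) h1 2).trans_eq ?_
      rw [mul_pow, ← pow_mul, mul_comm k 2, pow_mul]
      norm_num
    refine (Finset.sum_le_sum fun i _ => h i).trans_eq ?_
    simp
  · rw [Set.indicator_of_notMem hx, gradSq]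
    have hx' : x ∉ tsupport (trial n k) := fun h =>
      hx (mem_slab_scaled_iff.mpr (tsupport_trial_subset k h))
    rw [fderiv_of_notMem_tsupport ℝ hx']
    simp

/-- Here 2 - log r ≤ 2 + (k + 1) log 2 ≤ k + 3. -/
theorem le_logWeight {k : ℕ} {r : ℝ} (h1 : (2 ^ (k + 1))⁻¹ ≤ r) (h2 : r < 2) :
    ((k : ℝ) + 3) ^ (-(1 / ((n : ℝ) + 1))) ≤ logWeight n r := by
  have hr : 0 < r := lt_of_lt_of_le (by positivity) h1
  refine Real.rpow_le_rpow_of_nonpos (by linarith [one_le_two_sub_log hr h2]) ?_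
    (neg_nonpos.mpr (by positivity))
  have h3 := Real.log_le_log (by positivity) h1
  rw [Real.log_inv, Real.log_pow] at h3
  have h4 : Real.log 2 ≤ 1 := by linarith [Real.log_le_sub_one_of_pos (zero_lt_two (α := ℝ))]
  push_cast at h3
  nlinarith [(Nat.cast_nonneg k : (0 : ℝ) ≤ k)]

/-- Only the plateau, where the trial function is one and r⁻² ≥ 4ᵏ, is kept; elsewhere the sign of V
suffices. -/
theorem cuspPotential_mul_trial_le (k : ℕ) {x : EuclideanSpace ℝ (Fin (n + 1))}
    (hx : x ∈ doubleCusp n γ) : cuspPotential n x * ‖trial n k x‖ ^ 2 ≤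
      (slab n (11 / 16 * (2 ^ k)⁻¹) (13 / 16 * (2 ^ k)⁻¹)).indicator
        (fun _ => -(4 ^ k * ((k : ℝ) + 3) ^ (-(1 / ((n : ℝ) + 1))))) x := by
  by_cases hs : x ∈ slab n (11 / 16 * (2 ^ k)⁻¹) (13 / 16 * (2 ^ k)⁻¹)
  · rw [Set.indicator_of_mem hs]
    have hr := one_sub_head_mem_Ioo hx
    have h2 : (0 : ℝ) < 2 ^ k := by positivity
    rw [trial, profile_eq_one (mem_slab_scaled_iff.mp hs), Complex.ofReal_one, norm_one, one_pow,
      mul_one, cuspPotential, neg_le_neg_iff]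
    have h3 : 1 - x 0 ≤ (2 ^ k)⁻¹ := hs.2.trans (mul_le_of_le_one_left (by positivity) (by norm_num))
    refine mul_le_mul ?_ (le_logWeight (le_trans ?_ hs.1) hr.2)
      (Real.rpow_nonneg (by positivity) _) (by positivity)
    · rw [show (4 : ℝ) = 2 ^ 2 by norm_num, ← pow_mul, mul_comm, pow_mul,
        ← inv_inv (((2 : ℝ) ^ k) ^ 2), ← inv_pow]
      exact inv_anti₀ (pow_pos hr.1 2) (pow_le_pow_left₀ hr.1.le h3 2)
    · rw [pow_succ, mul_inv, mul_comm]
      gcongr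
      norm_num
  · rw [Set.indicator_of_notMem hs]
    exact mul_nonpos_of_nonpos_of_nonneg (cuspPotential_nonpos hx) (by positivity)

theorem integrable_cuspPotential_mul_trial (h0 : 0 < γ) (hn : 1 ≤ n) (ha : n < n / γ) (k : ℕ) :
    Integrable (fun x => cuspPotential n x * ‖trial n k x‖ ^ 2)
      (volume.restrict (doubleCusp n γ)) := by
  have hfin : IsFiniteMeasure (volume.restrict (doubleCusp n γ)) :=
    ⟨by rw [Measure.restrict_apply_univ]; exact (isBounded_doubleCusp h0).measure_lt_top⟩
  have hV : Integrable (cuspPotential n) (volume.restrict (doubleCusp n γ)) := by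
    refine (memLp_cuspPotential h0 hn ha).integrable ?_
    rw [ENNReal.le_div_iff_mul_le (by simp) (by simp), one_mul]
    exact_mod_cast Nat.succ_le_succ hn
  refine hV.norm.mono' ((measurable_cuspPotential.mul
    ((contDiff_trial k).continuous.norm.measurable.pow_const 2)).aestronglyMeasurable) ?_
  refine Eventually.of_forall fun x => ?_
  rw [norm_mul, norm_pow, norm_norm]
  refine mul_le_of_le_one_right (norm_nonneg _) (pow_le_one₀ (norm_nonneg _) ?_)
  rw [trial, Complex.norm_real, Real.norm_eq_abs, abs_of_nonneg profile.nonneg]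
  exact profile.le_one

theorem setIntegral_indicator_slab (h0 : 0 < γ) (α β c : ℝ) :
    Integrable ((slab n α β).indicator fun _ => c) (volume.restrict (doubleCusp n γ)) ∧
    ∫ x in doubleCusp n γ, (slab n α β).indicator (fun _ => c) x =
      volume.real (doubleCusp n γ ∩ slab n α β) * c := by
  have hfin : IsFiniteMeasure (volume.restrict (doubleCusp n γ)) :=
    ⟨by rw [Measure.restrict_apply_univ]; exact (isBounded_doubleCusp h0).measure_lt_top⟩
  refine ⟨(integrable_const c).indicator (measurableSet_slab α β), ?_⟩
  rw [setIntegral_indicator (measurableSet_slab α β), setIntegral_const, smul_eq_mul]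

/-- The energy of the trial functions is negative up to a scale of order `t^d`. -/
theorem exists_energy_trial_neg (h0 : 0 < γ) (hn : 1 ≤ n) (ha : n < n / γ) :
    ∃ C : ℝ, 0 < C ∧ ∀ (t : ℝ) (k : ℕ), 0 < t → C < t * ((k : ℝ) + 3) ^ (-(1 / ((n : ℝ) + 1))) →
      (∫ x in doubleCusp n γ, gradSq (trial n k) x) +
        ∫ x in doubleCusp n γ, t * cuspPotential n x * ‖trial n k x‖ ^ 2 < 0 := by
  obtain ⟨L, hL0, hL⟩ := exists_abs_deriv_profile_le
  set a := (n : ℝ) / γ with haq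
  -- `A` and `B` come from the volumes of the support slab (above) and the plateau slab (below): an
  -- extremal depth to the power a times the width 7/8 - 5/8 or 13/16 - 11/16.
  set A := (7 / 8 : ℝ) ^ a * (1 / 4) with hA
  set B := (11 / 16 : ℝ) ^ a * (1 / 8) with hB
  have hA0 : 0 < A := by positivity
  have hB0 : 0 < B := by positivity
  refine ⟨(n + 1) * L ^ 2 * A / B, by positivity, fun t k ht hC => ?_⟩
  set q : ℝ := (2 ^ k)⁻¹ with hq
  have hq0 : 0 < q := by positivity
  have hq1 : q ≤ 1 := inv_le_one_of_one_le₀ (one_le_pow₀ one_le_two)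
  set v := volume.real (Metric.ball (0 : EuclideanSpace ℝ (Fin n)) 1) with hv
  have hv0 : 0 < v := ENNReal.toReal_pos (Metric.measure_ball_pos _ _ one_pos).ne'
    measure_ball_lt_top.ne
  set w : ℝ := ((k : ℝ) + 3) ^ (-(1 / ((n : ℝ) + 1))) with hw
  have hS : volume.real (doubleCusp n γ ∩ slab n (5 / 8 * q) (7 / 8 * q)) ≤
      A * (q ^ a * q * v) := by
    refine (measureReal_slab_le h0 (by positivity) (by linarith) (by linarith)).trans_eq ?_
    rw [Real.mul_rpow (by norm_num) hq0.le, hA]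
    ring
  have hP : B * (q ^ a * q * v) ≤
      volume.real (doubleCusp n γ ∩ slab n (11 / 16 * q) (13 / 16 * q)) := by
    refine Eq.trans_le ?_ (le_measureReal_slab h0 (by positivity) (by linarith))
    rw [Real.mul_rpow (by norm_num) hq0.le, hB]
    ring
  have hM : 0 < q ^ a * q * v := by positivity
  have h4 : (0 : ℝ) < 4 ^ k := by positivity
  have h1 : ∫ x in doubleCusp n γ, gradSq (trial n k) x ≤
      A * (q ^ a * q * v) * ((n + 1) * (4 ^ k * L ^ 2)) := by
    obtain ⟨hi, he⟩ := setIntegral_indicator_slab (n := n) h0 (5 / 8 * q) (7 / 8 * q)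
      ((n + 1) * (4 ^ k * L ^ 2))
    refine (integral_mono_of_nonneg (Eventually.of_forall fun x => gradSq_nonneg _ x) hi
      (Eventually.of_forall fun x => gradSq_trial_le hL k x)).trans ?_
    rw [he]
    exact mul_le_mul_of_nonneg_right hS (by positivity)
  have h2 : ∫ x in doubleCusp n γ, cuspPotential n x * ‖trial n k x‖ ^ 2 ≤
      -(B * (q ^ a * q * v) * (4 ^ k * w)) := by
    obtain ⟨hi, he⟩ := setIntegral_indicator_slab (n := n) h0 (11 / 16 * q) (13 / 16 * q)
      (-(4 ^ k * w))
    refine (setIntegral_mono_on (integrable_cuspPotential_mul_trial h0 hn ha k) hi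
      (isOpen_doubleCusp h0).measurableSet fun x hx => cuspPotential_mul_trial_le k hx).trans ?_
    rw [he, mul_neg, neg_le_neg_iff]
    exact mul_le_mul_of_nonneg_right hP (by positivity)
  simp only [mul_assoc t]
  rw [integral_const_mul]
  rw [div_lt_iff₀ hB0] at hC
  have h5 := mul_le_mul_of_nonneg_left h2 ht.le
  -- Both energies carry the factor 4ᵏ q^a q v, so the comparison depends on k only through the
  -- logarithmic weight.
  have h6 := mul_lt_mul_of_pos_right hC (mul_pos h4 hM)
  linarith

/-- The energy condition C < t (k + 3)^(-1/d) amounts to k + 3 < (t/C)^d, and the trial functions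
with k < N all satisfy it. -/
theorem exists_le_numNegEigenvalues (h0 : 0 < γ) (h1 : γ ≤ 1) (hn : 1 ≤ n) (ha : n < n / γ) :
    ∃ C : ℝ, 0 < C ∧ ∀ (t : ℝ) (N : ℕ), 0 < t → (N : ℝ) + 3 ≤ (t / C) ^ ((n : ℝ) + 1) →
      (N : ℕ∞) ≤ numNegEigenvalues (doubleCusp n γ) fun x => t * cuspPotential n x := by
  obtain ⟨C, hC, h⟩ := exists_energy_trial_neg (n := n) h0 hn ha
  have ha1 : 1 < n / γ := lt_of_le_of_lt (by exact_mod_cast hn) ha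
  refine ⟨C, hC, fun t N ht hN => ?_⟩
  refine le_numNegEigenvalues_of_contDiff (starContracting_doubleCusp h0 h1)
    ((isFormSmall_cuspPotential h0 h1 ha1).const_mul ht) (measurable_cuspPotential.const_mul t)
    (fun i => trial n i) (fun i => contDiff_trial i)
    (fun i j hij => disjoint_tsupport_trial (Fin.val_injective.ne hij)) fun i => h t i ht ?_
  have hk : ((i : ℕ) : ℝ) + 3 < (t / C) ^ ((n : ℝ) + 1) := by
    refine lt_of_lt_of_le ?_ hN
    have : ((i : ℕ) : ℝ) < N := by exact_mod_cast i.2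
    linarith
  have h2 : (((i : ℕ) : ℝ) + 3) ^ (1 / ((n : ℝ) + 1)) < t / C := by
    have := Real.rpow_lt_rpow (by positivity) hk (show 0 < 1 / ((n : ℝ) + 1) by positivity)
    rwa [← Real.rpow_mul (by positivity), mul_one_div_cancel (by positivity), Real.rpow_one] at this
  rw [lt_div_iff₀ hC, mul_comm] at h2
  rw [Real.rpow_neg (by positivity), ← div_eq_mul_inv, lt_div_iff₀ (by positivity)]
  exact h2

theorem tendsto_numNegEigenvalues_div (h0 : 0 < γ) (h1 : γ ≤ 1) (hn : 1 ≤ n) (ha : n < n / γ) :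
    Tendsto (fun t : ℝ => ((numNegEigenvalues (doubleCusp n γ)
      (fun x => t * cuspPotential n x) : ℕ∞) : ℝ≥0∞) /
        ENNReal.ofReal (t ^ (((n + 1 : ℕ) : ℝ) / 2))) atTop (𝓝 ⊤) := by
  obtain ⟨C, hC, h⟩ := exists_le_numNegEigenvalues (n := n) h0 h1 hn ha
  set s : ℝ := ((n + 1 : ℕ) : ℝ) / 2 with hs
  have hs0 : 0 < s := by positivity
  -- The quotient (t/C)^d / t^(d/2); the 4 covers the shift 3 and the rounding down to an integer,
  -- since t^s ≥ 1 for t ≥ 1.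
  have hlim : Tendsto (fun t : ℝ => (C ^ ((n : ℝ) + 1))⁻¹ * t ^ s - 4) atTop atTop :=
    tendsto_atTop_add_const_right _ _
      ((tendsto_rpow_atTop hs0).const_mul_atTop (by positivity))
  refine tendsto_of_tendsto_of_tendsto_of_le_of_le' (ENNReal.tendsto_ofReal_atTop.comp hlim)
    tendsto_const_nhds ?_ (Eventually.of_forall fun _ => le_top)
  filter_upwards [eventually_ge_atTop 1] with t ht
  have ht0 : 0 < t := by linarith
  have hts : 1 ≤ t ^ s := Real.one_le_rpow ht hs0.le
  have hts0 : 0 < t ^ s := by linarith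
  have hsq : (t / C) ^ ((n : ℝ) + 1) = (C ^ ((n : ℝ) + 1))⁻¹ * t ^ s * t ^ s := by
    rw [Real.div_rpow ht0.le hC.le, mul_assoc, ← Real.rpow_add ht0, hs, div_eq_inv_mul]
    congr 2
    push_cast
    ring
  rw [Function.comp_apply, ENNReal.le_div_iff_mul_le (Or.inl (by simpa using hts0))
    (Or.inl ENNReal.ofReal_ne_top), ← ENNReal.ofReal_mul' hts0.le]
  by_cases hbig : 3 ≤ (t / C) ^ ((n : ℝ) + 1)
  · have h3 := Nat.floor_le (sub_nonneg.mpr hbig)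
    have h4 := Nat.lt_floor_add_one ((t / C) ^ ((n : ℝ) + 1) - 3)
    have h5 := h t ⌊(t / C) ^ ((n : ℝ) + 1) - 3⌋₊ ht0 (by linarith)
    have h6 : ((⌊(t / C) ^ ((n : ℝ) + 1) - 3⌋₊ : ℕ) : ℝ≥0∞) ≤
        ((numNegEigenvalues (doubleCusp n γ) (fun x => t * cuspPotential n x) : ℕ∞) : ℝ≥0∞) := by
      exact_mod_cast ENat.toENNReal_le.mpr h5
    refine le_trans ?_ h6
    rw [← ENNReal.ofReal_natCast]
    refine ENNReal.ofReal_le_ofReal ?_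
    rw [sub_mul, ← hsq]
    linarith
  · rw [ENNReal.ofReal_of_nonpos]
    · exact zero_le
    · rw [sub_mul, ← hsq]
      linarith

end TrialFunctions

/-! ### The main theorem. -/

open NeumannSchrodinger in
theorem theorem1 (d : ℕ) (hd : 2 ≤ d) (γ : ℝ) (hγ : γ ∈ Set.Ioo (((d : ℝ) - 1) / d) 1) :
    ∃ (Ω : Set (EuclideanSpace ℝ (Fin d))) (V : EuclideanSpace ℝ (Fin d) → ℝ),
      IsHolderDomain γ Ω ∧
      Measurable V ∧ (∀ x ∈ Ω, V x ≤ 0) ∧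
      MemLp V ((d : ℝ≥0∞) / 2) (volume.restrict Ω) ∧
      (∀ t : ℝ, 0 < t → IsWellPosed Ω (fun x => t * V x)) ∧
      limsup (fun t : ℝ => ((numNegEigenvalues Ω (fun x => t * V x) : ℕ∞) : ℝ≥0∞) /
        ENNReal.ofReal (t ^ ((d : ℝ) / 2))) atTop = ⊤ := by
  obtain ⟨n, rfl⟩ : ∃ n, d = n + 1 := ⟨d - 1, by omega⟩
  have hn : 1 ≤ n := by omega
  have hn' : (1 : ℝ) ≤ n := by exact_mod_cast hn
  have h0 : 0 < γ := by
    refine lt_of_le_of_lt ?_ hγ.1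
    push_cast
    rw [add_sub_cancel_right]
    positivity
  -- This is where γ < 1 makes the cusp thin enough.
  have ha : (n : ℝ) < n / γ := by
    rw [lt_div_iff₀ h0]
    nlinarith [hγ.2]
  have hV := isFormSmall_cuspPotential h0 hγ.2.le (hn'.trans_lt ha)
  exact ⟨doubleCusp n γ, cuspPotential n, isHolderDomain_doubleCusp h0 hγ.2.le,
    measurable_cuspPotential, fun x hx => cuspPotential_nonpos hx, memLp_cuspPotential h0 hn ha,
    fun t ht => isWellPosed_of_isFormSmall (starContracting_doubleCusp h0 hγ.2.le)
      (hV.const_mul ht) (measurable_cuspPotential.const_mul t),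
    (tendsto_numNegEigenvalues_div h0 hγ.2.le hn ha).limsup_eq⟩
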